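/- Let $L_2=L_2(0,1)$ be the space of complex-valued square-integrable functions on $(0,1)$, with norm $|\cdot|_0$. For an integer $m\ge1$ let $W_2^m$ be the space of all $f\in L_2$ whose distributional derivatives $f',\dots,f^{(m)}$ are in $L_2$. For $s\ge0$ put $m=\max\{2,\lceil s\rceil\}$ and let $W_2^s$, with norm $|\cdot|_s$, be - $L_2$ with the norm $|\cdot|_0$ if $s=0$; - $W_2^m$ with the norm $|f|_m=\bigl(\sum_{k=0}^m|f^{(k)}|_0^2\bigr)^{1/2}$ if $s=m$; - the complex interpolation space of exponent $\theta=s/m$ between $L_2$ (at $\theta=0$) and $W_2^m$ (at $\theta=1$), with its norm, otherwise (so for $0<s<2$ one interpolates between $L_2$ and $W_2^2$). For $k\ge1$, $y\in\mathbb R^k$ and $s\in(0,1)$ let $\xi_k(y)=\sum_{l=1}^k(-1)^{l+1}y_l$ and $$\Pi_k^*(s)=\{y\in\mathbb R^k : 0\le y_k\le y_{k-1}\le\dots\le y_1\le s+\xi_k(y)\le1\}.$$ For $n\ge2$ and $f_1,\dots,f_n\in L_2$ let $$I_n(f_1,\dots,f_n)(s)=\int_{\Pi_{n-1}^*(s)}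 f_1(s+\xi_{n-1}(y))\,f_2(y_1)\cdots f_n(y_{n-1})\,dy_1\cdots dy_{n-1},\qquad s\in(0,1).$$ **Theorem.** Let $\alpha\in[0,1]$. (a) There is a constant $C>0$ such that for all $n\ge2$ and all $f_1,\dots,f_n\in W_2^\alpha$ the integral defining $g=I_n(f_1,\dots,f_n)$ converges absolutely for almost every $s\in(0,1)$, $g\in W_2^{2\alpha}$, and, with $r=\max\{0,n-5\}$, $$|g|_{2\alpha}\le\frac{C}{\sqrt{r!}}\prod_{l=1}^n|f_l|_\alpha.$$ (b) There is a constant $C>0$ such that for all $n\ge4$ and all $f_1,\dots,f_n\in W_2^\alpha$ the function $g=I_n(f_1,\dots,f_n)$ belongs to $W_2^{3\alpha}$ and, with $r=\max\{0,n-7\}$, $$|g|_{3\alpha}\le\frac{C}{\sqrt{r!}}\prod_{l=1}^n|f_l|_\alpha.$$ In both parts $C$ does not depend on $n$ or on $f_1,\dots,f_n$ (it may depend on $\alpha$). -/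

import Mathlib

open MeasureTheory Filter Topology Complex
open scoped ENNReal ContDiff

noncomputable section

namespace IntervalSobolev

/-- Lebesgue measure on the interval `(0,1)`. -/
abbrev μ : Measure ℝ := volume.restrict (Set.Ioo (0 : ℝ) 1)

/-- The complex space `L₂ = L₂(0,1)`. -/
abbrev L2 : Type := Lp ℂ 2 μ

/-- `g` is the distributional derivative of `f` on `(0,1)`: `∫ φ' f = - ∫ φ g` for all smooth `φ`
whose support is a compact subset of `(0,1)`. -/
def HasWeakDeriv (f g : L2) : Prop :=
  ∀ φ : ℝ → ℝ, ContDiff ℝ ∞ φ → HasCompactSupport φ → tsupport φ ⊆ Set.Ioo (0 : ℝ) 1 →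
    ∫ x, deriv φ x • f x ∂μ = - ∫ x, φ x • g x ∂μ

/-- `D k` is the `k`-th distributional derivative of `f`, for `k = 0, …, m`. -/
def IsWeakJet (m : ℕ) (f : L2) (D : Fin (m + 1) → L2) : Prop :=
  D 0 = f ∧ ∀ k : Fin m, HasWeakDeriv (D k.castSucc) (D k.succ)

/-- The norm `(∑_{k ≤ m} |f^{(k)}|₀²)^{1/2}` of the Sobolev space `W^m_2(0,1)` of integer order `m`;
it is `∞` when some distributional derivative `f^{(k)}`, `k ≤ m`, is not in `L₂`. (The family `D` of
distributional derivatives is unique if it exists, so the infimum is over at most one family.) -/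
def intENorm (m : ℕ) (f : L2) : ℝ≥0∞ :=
  ⨅ (D : Fin (m + 1) → L2) (_ : IsWeakJet m f D), (∑ k, ‖D k‖ₑ ^ 2) ^ (1 / 2 : ℝ)

/-- The functions admitted in the complex interpolation method for the couple `(L₂, W^m_2)`:
bounded continuous functions on the closed strip `0 ≤ Re z ≤ 1` with values in
`L₂ + W^m_2 = L₂`, analytic in the open strip, such that `t ↦ F (it)` and `t ↦ F (1 + it)` are
continuous functions with values in `L₂` and `W^m_2` respectively, tending to zero as `|t| → ∞`.
(Continuity of `t ↦ F (it)` in `L₂` is contained in `diffContOnCl`.) -/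
structure Admissible (m : ℕ) (F : ℂ → L2) : Prop where
  diffContOnCl : DiffContOnCl ℂ F (HadamardThreeLines.verticalStrip 0 1)
  bounded : ∃ C : ℝ, ∀ z ∈ HadamardThreeLines.verticalClosedStrip 0 1, ‖F z‖ ≤ C
  zero_left : Tendsto (fun t : ℝ => F (t * I)) (cocompact ℝ) (𝓝 0)
  mem_right : ∀ t : ℝ, intENorm m (F (1 + t * I)) < ⊤
  continuous_right : ∀ t₀ : ℝ,
    Tendsto (fun t : ℝ => intENorm m (F (1 + t * I) - F (1 + t₀ * I))) (𝓝 t₀) (𝓝 0)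
  zero_right : Tendsto (fun t : ℝ => intENorm m (F (1 + t * I))) (cocompact ℝ) (𝓝 0)

/-- The norm of the complex interpolation space between `L₂` (at `θ = 0`) and `W^m_2` (at `θ = 1`);
it is `∞` outside that space. -/
def interpENorm (m : ℕ) (θ : ℝ) (f : L2) : ℝ≥0∞ :=
  ⨅ (F : ℂ → L2) (_ : Admissible m F ∧ F θ = f),
    max (⨆ t : ℝ, ‖F (t * I)‖ₑ) (⨆ t : ℝ, intENorm m (F (1 + t * I)))

open Classical in
/-- The norm `|f|_s` of `W^s_2(0,1)`, `s ≥ 0`, with value `∞` if `f ∉ W^s_2`. It is the `L₂` norm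
for `s = 0`, and with `m = max {2, ⌈s⌉}` it is the norm of `W^m_2` for `s = m`, and otherwise the
interpolation norm at `θ = s / m` between `L₂` and `W^m_2`. In particular all spaces with
`0 < s < 2` are interpolated between `L₂` and `W²_2`. -/
def sobolevENorm (s : ℝ) (f : L2) : ℝ≥0∞ :=
  if s = 0 then ‖f‖ₑ
  else if s = (max 2 ⌈s⌉₊ : ℕ) then intENorm (max 2 ⌈s⌉₊) f
  else interpENorm (max 2 ⌈s⌉₊) (s / (max 2 ⌈s⌉₊ : ℕ)) f

/-- `|u|_s` for a function `u` on `(0,1)`; it is `∞` if `u ∉ L₂` or `u ∉ W^s_2`. -/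
def wENorm (s : ℝ) (u : ℝ → ℂ) : ℝ≥0∞ :=
  ⨅ h : MemLp u 2 μ, sobolevENorm s (h.toLp u)

/-- The (class of the) function `u` belongs to `W^s_2(0,1)`. -/
def MemW (s : ℝ) (u : ℝ → ℂ) : Prop := wENorm s u < ⊤

/-- The norm `|u|_s` as a real number, meaningful for `u ∈ W^s_2(0,1)`. -/
def wNorm (s : ℝ) (u : ℝ → ℂ) : ℝ := (wENorm s u).toReal

/-- `ξ_k(y) = ∑_{l=1}^k (-1)^{l+1} y_l`, the variable `y_l` being `y (l - 1)`. -/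
def xi {k : ℕ} (y : Fin k → ℝ) : ℝ := ∑ l : Fin k, (-1 : ℝ) ^ (l : ℕ) * y l

/-- The set of `y ∈ ℝ^k` with `0 ≤ y_k ≤ … ≤ y_1 ≤ s + ξ_k(y) ≤ 1`. -/
def PiStar (k : ℕ) (s : ℝ) : Set (Fin k → ℝ) :=
  {y | Antitone y ∧ (∀ l, 0 ≤ y l) ∧ (∀ l, y l ≤ s + xi y) ∧ s + xi y ≤ 1}

/-- The product `f_1(s + ξ_{n-1}(y)) f_2(y_1) ⋯ f_n(y_{n-1})`, `f_l` being `f (l - 1)`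
(with a dummy value for `n = 0`). -/
def integrand : (n : ℕ) → (Fin n → ℝ → ℂ) → ℝ → (Fin (n - 1) → ℝ) → ℂ
  | 0, _, _, _ => 0
  | k + 1, f, s, y => f 0 (s + xi (k := k) y) * ∏ l : Fin k, f l.succ (y l)

/-- The mapping `I_n`. -/
def In (n : ℕ) (f : Fin n → ℝ → ℂ) (s : ℝ) : ℂ :=
  ∫ y in PiStar (n - 1) s, integrand n f s y

end IntervalSobolev

end

/-!
The operator `I_n` maps products of `L₂` functions to `L₂` with norm at most `1 / √((n - 1)!)`. On
functions with a weak derivative it gains one derivative, and for `n ≥ 4` two. The theorem is the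
complex interpolation of these facts, and the point is that the number of factors on which a
constant is lost stays bounded, so that no power `K^n` appears.

**Boundedness in `L₂`** (`norm_Iop_le`). Integrating the last variable out last expresses `I_{k+1}`
through `I_k` on the domain in which all variables are bounded below by that variable. By induction,
the mean square of the integral over `u ≤ y_k ≤ … ≤ y_1 ≤ s + ξ_k(y) ≤ 1` is at most
`(1 - u)^k / k! ∏ |f_l|₀²`.

**Smooth functions** (`reg_two`, `reg_three`). After the reflection `x ↦ 1 - x` the recursion reads
`I_{k+1} = (V_{g_{k+1}} ⋯ V_{g_2} g_1)(x, 1)` with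
`V_f B (x, v) = ∫_x^v f(τ) B(τ - x, τ) dτ`, where `x` is `s` or `1 - s` (`In_refl`). A derivative in
`x` may be put on the first, the second or the third function; in the boundary terms there are
fewer functions, and products such as `g(x) ∫_0^x f h` among them. The first derivative is put on `g_1`, the next one on `g_2`, which is still differentiable whereas `g_1'` need
not be, and, where `g_2'` occurs, the last one on `g_3`. Each estimate uses only a few sup norms and
derivatives, and Cauchy–Schwarz yields a factor `1 / √(j!)` for the `j` operators that are left.
Smoothing carries the bounds over to all functions with a weak derivative (`exists_isWeakJet_two`,
`exists_isWeakJet_three`).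

**Intermediate derivatives** (`intENorm_one_le`, `intENorm_two_le`). If `F` is holomorphic in the
strip with boundary values in `L₂` and `W²_2`, then `F(1/2 + it)` is in `W^1_2`. For the proof the
norm of the first derivative, with the weights `1 - x` and `x`, is dominated by a sesquilinear form
`a(u, v)` (`form`) such that integration by parts in either argument has no boundary terms; the
maximum principle is applied to `z ↦ a(F(1 - z̄), F(z))`, which is holomorphic. The same form, used
for the derivative of order one and two, gives `F(2/3 + it)` in `W²_2` for boundary values in
`W³_2`.

**Interpolation** (`interpENorm_Iop_le`). If `F_l` is admissible for `f_l` at `α/2`, then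
`I_n(F_1(z/2), …, F_n(z/2)) exp(z² - α²)` is admissible for `(L₂, W^m_2)`, `m = 2, 3`, with value
`I_n(f_1, …, f_n)` at `α`. Since the values of `F_l` on the middle line of the strip are bounded in
`L₂` by the norm of `F_l` itself, with constant one, and only their derivatives by a multiple of it,
the constants are uniform in `n`. For `α < 1` this bounds the norm in part (a) if `m = 2`, and the
norm in part (b) for `α > 2/3` if `m = 3`; for `α = 1` the bounds on the middle line suffice. For
`α ≤ 2/3` the space of order `3 α` belongs to the couple `(L₂, W²_2)`, and one passes from
`(L₂, W³_2)` to this couple by restricting to `0 ≤ Re z ≤ 2/3` (`interpENorm_two_le`).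
-/

noncomputable section

namespace IntervalSobolev

/-! ### Weak derivatives and jets -/

lemma integrable_test_smul {φ : ℝ → ℝ} (hφ : Continuous φ) (hc : HasCompactSupport φ) (f : L2) :
    Integrable (fun x => φ x • f x) μ := by
  have hf : Integrable f μ := (Lp.memLp f).integrable (by norm_num)
  obtain ⟨C, hC⟩ := hφ.bounded_above_of_compact_support hc
  exact hf.bdd_smul C hφ.aestronglyMeasurable (Eventually.of_forall hC)

lemma integral_test_add {φ : ℝ → ℝ} (hφ : Continuous φ) (hc : HasCompactSupport φ) (f g : L2) :
    ∫ x, φ x • (f + g : L2) x ∂μ = ∫ x, φ x • f x ∂μ + ∫ x, φ x • g x ∂μ := by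
  rw [← integral_add (integrable_test_smul hφ hc f) (integrable_test_smul hφ hc g)]
  refine integral_congr_ae ?_
  filter_upwards [Lp.coeFn_add f g] with x hx
  simp only [hx, Pi.add_apply, smul_add]

lemma integral_test_smul (φ : ℝ → ℝ) (c : ℂ) (f : L2) :
    ∫ x, φ x • (c • f : L2) x ∂μ = c * ∫ x, φ x • f x ∂μ := by
  rw [← integral_const_mul]
  refine integral_congr_ae ?_
  filter_upwards [Lp.coeFn_smul c f] with x hx
  simp only [hx, Pi.smul_apply, real_smul, smul_eq_mul]
  ring

lemma HasWeakDeriv.add {f g f' g' : L2} (hf : HasWeakDeriv f f') (hg : HasWeakDeriv g g') :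
    HasWeakDeriv (f + g) (f' + g') := by
  intro φ h1 h2 h3
  rw [integral_test_add (h1.continuous_deriv (by simp)) h2.deriv,
    integral_test_add h1.continuous h2, hf φ h1 h2 h3, hg φ h1 h2 h3]
  ring

lemma HasWeakDeriv.smul {f f' : L2} (c : ℂ) (hf : HasWeakDeriv f f') :
    HasWeakDeriv (c • f) (c • f') := by
  intro φ h1 h2 h3
  rw [integral_test_smul, integral_test_smul, hf φ h1 h2 h3]
  ring

lemma HasWeakDeriv.zero : HasWeakDeriv 0 0 := by
  have h : ∀ φ : ℝ → ℝ, ∫ x, φ x • (0 : L2) x ∂μ = 0 := fun φ => by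
    have := integral_test_smul φ 0 0
    simpa using this
  intro φ _ _ _
  rw [h, h, neg_zero]

lemma eq_zero_of_integral_test {f : L2}
    (h : ∀ φ : ℝ → ℝ, ContDiff ℝ ∞ φ → HasCompactSupport φ → tsupport φ ⊆ Set.Ioo (0 : ℝ) 1 →
      ∫ x, φ x • f x ∂μ = 0) : f = 0 := by
  have hf : Integrable f μ := (Lp.memLp f).integrable (by norm_num)
  have h0 : ∀ᵐ x ∂(volume : Measure ℝ), x ∈ Set.Ioo (0 : ℝ) 1 → f x = 0 := by
    refine isOpen_Ioo.ae_eq_zero_of_integral_contDiff_smul_eq_zero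
      (IntegrableOn.locallyIntegrableOn hf) ?_
    intro g h1 h2 h3
    rw [← h g h1 h2 h3, setIntegral_eq_integral_of_forall_compl_eq_zero]
    intro x hx
    rw [image_eq_zero_of_notMem_tsupport (fun hx' => hx (h3 hx')), zero_smul]
  rw [Lp.eq_zero_iff_ae_eq_zero]
  exact (ae_restrict_iff' measurableSet_Ioo).2 h0

lemma HasWeakDeriv.unique {f g h : L2} (hg : HasWeakDeriv f g) (hh : HasWeakDeriv f h) :
    g = h := by
  rw [← sub_eq_zero]
  refine eq_zero_of_integral_test fun φ h1 h2 h3 => ?_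
  have e : g - h = g + (-1 : ℂ) • h := by simp [sub_eq_add_neg]
  have := (hg φ h1 h2 h3).symm.trans (hh φ h1 h2 h3)
  rw [e, integral_test_add h1.continuous h2, integral_test_smul, neg_injective this]
  ring

/-- The space of jets `(f, f', …, f^{(m)})` of functions `f ∈ W^m_2`, as a subspace of `L₂^{m+1}`
with its maximum norm. -/
def jets (m : ℕ) : Submodule ℂ (Fin (m + 1) → L2) where
  carrier := {D | ∀ k : Fin m, HasWeakDeriv (D k.castSucc) (D k.succ)}
  add_mem' := fun ha hb k => (ha k).add (hb k)
  zero_mem' := fun _ => HasWeakDeriv.zero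
  smul_mem' := fun c _ h k => (h k).smul c

lemma jets_ext {m : ℕ} {D E : Fin (m + 1) → L2} (hD : D ∈ jets m) (hE : E ∈ jets m)
    (h : D 0 = E 0) : D = E := by
  funext k
  induction k using Fin.induction with
  | zero => exact h
  | succ k ih => exact HasWeakDeriv.unique (hD k) (ih ▸ hE k)

lemma IsWeakJet.mem_jets {m : ℕ} {f : L2} {D : Fin (m + 1) → L2} (h : IsWeakJet m f D) :
    D ∈ jets m := h.2

lemma isWeakJet_of_mem_jets {m : ℕ} {D : Fin (m + 1) → L2} (h : D ∈ jets m) :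
    IsWeakJet m (D 0) D := ⟨rfl, h⟩

lemma intENorm_eq {m : ℕ} {f : L2} {D : Fin (m + 1) → L2} (h : IsWeakJet m f D) :
    intENorm m f = (∑ k, ‖D k‖ₑ ^ 2) ^ (1 / 2 : ℝ) := by
  refine le_antisymm (iInf₂_le D h) (le_iInf₂ fun E hE => ?_)
  rw [jets_ext hE.mem_jets h.mem_jets (hE.1.trans h.1.symm)]

lemma exists_isWeakJet {m : ℕ} {f : L2} (h : intENorm m f < ⊤) : ∃ D, IsWeakJet m f D := by
  by_contra! hD
  have : intENorm m f = ⊤ := by simp [intENorm, hD]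
  exact h.ne this

lemma enorm_le_intENorm {m : ℕ} {f : L2} {D : Fin (m + 1) → L2} (h : IsWeakJet m f D)
    (k : Fin (m + 1)) : ‖D k‖ₑ ≤ intENorm m f := by
  rw [intENorm_eq h]
  calc ‖D k‖ₑ = (‖D k‖ₑ ^ 2) ^ (1 / 2 : ℝ) := by
        rw [← ENNReal.rpow_natCast, ← ENNReal.rpow_mul]; norm_num
    _ ≤ _ := ENNReal.rpow_le_rpow
        (Finset.single_le_sum (f := fun k => ‖D k‖ₑ ^ 2) (fun _ _ => zero_le) (Finset.mem_univ k))
        (by norm_num)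

lemma intENorm_le_mul {m : ℕ} {f : L2} {D : Fin (m + 1) → L2} (h : IsWeakJet m f D) {M : ℝ≥0∞}
    (hM : ∀ k, ‖D k‖ₑ ≤ M) : intENorm m f ≤ (m + 1 : ℕ) * M := by
  rw [intENorm_eq h]
  have h1 : ∑ k, ‖D k‖ₑ ^ 2 ≤ ((m + 1 : ℕ) * M) ^ 2 := by
    calc ∑ k, ‖D k‖ₑ ^ 2 ≤ ∑ _k : Fin (m + 1), M ^ 2 :=
          Finset.sum_le_sum fun k _ => pow_le_pow_left' (hM k) 2
      _ = (m + 1 : ℕ) * M ^ 2 := by simp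
      _ ≤ (m + 1 : ℕ) ^ 2 * M ^ 2 := by
          gcongr
          exact_mod_cast Nat.le_self_pow (by norm_num) _
      _ = _ := (mul_pow _ _ _).symm
  calc _ ≤ (((m + 1 : ℕ) * M) ^ 2) ^ (1 / 2 : ℝ) := ENNReal.rpow_le_rpow h1 (by norm_num)
    _ = _ := by rw [← ENNReal.rpow_natCast, ← ENNReal.rpow_mul]; norm_num

lemma intENorm_lt_top {m : ℕ} {f : L2} {D : Fin (m + 1) → L2} (h : IsWeakJet m f D) :
    intENorm m f < ⊤ := by
  refine (intENorm_le_mul h (M := ∑ k, ‖D k‖ₑ) fun k =>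
    Finset.single_le_sum (f := fun k => ‖D k‖ₑ) (fun _ _ => zero_le) (Finset.mem_univ k)).trans_lt ?_
  exact ENNReal.mul_lt_top (ENNReal.natCast_lt_top _)
    (ENNReal.sum_lt_top.2 fun k _ => enorm_lt_top)

lemma intENorm_jet_le {m : ℕ} (D : jets m) :
    intENorm m (D.1 0) ≤ (m + 1 : ℕ) * ‖D‖ₑ :=
  intENorm_le_mul (isWeakJet_of_mem_jets D.2) fun k => by
    rw [← ofReal_norm, ← ofReal_norm]
    exact ENNReal.ofReal_le_ofReal (norm_le_pi_norm D.1 k)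

lemma enorm_jet_le {m : ℕ} (D : jets m) : ‖D‖ₑ ≤ intENorm m (D.1 0) := by
  have h := isWeakJet_of_mem_jets D.2
  have hk := enorm_le_intENorm h
  rw [← ofReal_norm]
  refine ENNReal.ofReal_le_of_le_toReal ?_
  refine (pi_norm_le_iff_of_nonneg ENNReal.toReal_nonneg).2 fun k => ?_
  have := ENNReal.toReal_mono (intENorm_lt_top h).ne (hk k)
  simpa using this

/-! ### Limits of bounded sequences of jets -/

/-- Weak sequential compactness of balls of `L₂`, along an ultrafilter. -/
lemma exists_weak_limit {ι : Type*} (U : Ultrafilter ι) (v : ι → L2) {M : ℝ}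
    (hv : ∀ᶠ j in (U : Filter ι), ‖v j‖ ≤ M) :
    ∃ w : L2, ‖w‖ ≤ M ∧ ∀ y : L2, Tendsto (fun j => inner ℂ (v j) y) U (𝓝 (inner ℂ w y)) := by
  have hK := WeakDual.isCompact_closedBall (𝕜 := ℂ) (E := L2) 0 M
  let ℓ : ι → WeakDual ℂ L2 := fun j => StrongDual.toWeakDual (InnerProductSpace.toDual ℂ L2 (v j))
  have hmem : ∀ᶠ j in (U : Filter ι),
      ℓ j ∈ WeakDual.toStrongDual ⁻¹' Metric.closedBall (0 : StrongDual ℂ L2) M := by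
    filter_upwards [hv] with j hj
    simpa [ℓ] using hj
  obtain ⟨w', hw', hlim⟩ := hK.ultrafilter_le_nhds (U.map ℓ)
    (Filter.le_principal_iff.2 hmem)
  refine ⟨(InnerProductSpace.toDual ℂ L2).symm (WeakDual.toStrongDual w'), ?_, fun y => ?_⟩
  · simpa using hw'
  · have h1 : Tendsto ℓ U (𝓝 w') := hlim
    have h2 := ((WeakDual.eval_continuous y).tendsto w').comp h1
    have e : inner ℂ ((InnerProductSpace.toDual ℂ L2).symm (WeakDual.toStrongDual w')) y = w' y := by
      rw [InnerProductSpace.toDual_symm_apply]; rfl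
    rw [e]
    exact h2

lemma exists_test_toLp {φ : ℝ → ℝ} (hφ : Continuous φ) (hc : HasCompactSupport φ) :
    ∃ Φ : L2, ∀ f : L2, ∫ x, φ x • f x ∂μ = inner ℂ Φ f := by
  have hm : MemLp (fun x => (φ x : ℂ)) 2 μ := by
    obtain ⟨C, hC⟩ := hφ.bounded_above_of_compact_support hc
    refine MemLp.of_bound (by fun_prop) C (Eventually.of_forall fun x => ?_)
    simpa using hC x
  refine ⟨hm.toLp _, fun f => ?_⟩
  rw [L2.inner_def]
  refine integral_congr_ae ?_
  filter_upwards [hm.coeFn_toLp] with x hx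
  rw [hx]; simp [mul_comm]

/-- A bounded family of jets whose functions converge in `L₂` yields a jet of the limit, with the
same bound: the Sobolev spaces are closed under bounded `L₂`-limits. -/
lemma exists_isWeakJet_of_tendsto {ι : Type*} {l : Filter ι} [l.NeBot] {m : ℕ}
    {v : ι → Fin (m + 1) → L2} {u : L2} {M : ℝ}
    (hv : ∀ᶠ j in l, v j ∈ jets m) (hM : ∀ᶠ j in l, ∀ k, ‖v j k‖ ≤ M)
    (hu : Tendsto (fun j => v j 0) l (𝓝 u)) :
    ∃ D, IsWeakJet m u D ∧ ∀ k, ‖D k‖ ≤ M := by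
  set U := Ultrafilter.of l
  have hU : (U : Filter ι) ≤ l := Ultrafilter.of_le l
  have hw := fun k => exists_weak_limit U (fun j => v j k) ((hM.filter_mono hU).mono fun j h => h k)
  choose D hD hlim using hw
  have h0 : D 0 = u := by
    refine ext_inner_right ℂ fun y => ?_
    exact tendsto_nhds_unique (hlim 0 y) (((hu.mono_left hU).inner tendsto_const_nhds))
  refine ⟨D, ⟨h0, fun k => ?_⟩, hD⟩
  intro φ h1 h2 h3
  obtain ⟨Φ, hΦ⟩ := exists_test_toLp h1.continuous h2
  obtain ⟨Ψ, hΨ⟩ := exists_test_toLp (h1.continuous_deriv (by simp)) h2.deriv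
  have key : ∀ w Φ : L2, inner ℂ Φ w = star (inner ℂ w Φ) := fun w Φ =>
    (inner_conj_symm Φ w).symm
  rw [hΦ, hΨ, key _ Φ, key _ Ψ]
  have e1 := (continuous_star.tendsto _).comp (hlim k.castSucc Ψ)
  have e2 := ((continuous_star.tendsto _).comp (hlim k.succ Φ)).neg
  refine tendsto_nhds_unique_of_eventuallyEq e1 e2 ?_
  filter_upwards [hv.filter_mono hU] with j hj
  have := hj k φ h1 h2 h3
  rw [hΦ, hΨ, key _ Φ, key _ Ψ] at this
  exact this

/-! ### Continuous functions as elements of `L₂` -/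

lemma memLp_continuous (f : C(ℝ, ℂ)) : MemLp f 2 μ := by
  obtain ⟨C, hC⟩ := (isCompact_Icc (a := (0 : ℝ)) (b := 1)).exists_bound_of_continuousOn
    f.continuous.continuousOn
  refine MemLp.of_bound f.continuous.aestronglyMeasurable C ?_
  exact (ae_restrict_iff' measurableSet_Ioo).2
    (Eventually.of_forall fun x hx => hC x (Set.Ioo_subset_Icc_self hx))

/-- The class in `L₂(0,1)` of a continuous function on `ℝ`. -/
def cls : C(ℝ, ℂ) →ₗ[ℂ] L2 where
  toFun f := (memLp_continuous f).toLp f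
  map_add' f g := MemLp.toLp_add (memLp_continuous f) (memLp_continuous g)
  map_smul' c f := MemLp.toLp_const_smul c (memLp_continuous f)

lemma coeFn_cls (f : C(ℝ, ℂ)) : cls f =ᵐ[μ] f := (memLp_continuous f).coeFn_toLp

lemma integral_μ (F : ℝ → ℂ) : ∫ x, F x ∂μ = ∫ x in (0 : ℝ)..1, F x := by
  rw [intervalIntegral.integral_of_le zero_le_one, integral_Ioc_eq_integral_Ioo]

lemma integral_μ_real (F : ℝ → ℝ) : ∫ x, F x ∂μ = ∫ x in (0 : ℝ)..1, F x := by
  rw [intervalIntegral.integral_of_le zero_le_one, integral_Ioc_eq_integral_Ioo]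

lemma norm_sq_eq_integral (f : L2) : ‖f‖ ^ 2 = ∫ x, ‖f x‖ ^ 2 ∂μ := by
  have h := L2.inner_def (𝕜 := ℂ) f f
  rw [inner_self_eq_norm_sq_to_K] at h
  have h2 : ∫ x, inner ℂ (f x) (f x) ∂μ = ((∫ x, ‖f x‖ ^ 2 ∂μ : ℝ) : ℂ) := by
    rw [← integral_complex_ofReal]
    refine integral_congr_ae (Eventually.of_forall fun x => ?_)
    simp only [inner_self_eq_norm_sq_to_K]
    push_cast; rfl
  rw [h2] at h
  have h3 : ((‖f‖ ^ 2 : ℝ) : ℂ) = ((∫ x, ‖f x‖ ^ 2 ∂μ : ℝ) : ℂ) := by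
    rw [← h]; push_cast; rfl
  exact Complex.ofReal_injective h3

lemma norm_cls_sq (f : C(ℝ, ℂ)) : ‖cls f‖ ^ 2 = ∫ x in (0 : ℝ)..1, ‖f x‖ ^ 2 := by
  rw [norm_sq_eq_integral, ← integral_μ_real]
  refine integral_congr_ae ?_
  filter_upwards [coeFn_cls f] with x hx
  rw [hx]

lemma cls_congr {f g : C(ℝ, ℂ)} (h : ∀ x ∈ Set.Icc (0 : ℝ) 1, f x = g x) : cls f = cls g := by
  refine (MemLp.toLp_eq_toLp_iff (memLp_continuous f) (memLp_continuous g)).2 ?_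
  exact (ae_restrict_iff' measurableSet_Ioo).2
    (Eventually.of_forall fun x hx => h x (Set.Ioo_subset_Icc_self hx))

lemma norm_cls_le {f : C(ℝ, ℂ)} {M : ℝ} (hM : 0 ≤ M) (h : ∀ x ∈ Set.Icc (0 : ℝ) 1, ‖f x‖ ≤ M) :
    ‖cls f‖ ≤ M := by
  refine abs_le_of_sq_le_sq' ?_ hM |>.2
  rw [norm_cls_sq]
  calc ∫ x in (0 : ℝ)..1, ‖f x‖ ^ 2 ≤ ∫ _x in (0 : ℝ)..1, M ^ 2 := by
        refine intervalIntegral.integral_mono_on zero_le_one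
          (Continuous.intervalIntegrable (by fun_prop) _ _) (by simp) fun x hx => ?_
        gcongr
        exact h x hx
    _ = M ^ 2 := by simp

lemma hasWeakDeriv_cls {f f' : C(ℝ, ℂ)} (h : ∀ x, HasDerivAt f (f' x) x) :
    HasWeakDeriv (cls f) (cls f') := by
  intro φ h1 h2 h3
  have e1 : ∀ (ψ : ℝ → ℝ) (g : C(ℝ, ℂ)),
      ∫ x, ψ x • cls g x ∂μ = ∫ x in (0 : ℝ)..1, (ψ x : ℂ) * g x := fun ψ g => by
    rw [← integral_μ]
    refine integral_congr_ae ?_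
    filter_upwards [coeFn_cls g] with x hx
    simp [hx]
  rw [e1, e1]
  have z : ∀ x, x ∉ Set.Ioo (0 : ℝ) 1 → φ x = 0 := fun x hx =>
    image_eq_zero_of_notMem_tsupport fun hx' => hx (h3 hx')
  have hd : ∀ x, HasDerivAt (fun x => (φ x : ℂ)) ((deriv φ x : ℝ) : ℂ) x := fun x =>
    ((h1.differentiable (by simp)).differentiableAt.hasDerivAt (x := x)).ofReal_comp
  have hc := h1.continuous
  have hc' : Continuous (deriv φ) := h1.continuous_deriv (by simp)
  have := intervalIntegral.integral_mul_deriv_eq_deriv_mul (a := 0) (b := 1)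
    (fun x _ => hd x) (fun x _ => h x)
    (Continuous.intervalIntegrable (by fun_prop) _ _)
    (Continuous.intervalIntegrable (by fun_prop) _ _)
  rw [this, z 0 (by simp), z 1 (by simp)]
  simp

/-! ### Cauchy–Schwarz inequality -/

lemma sq_integral_mul_le {X : Type*} [MeasurableSpace X] {ν : Measure X} {f g : X → ℝ}
    (hf : MemLp f 2 ν) (hg : MemLp g 2 ν) :
    (∫ x, f x * g x ∂ν) ^ 2 ≤ (∫ x, f x ^ 2 ∂ν) * ∫ x, g x ^ 2 ∂ν := by
  have key : ∀ {u v : X → ℝ} (hu : MemLp u 2 ν) (hv : MemLp v 2 ν),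
      inner ℝ (hu.toLp u) (hv.toLp v) = ∫ x, u x * v x ∂ν := fun hu hv => by
    rw [L2.inner_def]
    refine integral_congr_ae ?_
    filter_upwards [hu.coeFn_toLp, hv.coeFn_toLp] with x h1 h2
    simp [h1, h2, mul_comm]
  have h := real_inner_mul_inner_self_le (hf.toLp f) (hg.toLp g)
  rw [key, key, key] at h
  simpa [sq] using h

/-! ### Averages against a moving kernel -/

/-- The averages `x ↦ ∫ κ(w - a x) f(w) dw` over `(0,1)`. -/
def avg (κ : ℝ → ℝ) (a : ℝ) (f : L2) (x : ℝ) : ℂ := ∫ w, κ (w - a * x) • f w ∂μ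

lemma hasCompactSupport_shift {κ : ℝ → ℝ} (hc : HasCompactSupport κ) (b : ℝ) : HasCompactSupport fun w => κ (w - b) :=
  hc.comp_homeomorph (Homeomorph.subRight b)

lemma norm_avg_le {κ : ℝ → ℝ} {C : ℝ} (hC : ∀ x, ‖κ x‖ ≤ C) (a : ℝ) (f : L2) (x : ℝ) :
    ‖avg κ a f x‖ ≤ C * ‖f‖ := by
  have hf : Integrable f μ := (Lp.memLp f).integrable (by norm_num)
  have hC0 : 0 ≤ C := (norm_nonneg _).trans (hC 0)
  have h1 : ‖avg κ a f x‖ ≤ ∫ w, C * ‖f w‖ ∂μ := by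
    refine norm_integral_le_of_norm_le (hf.norm.const_mul C) (Eventually.of_forall fun w => ?_)
    rw [norm_smul]; gcongr; exact hC _
  rw [integral_const_mul] at h1
  have h2 : ∫ w, ‖f w‖ ∂μ ≤ ‖f‖ := by
    refine abs_le_of_sq_le_sq' ?_ (norm_nonneg f) |>.2
    have := sq_integral_mul_le (Lp.memLp f).norm (memLp_const (1 : ℝ) (μ := μ))
    rw [norm_sq_eq_integral]
    simpa using this
  exact h1.trans (by gcongr)

lemma hasDerivAt_avg {κ : ℝ → ℝ} (hκ : ContDiff ℝ ∞ κ) (hc : HasCompactSupport κ) (a : ℝ) (f : L2) (x : ℝ) :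
    HasDerivAt (avg κ a f) (-a * avg (deriv κ) a f x) x := by
  have hf : Integrable f μ := (Lp.memLp f).integrable (by norm_num)
  have hκ' : Continuous (deriv κ) := hκ.continuous_deriv (by simp)
  have hκc := hκ.continuous
  obtain ⟨C, hC⟩ := hκ'.bounded_above_of_compact_support hc.deriv
  have hd : ∀ w x, HasDerivAt (fun x => κ (w - a * x) • f w)
      ((deriv κ (w - a * x) * (-a)) • f w) x := fun w x => by
    have h1 : HasDerivAt κ (deriv κ (w - a * x)) (w - a * x) :=
      (hκ.differentiable (by simp)).differentiableAt.hasDerivAt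
    have h2 : HasDerivAt (fun x => w - a * x) (-a) x := by
      simpa using ((hasDerivAt_id x).const_mul a).const_sub w
    exact (h1.comp x h2).smul_const (f w)
  have := (hasDerivAt_integral_of_dominated_loc_of_deriv_le (μ := μ) (s := Set.univ)
    (bound := fun w => C * |a| * ‖f w‖) (F := fun x w => κ (w - a * x) • f w) (x₀ := x)
    (F' := fun x w => (deriv κ (w - a * x) * (-a)) • f w) univ_mem ?_ ?_ ?_ ?_ ?_ ?_).2
  · refine this.congr_deriv ?_
    simp only [avg]
    rw [← integral_const_mul]
    refine integral_congr_ae (Eventually.of_forall fun w => ?_)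
    simp; ring
  · exact Eventually.of_forall fun x => AEStronglyMeasurable.smul
      (f := fun w => κ (w - a * x)) (Continuous.aestronglyMeasurable (by fun_prop)) hf.1
  · exact integrable_test_smul (φ := fun w => κ (w - a * x)) (by fun_prop)
      (hasCompactSupport_shift hc _) f
  · exact AEStronglyMeasurable.smul (f := fun w => deriv κ (w - a * x) * -a)
      (Continuous.aestronglyMeasurable (by fun_prop)) hf.1
  · refine Eventually.of_forall fun w y _ => ?_
    rw [norm_smul, norm_mul, norm_neg, Real.norm_eq_abs a]
    exact mul_le_mul_of_nonneg_right (mul_le_mul_of_nonneg_right (hC _) (abs_nonneg a))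
      (norm_nonneg _)
  · exact hf.norm.const_mul _
  · exact Eventually.of_forall fun w y _ => hd w y

lemma avg_add {κ : ℝ → ℝ} (hκ : Continuous κ) (hc : HasCompactSupport κ) (a : ℝ) (f g : L2)
    (x : ℝ) : avg κ a (f + g) x = avg κ a f x + avg κ a g x := by
  exact integral_test_add (φ := fun w => κ (w - a * x)) (by fun_prop)
    (hasCompactSupport_shift hc _) f g

lemma avg_smul (κ : ℝ → ℝ) (a : ℝ) (c : ℂ) (f : L2) (x : ℝ) : avg κ a (c • f) x = c * avg κ a f x :=
  integral_test_smul _ c f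

/-- Integration by parts in an average, for kernels supported in `(0, 1 - a)`, so that
`w ↦ κ (w - a x)` is a test function on `(0,1)`. -/
lemma avg_deriv {κ : ℝ → ℝ} (hκ : ContDiff ℝ ∞ κ) (hc : HasCompactSupport κ) {ε : ℝ} (hε1 : ε ≤ 1) (hs : tsupport κ ⊆ Set.Ioo 0 ε)
    {f f' : L2} (h : HasWeakDeriv f f') {x : ℝ} (hx : x ∈ Set.Icc (0 : ℝ) 1) :
    avg (deriv κ) (1 - ε) f x = -avg κ (1 - ε) f' x := by
  have := h (fun w => κ (w - (1 - ε) * x)) (by fun_prop) (hasCompactSupport_shift hc _) ?_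
  · rw [avg, avg, ← this]
    simp only [deriv_comp_sub_const]
  · intro w hw
    have h1 : w - (1 - ε) * x ∈ tsupport κ := by
      have := tsupport_comp_subset_preimage κ (f := fun w : ℝ => w - (1 - ε) * x) (by fun_prop) hw
      exact this
    have h2 := hs h1
    constructor
    · nlinarith [h2.1, hx.1, hx.2]
    · nlinarith [h2.2, hx.1, hx.2]

/-! ### The smoothing operators -/

/-- The width `1 / (j + 2)` of the `j`-th smoothing kernel. -/
def width (j : ℕ) : ℝ := 1 / (j + 2)

lemma width_pos (j : ℕ) : 0 < width j := by unfold width; positivity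

lemma width_lt_one (j : ℕ) : width j < 1 := by
  unfold width; rw [div_lt_one (by positivity)]; linarith [(Nat.cast_nonneg j : (0 : ℝ) ≤ j)]

lemma tendsto_width : Tendsto width atTop (𝓝 0) := by
  unfold width
  have := (tendsto_const_div_atTop_nhds_zero_nat (1 : ℝ)).comp (tendsto_add_atTop_nat 2)
  refine this.congr fun j => ?_
  simp

/-- A smooth bump function in the interval `(0, width j)`. -/
def bump (j : ℕ) : ContDiffBump (width j / 2) :=
  ⟨width j / 8, width j / 4, by linarith [width_pos j], by linarith [width_pos j]⟩

/-- A nonnegative smooth function of integral one, supported in `(0, width j)`. -/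
def ker (j : ℕ) : ℝ → ℝ := (bump j).normed volume

lemma ker_contDiff (j : ℕ) : ContDiff ℝ ∞ (ker j) := (bump j).contDiff_normed

lemma ker_hasCompactSupport (j : ℕ) : HasCompactSupport (ker j) := (bump j).hasCompactSupport_normed

lemma ker_nonneg (j : ℕ) (x : ℝ) : 0 ≤ ker j x := (bump j).nonneg_normed x

lemma ker_integral (j : ℕ) : ∫ x, ker j x = 1 := (bump j).integral_normed

lemma ker_tsupport (j : ℕ) : tsupport (ker j) ⊆ Set.Ioo 0 (width j) := by
  rw [ker, (bump j).tsupport_normed_eq, Real.closedBall_eq_Icc]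
  intro x hx
  have := width_pos j
  simp only [bump] at hx
  exact ⟨by linarith [hx.1], by linarith [hx.2]⟩

lemma iteratedDeriv_ker_contDiff (j i : ℕ) : ContDiff ℝ ∞ (iteratedDeriv i (ker j)) :=
  iteratedDeriv_eq_iterate (𝕜 := ℝ) (F := ℝ) ▸ (ker_contDiff j).iterate_deriv i

lemma iteratedDeriv_ker_hasCompactSupport (j i : ℕ) :
    HasCompactSupport (iteratedDeriv i (ker j)) := by
  induction i with
  | zero => simpa using ker_hasCompactSupport j
  | succ i ih => rw [iteratedDeriv_succ]; exact ih.deriv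

lemma iteratedDeriv_ker_tsupport (j i : ℕ) :
    tsupport (iteratedDeriv i (ker j)) ⊆ Set.Ioo 0 (width j) := by
  induction i with
  | zero => simpa using ker_tsupport j
  | succ i ih =>
    rw [iteratedDeriv_succ]
    exact (closure_minimal (support_deriv_subset (𝕜 := ℝ)) (isClosed_tsupport _)).trans ih

/-- The `i`-th derivative of the smoothing `S f (x) = √a ∫ ker(w - a x) f(w) dw` of `f ∈ L₂`, where
`a = 1 - width j`. As the averages are over points of `(0,1)` when `x ∈ [0,1]`, no extension of `f`
is needed, and `S` commutes with differentiation up to the factor `a`; the factor `√a` makes `S` a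
contraction of `L₂`. -/
def smooth (j i : ℕ) : L2 →ₗ[ℂ] C(ℝ, ℂ) where
  toFun f :=
    { toFun := fun x => (√(1 - width j) * (-(1 - width j)) ^ i : ℝ) *
        avg (iteratedDeriv i (ker j)) (1 - width j) f x
      continuous_toFun := by
        refine continuous_const.mul (Differentiable.continuous (𝕜 := ℝ) fun x => ?_)
        exact (hasDerivAt_avg (iteratedDeriv_ker_contDiff j i)
          (iteratedDeriv_ker_hasCompactSupport j i) _ f x).differentiableAt }
  map_add' f g := by
    ext x
    simp [avg_add (iteratedDeriv_ker_contDiff j i).continuous (iteratedDeriv_ker_hasCompactSupport j i),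
      mul_add]
  map_smul' c f := by
    ext x
    simp [avg_smul]; ring

lemma smooth_apply (j i : ℕ) (f : L2) (x : ℝ) :
    smooth j i f x = (√(1 - width j) * (-(1 - width j)) ^ i : ℝ) *
        avg (iteratedDeriv i (ker j)) (1 - width j) f x := rfl

lemma hasDerivAt_smooth (j i : ℕ) (f : L2) (x : ℝ) :
    HasDerivAt (smooth j i f) (smooth j (i + 1) f x) x := by
  have := (hasDerivAt_avg (iteratedDeriv_ker_contDiff j i)
    (iteratedDeriv_ker_hasCompactSupport j i) (1 - width j) f x).const_mul
      ((√(1 - width j) * (-(1 - width j)) ^ i : ℝ) : ℂ)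
  refine this.congr_deriv ?_
  rw [smooth_apply, iteratedDeriv_succ, pow_succ]
  push_cast; ring

lemma exists_smooth_bound (j i : ℕ) : ∃ C : ℝ, 0 ≤ C ∧ ∀ f x, ‖smooth j i f x‖ ≤ C * ‖f‖ := by
  obtain ⟨C, hC⟩ := (iteratedDeriv_ker_contDiff j i).continuous.bounded_above_of_compact_support
    (iteratedDeriv_ker_hasCompactSupport j i)
  have hC0 : 0 ≤ C := (norm_nonneg _).trans (hC 0)
  refine ⟨‖((√(1 - width j) * (-(1 - width j)) ^ i : ℝ) : ℂ)‖ * C, by positivity, fun f x => ?_⟩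
  rw [smooth_apply, norm_mul, mul_assoc]
  gcongr
  exact norm_avg_le hC _ f x

lemma smooth_succ {f f' : L2} (h : HasWeakDeriv f f') (j i : ℕ) {x : ℝ}
    (hx : x ∈ Set.Icc (0 : ℝ) 1) :
    smooth j (i + 1) f x = ((1 - width j : ℝ) : ℂ) * smooth j i f' x := by
  rw [smooth_apply, smooth_apply, iteratedDeriv_succ,
    avg_deriv (iteratedDeriv_ker_contDiff j i) (iteratedDeriv_ker_hasCompactSupport j i)
      (width_lt_one j).le (iteratedDeriv_ker_tsupport j i) h hx]
  push_cast; ring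

lemma cls_smooth_succ {f f' : L2} (h : HasWeakDeriv f f') (j i : ℕ) :
    cls (smooth j (i + 1) f) = ((1 - width j : ℝ) : ℂ) • cls (smooth j i f') := by
  rw [← map_smul]
  exact cls_congr fun x hx => by simpa using smooth_succ h j i hx

/-- For `x ∈ [0,1]` the whole mass of the kernel lies in `(0,1)`. -/
lemma integral_ker_shift (j : ℕ) {x : ℝ} (hx : x ∈ Set.Icc (0 : ℝ) 1) :
    ∫ w, ker j (w - (1 - width j) * x) ∂μ = 1 := by
  rw [setIntegral_eq_integral_of_forall_compl_eq_zero,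
    integral_sub_right_eq_self (fun w => ker j w) ((1 - width j) * x), ker_integral]
  intro w hw
  refine image_eq_zero_of_notMem_tsupport fun h => hw ?_
  have h2 := ker_tsupport j h
  have := width_lt_one j
  constructor
  · nlinarith [h2.1, hx.1, hx.2]
  · nlinarith [h2.2, hx.1, hx.2]

lemma norm_avg_ker_sq_le (j : ℕ) (f : L2) {x : ℝ} (hx : x ∈ Set.Icc (0 : ℝ) 1) :
    ‖avg (ker j) (1 - width j) f x‖ ^ 2 ≤ ∫ w, ‖f w‖ ^ 2 * ker j (w - (1 - width j) * x) ∂μ := by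
  set k : ℝ → ℝ := fun w => ker j (w - (1 - width j) * x) with hk
  have hkc : Continuous k := by have := (ker_contDiff j).continuous; fun_prop
  have hk0 : ∀ w, 0 ≤ k w := fun w => ker_nonneg j _
  obtain ⟨C, hC⟩ := hkc.bounded_above_of_compact_support
    (hasCompactSupport_shift (ker_hasCompactSupport j) _)
  have hsq : MemLp (fun w => √(k w)) 2 μ := by
    refine MemLp.of_bound (by fun_prop) (√C) (Eventually.of_forall fun w => ?_)
    rw [Real.norm_of_nonneg (Real.sqrt_nonneg _)]
    exact Real.sqrt_le_sqrt ((Real.le_norm_self _).trans (hC w))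
  have hfk : MemLp (fun w => √(k w) * ‖f w‖) 2 μ := by
    refine (Lp.memLp f).norm.of_le_mul (c := √C)
      (AEStronglyMeasurable.mul (by fun_prop) (Lp.memLp f).1.norm) (Eventually.of_forall fun w => ?_)
    rw [norm_mul, Real.norm_of_nonneg (Real.sqrt_nonneg _)]
    gcongr
    exact (Real.le_norm_self _).trans (hC w)
  have h1 : ‖avg (ker j) (1 - width j) f x‖ ≤ ∫ w, √(k w) * ‖f w‖ * √(k w) ∂μ := by
    refine (norm_integral_le_integral_norm _).trans_eq ?_
    refine integral_congr_ae (Eventually.of_forall fun w => ?_)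
    simp only [norm_smul, Real.norm_of_nonneg (ker_nonneg j _)]
    rw [mul_right_comm, Real.mul_self_sqrt (hk0 w)]
  have h2 := sq_integral_mul_le hfk hsq
  have e : ∀ w, (√(k w) * ‖f w‖) ^ 2 = ‖f w‖ ^ 2 * k w := fun w => by
    rw [mul_pow, Real.sq_sqrt (hk0 w), mul_comm]
  simp only [e, Real.sq_sqrt (hk0 _)] at h2
  rw [show ∫ w, k w ∂μ = 1 from integral_ker_shift j hx, mul_one] at h2
  exact (pow_le_pow_left₀ (norm_nonneg _) h1 2).trans h2

lemma norm_cls_smooth_zero_le (j : ℕ) (f : L2) : ‖cls (smooth j 0 f)‖ ≤ ‖f‖ := by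
  refine abs_le_of_sq_le_sq' ?_ (norm_nonneg f) |>.2
  set a := 1 - width j with ha
  have ha0 : 0 < a := by linarith [width_lt_one j]
  have hf2 : Integrable (fun w => ‖f w‖ ^ 2) μ := (Lp.memLp f).integrable_norm_pow (by norm_num)
  have hkc := (ker_contDiff j).continuous
  obtain ⟨C, hC⟩ := hkc.bounded_above_of_compact_support (ker_hasCompactSupport j)
  have hki : Integrable (ker j) := hkc.integrable_of_hasCompactSupport (ker_hasCompactSupport j)
  have hI : Integrable (Function.uncurry fun x w => ‖f w‖ ^ 2 * ker j (w - a * x)) (μ.prod μ) := by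
    have : Integrable (fun z : ℝ × ℝ => ‖f z.2‖ ^ 2) (μ.prod μ) := hf2.comp_snd μ
    refine this.mul_bdd (g := fun z : ℝ × ℝ => ker j (z.2 - a * z.1)) (c := C)
      (Continuous.aestronglyMeasurable (by fun_prop)) (Eventually.of_forall fun z => hC _)
  have hin : ∀ w, ∫ x, ker j (w - a * x) ∂μ ≤ a⁻¹ := fun w => by
    have e : ∫ x, ker j (w - a * x) = a⁻¹ := by
      rw [Measure.integral_comp_mul_left (fun y => ker j (w - y)) a, integral_sub_left_eq_self,
        ker_integral]
      simp [abs_of_pos ha0]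
    rw [← e]
    refine setIntegral_le_integral ?_ (Eventually.of_forall fun x => ker_nonneg j _)
    have := hki.comp_sub_left w
    exact this.comp_mul_left' ha0.ne'
  rw [norm_cls_sq]
  calc ∫ x in (0 : ℝ)..1, ‖smooth j 0 f x‖ ^ 2
      = ∫ x, a * ‖avg (ker j) a f x‖ ^ 2 ∂μ := by
        rw [← integral_μ_real]
        refine integral_congr_ae (Eventually.of_forall fun x => ?_)
        simp only [smooth_apply, iteratedDeriv_zero, pow_zero, mul_one, norm_mul, mul_pow]
        rw [Complex.norm_real, Real.norm_of_nonneg (Real.sqrt_nonneg _), Real.sq_sqrt ha0.le]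
    _ ≤ ∫ x, a * ∫ w, ‖f w‖ ^ 2 * ker j (w - a * x) ∂μ ∂μ := by
        refine integral_mono_ae ?_ ((hI.integral_prod_left).const_mul a) ?_
        · have : MemLp (fun x => avg (ker j) a f x) 2 μ := memLp_continuous
            ⟨_, Differentiable.continuous (𝕜 := ℝ) fun x =>
              (hasDerivAt_avg (ker_contDiff j) (ker_hasCompactSupport j) a f x).differentiableAt⟩
          exact (this.integrable_norm_pow (by norm_num)).const_mul a
        · refine (ae_restrict_iff' measurableSet_Ioo).2 (Eventually.of_forall fun x hx => ?_)
          have := norm_avg_ker_sq_le j f (Set.Ioo_subset_Icc_self hx)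
          dsimp only
          gcongr
    _ = a * ∫ w, ‖f w‖ ^ 2 * ∫ x, ker j (w - a * x) ∂μ ∂μ := by
        rw [integral_const_mul, integral_integral_swap hI]
        simp only [integral_const_mul]
    _ ≤ a * ∫ w, ‖f w‖ ^ 2 * a⁻¹ ∂μ := by
        refine mul_le_mul_of_nonneg_left ?_ ha0.le
        refine integral_mono_ae ?_ (hf2.mul_const _) (Eventually.of_forall fun w => ?_)
        · have := hI.integral_prod_right
          simpa only [Function.uncurry, integral_const_mul] using this
        · exact mul_le_mul_of_nonneg_left (hin w) (by positivity)
    _ = ‖f‖ ^ 2 := by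
        rw [integral_mul_const, norm_sq_eq_integral]
        field_simp

lemma tendsto_cls_smooth_cls (g : C(ℝ, ℂ)) :
    Tendsto (fun j => cls (smooth j 0 (cls g))) atTop (𝓝 (cls g)) := by
  have huc := (isCompact_Icc (a := (0 : ℝ)) (b := 1)).uniformContinuousOn_of_continuous
    g.continuous.continuousOn
  rw [Metric.uniformContinuousOn_iff_le] at huc
  -- the averages without the factor `√a` converge uniformly
  have hmain : Tendsto (fun j => ((√(1 - width j) : ℝ) : ℂ)⁻¹ • cls (smooth j 0 (cls g))) atTop
      (𝓝 (cls g)) := by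
    rw [Metric.tendsto_atTop']
    intro ε hε
    obtain ⟨δ, hδ, h⟩ := huc (ε / 2) (by positivity)
    have hw := (tendsto_width.eventually (gt_mem_nhds hδ))
    obtain ⟨N, hN⟩ := eventually_atTop.1 hw
    refine ⟨N, fun j hj => ?_⟩
    have hjw := hN j hj.le
    have ha0 : 0 < 1 - width j := by linarith [width_lt_one j]
    have hs0 : ((√(1 - width j) : ℝ) : ℂ) ≠ 0 := by
      exact_mod_cast (Real.sqrt_pos.2 ha0).ne'
    rw [dist_eq_norm, ← map_smul, ← map_sub]
    refine (norm_cls_le (by positivity : (0 : ℝ) ≤ ε / 2) fun x hx => ?_).trans_lt (by linarith)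
    have e1 : (((√(1 - width j) : ℝ) : ℂ)⁻¹ • smooth j 0 (cls g) - g) x
        = ∫ w, ker j (w - (1 - width j) * x) • (g w - g x) ∂μ := by
      have hkc := (ker_contDiff j).continuous
      have hkb : Continuous fun w => ker j (w - (1 - width j) * x) := by fun_prop
      have i1 : Integrable (fun w => ker j (w - (1 - width j) * x) • g w) μ := by
        exact (memLp_continuous ⟨fun w => ker j (w - (1 - width j) * x) • g w, by fun_prop⟩).integrable
          (q := 2) (by norm_num)
      have i2 : Integrable (fun w => ker j (w - (1 - width j) * x) • g x) μ := by
        exact (memLp_continuous ⟨fun w => ker j (w - (1 - width j) * x) • g x, by fun_prop⟩).integrable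
          (q := 2) (by norm_num)
      simp only [smul_sub]
      rw [integral_sub i1 i2, integral_smul_const, integral_ker_shift j hx, one_smul]
      simp only [ContinuousMap.sub_apply, ContinuousMap.smul_apply, smul_eq_mul, smooth_apply,
        iteratedDeriv_zero, pow_zero, mul_one]
      rw [inv_mul_cancel_left₀ hs0, avg]
      congr 1
      refine integral_congr_ae ?_
      filter_upwards [coeFn_cls g] with w hw
      rw [hw]
    rw [e1]
    calc ‖∫ w, ker j (w - (1 - width j) * x) • (g w - g x) ∂μ‖
        ≤ ∫ w, ker j (w - (1 - width j) * x) * (ε / 2) ∂μ := by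
          refine norm_integral_le_of_norm_le ?_ ?_
          · have hkc := (ker_contDiff j).continuous
            have := (memLp_continuous ⟨fun w => ((ker j (w - (1 - width j) * x) : ℝ) : ℂ),
              by fun_prop⟩).integrable (q := 2) (by norm_num)
            have := this.re
            simp only [ContinuousMap.coe_mk, RCLike.re_to_complex, ofReal_re] at this
            exact this.mul_const _
          · refine (ae_restrict_iff' measurableSet_Ioo).2 (Eventually.of_forall fun w hw => ?_)
            rw [norm_smul, Real.norm_of_nonneg (ker_nonneg j _)]
            by_cases hz : ker j (w - (1 - width j) * x) = 0
            · simp [hz]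
            refine mul_le_mul_of_nonneg_left ?_ (ker_nonneg j _)
            have h2 := ker_tsupport j (subset_tsupport _ hz)
            rw [← dist_eq_norm]
            refine h w (Set.Ioo_subset_Icc_self hw) x hx ?_
            rw [Real.dist_eq, abs_le]
            have := width_pos j
            constructor
            · nlinarith [h2.1, hx.1, hx.2]
            · nlinarith [h2.2, hx.1, hx.2]
      _ = ε / 2 := by rw [integral_mul_const, integral_ker_shift j hx, one_mul]
  have hs : Tendsto (fun j => ((√(1 - width j) : ℝ) : ℂ)) atTop (𝓝 1) := by
    have h1 : Tendsto (fun j => √(1 - width j)) atTop (𝓝 1) := by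
      have := (Real.continuous_sqrt.tendsto _).comp (tendsto_width.const_sub 1)
      simpa [Function.comp_def] using this
    exact_mod_cast (continuous_ofReal.tendsto _).comp h1
  have := hs.smul hmain
  rw [one_smul] at this
  refine this.congr fun j => ?_
  have ha0 : 0 < 1 - width j := by linarith [width_lt_one j]
  have hs0 : ((√(1 - width j) : ℝ) : ℂ) ≠ 0 := by
    exact_mod_cast (Real.sqrt_pos.2 ha0).ne'
  exact smul_inv_smul₀ hs0 _

lemma tendsto_cls_smooth (f : L2) : Tendsto (fun j => cls (smooth j 0 f)) atTop (𝓝 f) := by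
  rw [Metric.tendsto_atTop']
  intro ε hε
  obtain ⟨g, hg⟩ : ∃ g : C(ℝ, ℂ), ‖f - cls g‖ < ε / 3 := by
    have hd := BoundedContinuousFunction.toLp_denseRange (E := ℂ) (μ := μ) (p := 2) ℂ (by norm_num)
    obtain ⟨g, hg⟩ := hd.exists_dist_lt f (by positivity : 0 < ε / 3)
    refine ⟨g.toContinuousMap, ?_⟩
    rwa [dist_eq_norm] at hg
  obtain ⟨N, hN⟩ := Metric.tendsto_atTop'.1 (tendsto_cls_smooth_cls g) (ε / 3) (by positivity)
  refine ⟨N, fun j hj => ?_⟩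
  have h1 := hN j hj
  rw [dist_eq_norm] at h1 ⊢
  have h2 := norm_cls_smooth_zero_le j (f - cls g)
  rw [map_sub, map_sub] at h2
  calc ‖cls (smooth j 0 f) - f‖ = ‖(cls (smooth j 0 f) - cls (smooth j 0 (cls g)))
        + (cls (smooth j 0 (cls g)) - cls g) - (f - cls g)‖ := by congr 1; abel
    _ ≤ ‖cls (smooth j 0 f) - cls (smooth j 0 (cls g))‖ + ‖cls (smooth j 0 (cls g)) - cls g‖
        + ‖f - cls g‖ := (norm_sub_le _ _).trans (by gcongr; exact norm_add_le _ _)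
    _ < ε := by linarith

/-- Smoothing does not increase the norms of the derivatives of `f ∈ W^m_2`. -/
lemma norm_cls_smooth_le {m : ℕ} {D : Fin (m + 1) → L2} (hD : D ∈ jets m) (j : ℕ)
    (i : Fin (m + 1)) : ‖cls (smooth j i (D 0))‖ ≤ ‖D i‖ := by
  have h0 := width_pos j
  have h1 := width_lt_one j
  have key : ∀ i : Fin (m + 1), ∀ n : ℕ, ‖cls (smooth j (i + n) (D 0))‖ ≤
      ‖cls (smooth j n (D i))‖ := by
    intro i
    induction i using Fin.induction with
    | zero => intro n; simp
    | succ i ih =>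
      intro n
      have := ih (n + 1)
      rw [cls_smooth_succ (hD i), norm_smul, Complex.norm_real,
        Real.norm_of_nonneg (by linarith)] at this
      have e : (i.succ : ℕ) + n = (i.castSucc : ℕ) + (n + 1) := by simp; ring
      rw [e]
      exact this.trans (mul_le_of_le_one_left (norm_nonneg _) (by linarith))
  exact (key i 0).trans (norm_cls_smooth_zero_le j _)

/-! ### A coercive form without boundary terms -/

lemma integral_norm_mul_le (f g : C(ℝ, ℂ)) :
    ∫ x in (0 : ℝ)..1, ‖f x‖ * ‖g x‖ ≤ ‖cls f‖ * ‖cls g‖ := by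
  refine abs_le_of_sq_le_sq' ?_ (by positivity) |>.2
  rw [← integral_μ_real, mul_pow, norm_cls_sq, norm_cls_sq, ← integral_μ_real, ← integral_μ_real]
  exact sq_integral_mul_le (memLp_continuous f).norm (memLp_continuous g).norm

/-- The function `x ↦ f (x / 2)`. -/
def half (f : C(ℝ, ℂ)) : C(ℝ, ℂ) := ⟨fun x => f (x / 2), by fun_prop⟩

@[simp] lemma half_apply (f : C(ℝ, ℂ)) (x : ℝ) : half f x = f (x / 2) := rfl

/-- The function `x ↦ f (1 - x)`. -/
def refl : C(ℝ, ℂ) →ₗ[ℂ] C(ℝ, ℂ) where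
  toFun f := ⟨fun x => f (1 - x), by fun_prop⟩
  map_add' _ _ := rfl
  map_smul' _ _ := rfl

@[simp] lemma refl_apply (f : C(ℝ, ℂ)) (x : ℝ) : refl f x = f (1 - x) := rfl

lemma norm_cls_refl (f : C(ℝ, ℂ)) : ‖cls (refl f)‖ = ‖cls f‖ := by
  rw [← sq_eq_sq₀ (norm_nonneg _) (norm_nonneg _), norm_cls_sq, norm_cls_sq]
  simpa using intervalIntegral.integral_comp_sub_left (a := 0) (b := 1) (fun x => ‖f x‖ ^ 2) 1

lemma norm_cls_half_le (f : C(ℝ, ℂ)) : ‖cls (half f)‖ ≤ 2 * ‖cls f‖ := by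
  refine abs_le_of_sq_le_sq' ?_ (by positivity) |>.2
  rw [mul_pow, norm_cls_sq, norm_cls_sq]
  have h1 : ∫ x in (0 : ℝ)..1, ‖half f x‖ ^ 2 = 2 * ∫ x in (0 : ℝ)..(1 / 2), ‖f x‖ ^ 2 := by
    have := intervalIntegral.integral_comp_div (a := 0) (b := 1) (fun x => ‖f x‖ ^ 2)
      (two_ne_zero (α := ℝ))
    simpa using this
  have h2 : ∫ x in (0 : ℝ)..(1 / 2), ‖f x‖ ^ 2 ≤ ∫ x in (0 : ℝ)..1, ‖f x‖ ^ 2 := by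
    refine intervalIntegral.integral_mono_interval le_rfl (by norm_num) (by norm_num)
      (Eventually.of_forall fun x => by positivity)
      (Continuous.intervalIntegrable (by fun_prop) _ _)
  have h3 : 0 ≤ ∫ x in (0 : ℝ)..1, ‖f x‖ ^ 2 :=
    intervalIntegral.integral_nonneg zero_le_one fun x _ => by positivity
  linarith

/-- The sesquilinear form
`∫₀¹ (1 - x) (3 p̄(x) q(x) - p̄(x) q(x/2) - p̄(x/2) q(x)) dx` in `p = u'`, `q = v'`. The dilations are
chosen such that integration by parts, in `u` or in `v`, produces no boundary term at `0`
(there is none at `1` because of the weight). -/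
def form (p q : C(ℝ, ℂ)) : ℂ :=
  ∫ x in (0 : ℝ)..1, ((1 - x : ℝ) : ℂ) *
    (3 * (star (p x) * q x) - star (p x) * q (x / 2) - star (p (x / 2)) * q x)

lemma form_star (p q : C(ℝ, ℂ)) : form q p = star (form p q) := by
  have : star (form p q) = ∫ x in (0 : ℝ)..1, star (((1 - x : ℝ) : ℂ) *
    (3 * (star (p x) * q x) - star (p x) * q (x / 2) - star (p (x / 2)) * q x)) := by
    rw [form, intervalIntegral.integral_of_le zero_le_one,
      intervalIntegral.integral_of_le zero_le_one]
    exact integral_conj.symm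
  rw [this]
  refine intervalIntegral.integral_congr fun x _ => ?_
  simp only [star_mul', star_sub, RCLike.star_def, Complex.conj_ofReal, Complex.conj_conj,
    map_ofNat]
  ring

lemma integral_weight_half_le (p : C(ℝ, ℂ)) :
    ∫ x in (0 : ℝ)..1, (1 - x) * ‖p (x / 2)‖ ^ 2 ≤ 2 * ∫ x in (0 : ℝ)..1, (1 - x) * ‖p x‖ ^ 2 := by
  have h1 : ∫ x in (0 : ℝ)..1, (1 - x) * ‖p (x / 2)‖ ^ 2
      = 2 * ∫ x in (0 : ℝ)..(1 / 2), (1 - 2 * x) * ‖p x‖ ^ 2 := by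
    have := intervalIntegral.integral_comp_div (a := 0) (b := 1)
      (fun x => (1 - 2 * x) * ‖p x‖ ^ 2) (two_ne_zero (α := ℝ))
    simp only [zero_div, smul_eq_mul] at this
    rw [← this]
    refine intervalIntegral.integral_congr fun x _ => ?_
    congr 2; ring
  have h2 : ∫ x in (0 : ℝ)..(1 / 2), (1 - 2 * x) * ‖p x‖ ^ 2
      ≤ ∫ x in (0 : ℝ)..(1 / 2), (1 - x) * ‖p x‖ ^ 2 := by
    refine intervalIntegral.integral_mono_on (by norm_num)
      (Continuous.intervalIntegrable (by fun_prop) _ _)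
      (Continuous.intervalIntegrable (by fun_prop) _ _) fun x hx => ?_
    gcongr
    linarith [hx.1]
  have h3 : ∫ x in (0 : ℝ)..(1 / 2), (1 - x) * ‖p x‖ ^ 2
      ≤ ∫ x in (0 : ℝ)..1, (1 - x) * ‖p x‖ ^ 2 := by
    refine intervalIntegral.integral_mono_interval le_rfl (by norm_num) (by norm_num) ?_
      (Continuous.intervalIntegrable (by fun_prop) _ _)
    refine (ae_restrict_iff' measurableSet_Ioc).2 (Eventually.of_forall fun x hx => ?_)
    have : 0 ≤ 1 - x := by linarith [hx.2]
    simp only [Pi.zero_apply]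
    positivity
  linarith

/-- Coercivity of the form; the constant is `3 - (3/2 + 2 · 2/3)`. -/
lemma le_norm_form (p : C(ℝ, ℂ)) :
    1 / 6 * ∫ x in (0 : ℝ)..1, (1 - x) * ‖p x‖ ^ 2 ≤ ‖form p p‖ := by
  have hre : (form p p).re = ∫ x in (0 : ℝ)..1, (1 - x) *
      (3 * ‖p x‖ ^ 2 - 2 * (star (p x) * p (x / 2)).re) := by
    have h := intervalIntegral.intervalIntegral_re (𝕜 := ℂ) (a := 0) (b := 1) (μ := volume)
      (f := fun x => ((1 - x : ℝ) : ℂ) *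
        (3 * (star (p x) * p x) - star (p x) * p (x / 2) - star (p (x / 2)) * p x))
      (Continuous.intervalIntegrable (by fun_prop) _ _)
    rw [form, ← RCLike.re_to_complex, ← h]
    refine intervalIntegral.integral_congr fun x _ => ?_
    simp only [RCLike.re_to_complex, Complex.re_ofReal_mul, Complex.sub_re]
    rw [← Complex.normSq_eq_norm_sq]
    congr 1
    simp [Complex.normSq_apply]
    ring
  refine le_trans ?_ (Complex.re_le_norm _)
  rw [hre]
  have h1 : ∫ x in (0 : ℝ)..1, (1 - x) * (3 / 2 * ‖p x‖ ^ 2 - 2 / 3 * ‖p (x / 2)‖ ^ 2)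
      ≤ ∫ x in (0 : ℝ)..1, (1 - x) * (3 * ‖p x‖ ^ 2 - 2 * (star (p x) * p (x / 2)).re) := by
    refine intervalIntegral.integral_mono_on (by norm_num)
      (Continuous.intervalIntegrable (by fun_prop) _ _)
      (Continuous.intervalIntegrable (by fun_prop) _ _) fun x hx => ?_
    have hx1 : 0 ≤ 1 - x := by linarith [hx.2]
    refine mul_le_mul_of_nonneg_left ?_ hx1
    have h2 : (star (p x) * p (x / 2)).re ≤ ‖p x‖ * ‖p (x / 2)‖ := by
      refine (Complex.re_le_norm _).trans_eq ?_
      rw [norm_mul, norm_star]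
    nlinarith [sq_nonneg (3 * ‖p x‖ - 2 * ‖p (x / 2)‖)]
  have h2 : ∫ x in (0 : ℝ)..1, (1 - x) * (3 / 2 * ‖p x‖ ^ 2 - 2 / 3 * ‖p (x / 2)‖ ^ 2)
      = 3 / 2 * (∫ x in (0 : ℝ)..1, (1 - x) * ‖p x‖ ^ 2)
        - 2 / 3 * ∫ x in (0 : ℝ)..1, (1 - x) * ‖p (x / 2)‖ ^ 2 := by
    rw [← intervalIntegral.integral_const_mul, ← intervalIntegral.integral_const_mul,
      ← intervalIntegral.integral_sub (Continuous.intervalIntegrable (by fun_prop) _ _)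
        (Continuous.intervalIntegrable (by fun_prop) _ _)]
    refine intervalIntegral.integral_congr fun x _ => ?_
    ring
  linarith [integral_weight_half_le p]

lemma norm_form_le {u p q r : C(ℝ, ℂ)} (hu : ∀ x, HasDerivAt u (p x) x)
    (hq : ∀ x, HasDerivAt q (r x) x) : ‖form p q‖ ≤ 17 * ‖cls u‖ * (‖cls q‖ + ‖cls r‖) := by
  -- the remainder of the integration by parts
  let R : ℝ → ℂ := fun x =>
    -(3 * (star (u x) * q x) - star (u x) * q (x / 2) - 2 * (star (u (x / 2)) * q x))
    + ((1 - x : ℝ) : ℂ) * (3 * (star (u x) * r x) - star (u x) * (r (x / 2) * (1 / 2))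
      - 2 * (star (u (x / 2)) * r x))
  have hhalf : ∀ x : ℝ, HasDerivAt (fun x : ℝ => x / 2) (1 / 2) x := fun x =>
    (hasDerivAt_id x).div_const 2
  have hint : ∫ x in (0 : ℝ)..1, (((1 - x : ℝ) : ℂ) *
      (3 * (star (p x) * q x) - star (p x) * q (x / 2) - star (p (x / 2)) * q x) + R x) = 0 := by
    have hderiv : ∀ x ∈ Set.uIcc (0 : ℝ) 1, HasDerivAt (fun x => ((1 - x : ℝ) : ℂ) *
        (3 * (star (u x) * q x) - star (u x) * q (x / 2) - 2 * (star (u (x / 2)) * q x)))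
        (((1 - x : ℝ) : ℂ) *
          (3 * (star (p x) * q x) - star (p x) * q (x / 2) - star (p (x / 2)) * q x) + R x) x := by
      intro x _
      have h1 : HasDerivAt (fun x : ℝ => ((1 - x : ℝ) : ℂ)) ((-1 : ℝ) : ℂ) x := by
        simpa using ((hasDerivAt_id x).const_sub 1).ofReal_comp
      have h2 := (hu x).star
      have h3 : HasDerivAt (fun x => q (x / 2)) (r (x / 2) * (1 / 2)) x := by
        exact ((hq (x / 2)).scomp x (hhalf x)).congr_deriv (by simp [mul_comm])
      have h4 : HasDerivAt (fun x => star (u (x / 2))) (star (p (x / 2)) * (1 / 2)) x := by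
        have := (hu (x / 2)).star.scomp x (hhalf x)
        refine HasDerivAt.congr_deriv this ?_
        simp [mul_comm]
      have := h1.mul ((((h2.mul (hq x)).const_mul 3).sub (h2.mul h3)).sub
        ((h4.mul (hq x)).const_mul 2))
      refine this.congr_deriv ?_
      simp only [R, Pi.mul_apply, Pi.sub_apply]
      push_cast
      ring
    rw [intervalIntegral.integral_eq_sub_of_hasDerivAt hderiv
      (Continuous.intervalIntegrable (by fun_prop) _ _)]
    simp; ring
  rw [intervalIntegral.integral_add (Continuous.intervalIntegrable (by fun_prop) _ _)
    (Continuous.intervalIntegrable (by fun_prop) _ _)] at hint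
  have hform : form p q = -∫ x in (0 : ℝ)..1, R x := eq_neg_of_add_eq_zero_left hint
  have hbound : ‖∫ x in (0 : ℝ)..1, R x‖ ≤ ∫ x in (0 : ℝ)..1,
      (3 * (‖u x‖ * ‖q x‖) + ‖u x‖ * ‖half q x‖ + 2 * (‖half u x‖ * ‖q x‖)
      + 3 * (‖u x‖ * ‖r x‖) + ‖u x‖ * ‖half r x‖ + 2 * (‖half u x‖ * ‖r x‖)) := by
    refine intervalIntegral.norm_integral_le_of_norm_le zero_le_one
      (Eventually.of_forall fun x hx => ?_) (Continuous.intervalIntegrable (by fun_prop) _ _)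
    have hx1 : ‖((1 - x : ℝ) : ℂ)‖ ≤ 1 := by
      rw [Complex.norm_real, Real.norm_eq_abs, abs_le]
      constructor <;> linarith [hx.1, hx.2]
    have hA : ‖-(3 * (star (u x) * q x) - star (u x) * q (x / 2) - 2 * (star (u (x / 2)) * q x))‖
        ≤ 3 * (‖u x‖ * ‖q x‖) + ‖u x‖ * ‖q (x / 2)‖ + 2 * (‖u (x / 2)‖ * ‖q x‖) := by
      rw [norm_neg]
      refine (norm_sub_le _ _).trans ((add_le_add_left (norm_sub_le _ _) _).trans_eq ?_)
      simp
    have hB : ‖((1 - x : ℝ) : ℂ) * (3 * (star (u x) * r x) - star (u x) * (r (x / 2) * (1 / 2))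
        - 2 * (star (u (x / 2)) * r x))‖
        ≤ 3 * (‖u x‖ * ‖r x‖) + ‖u x‖ * ‖r (x / 2)‖ + 2 * (‖u (x / 2)‖ * ‖r x‖) := by
      rw [norm_mul]
      refine (mul_le_of_le_one_left (norm_nonneg _) hx1).trans ?_
      refine (norm_sub_le _ _).trans ((add_le_add_left (norm_sub_le _ _) _).trans ?_)
      simp only [norm_mul, norm_star, Complex.norm_ofNat, norm_div, norm_one]
      have : 0 ≤ ‖u x‖ * ‖r (x / 2)‖ := by positivity
      linarith
    refine (norm_add_le _ _).trans ((add_le_add hA hB).trans_eq ?_)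
    simp only [half_apply]; ring
  have hI : ∀ f g : C(ℝ, ℂ), IntervalIntegrable (fun x => ‖f x‖ * ‖g x‖) volume 0 1 := fun f g =>
    Continuous.intervalIntegrable (by fun_prop) _ _
  have hsplit : ∫ x in (0 : ℝ)..1,
      (3 * (‖u x‖ * ‖q x‖) + ‖u x‖ * ‖half q x‖ + 2 * (‖half u x‖ * ‖q x‖)
      + 3 * (‖u x‖ * ‖r x‖) + ‖u x‖ * ‖half r x‖ + 2 * (‖half u x‖ * ‖r x‖))
      = 3 * (∫ x in (0 : ℝ)..1, ‖u x‖ * ‖q x‖) + (∫ x in (0 : ℝ)..1, ‖u x‖ * ‖half q x‖)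
      + 2 * (∫ x in (0 : ℝ)..1, ‖half u x‖ * ‖q x‖) + 3 * (∫ x in (0 : ℝ)..1, ‖u x‖ * ‖r x‖)
      + (∫ x in (0 : ℝ)..1, ‖u x‖ * ‖half r x‖)
      + 2 * ∫ x in (0 : ℝ)..1, ‖half u x‖ * ‖r x‖ := by
    rw [intervalIntegral.integral_add ((((((hI _ _).const_mul _).add (hI _ _)).add
        ((hI _ _).const_mul _)).add ((hI _ _).const_mul _)).add (hI _ _)) ((hI _ _).const_mul _),
      intervalIntegral.integral_add (((((hI _ _).const_mul _).add (hI _ _)).add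
        ((hI _ _).const_mul _)).add ((hI _ _).const_mul _)) (hI _ _),
      intervalIntegral.integral_add ((((hI _ _).const_mul _).add (hI _ _)).add
        ((hI _ _).const_mul _)) ((hI _ _).const_mul _),
      intervalIntegral.integral_add (((hI _ _).const_mul _).add (hI _ _)) ((hI _ _).const_mul _),
      intervalIntegral.integral_add ((hI _ _).const_mul _) (hI _ _)]
    simp only [intervalIntegral.integral_const_mul]
  rw [hsplit] at hbound
  rw [hform, norm_neg]
  have a1 := integral_norm_mul_le u q
  have a2 := (integral_norm_mul_le u (half q)).trans
    (mul_le_mul_of_nonneg_left (norm_cls_half_le q) (norm_nonneg _))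
  have a3 := (integral_norm_mul_le (half u) q).trans
    (mul_le_mul_of_nonneg_right (norm_cls_half_le u) (norm_nonneg _))
  have a4 := integral_norm_mul_le u r
  have a5 := (integral_norm_mul_le u (half r)).trans
    (mul_le_mul_of_nonneg_left (norm_cls_half_le r) (norm_nonneg _))
  have a6 := (integral_norm_mul_le (half u) r).trans
    (mul_le_mul_of_nonneg_right (norm_cls_half_le u) (norm_nonneg _))
  nlinarith [mul_nonneg (norm_nonneg (cls u)) (norm_nonneg (cls q)),
    mul_nonneg (norm_nonneg (cls u)) (norm_nonneg (cls r))]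

lemma norm_cls_sq_eq_weights (p : C(ℝ, ℂ)) : ‖cls p‖ ^ 2 =
    (∫ x in (0 : ℝ)..1, (1 - x) * ‖p x‖ ^ 2) + ∫ x in (0 : ℝ)..1, (1 - x) * ‖refl p x‖ ^ 2 := by
  have h : ∫ x in (0 : ℝ)..1, (1 - x) * ‖refl p x‖ ^ 2 = ∫ x in (0 : ℝ)..1, x * ‖p x‖ ^ 2 := by
    simpa using intervalIntegral.integral_comp_sub_left (a := 0) (b := 1)
      (fun x => x * ‖p x‖ ^ 2) 1
  rw [h, norm_cls_sq, ← intervalIntegral.integral_add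
    (Continuous.intervalIntegrable (by fun_prop) _ _)
    (Continuous.intervalIntegrable (by fun_prop) _ _)]
  refine intervalIntegral.integral_congr fun x _ => ?_
  ring

lemma hasDerivAt_refl {u p : C(ℝ, ℂ)} (hu : ∀ x, HasDerivAt u (p x) x) (x : ℝ) :
    HasDerivAt (refl u) ((-refl p) x) x := by
  exact ((hu (1 - x)).scomp x ((hasDerivAt_id x).const_sub 1)).congr_deriv (by simp)

/-- The inequality `|v'| ≤ 204 |v| + |v''|` in `L₂(0,1)`. -/
lemma norm_cls_deriv_le {v q r : C(ℝ, ℂ)} (hv : ∀ x, HasDerivAt v (q x) x)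
    (hq : ∀ x, HasDerivAt q (r x) x) : ‖cls q‖ ≤ 204 * ‖cls v‖ + ‖cls r‖ := by
  have h1 := (le_norm_form q).trans (norm_form_le hv hq)
  have hr : ∀ x, HasDerivAt (-refl q) (refl r x) x := fun x => by
    simpa using (hasDerivAt_refl hq x).neg
  have h2 := (le_norm_form (-refl q)).trans
    (norm_form_le (hasDerivAt_refl hv) hr)
  simp only [map_neg, norm_neg, norm_cls_refl, ContinuousMap.neg_apply] at h2
  have h3 := norm_cls_sq_eq_weights q
  refine abs_le_of_sq_le_sq' ?_ (by positivity) |>.2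
  nlinarith [norm_nonneg (cls v), norm_nonneg (cls r), norm_nonneg (cls q),
    sq_nonneg (‖cls q‖ - 204 * ‖cls v‖), sq_nonneg ‖cls r‖]

open HadamardThreeLines

/-! ### Interpolation of first derivatives -/

lemma closure_strip : closure (verticalStrip 0 1) = verticalClosedStrip 0 1 := by
  unfold verticalStrip verticalClosedStrip
  rw [closure_preimage_re, closure_Ioo zero_ne_one]

/-- The maximum principle on the strip `0 ≤ Re z ≤ 1` for bounded functions. -/
lemma norm_le_of_strip {E : Type*} [NormedAddCommGroup E] [NormedSpace ℂ E] {F : ℂ → E} {M : ℝ}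
    (hd : DiffContOnCl ℂ F (verticalStrip 0 1))
    (hb : ∃ C : ℝ, ∀ z ∈ verticalClosedStrip 0 1, ‖F z‖ ≤ C)
    (h0 : ∀ t : ℝ, ‖F (t * I)‖ ≤ M) (h1 : ∀ t : ℝ, ‖F (1 + t * I)‖ ≤ M) {z : ℂ}
    (hz : z ∈ verticalClosedStrip 0 1) : ‖F z‖ ≤ M := by
  obtain ⟨C, hC⟩ := hb
  refine PhragmenLindelof.vertical_strip (a := 0) (b := 1) hd ⟨0, by simp [Real.pi_pos], 0, ?_⟩
    (fun z hz => ?_) (fun z hz => ?_) hz.1 hz.2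
  · refine Asymptotics.IsBigO.of_bound C ?_
    refine Filter.eventually_inf_principal.2 (Eventually.of_forall fun z hz => ?_)
    simpa using hC z (Set.Ioo_subset_Icc_self hz)
  · have : z = (z.im : ℂ) * I := by apply Complex.ext <;> simp [hz]
    rw [this]; exact h0 _
  · have : z = 1 + (z.im : ℂ) * I := by apply Complex.ext <;> simp [hz]
    rw [this]; exact h1 _

/-- For a bounded sesquilinear form `b` and a holomorphic `F`, the function
`z ↦ b (F (1 - z̄)) (F z)` is holomorphic. -/
lemma diffContOnCl_sesq (b : L2 →L⋆[ℂ] L2 →L[ℂ] ℂ) {F : ℂ → L2}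
    (hF : DiffContOnCl ℂ F (verticalStrip 0 1)) :
    DiffContOnCl ℂ (fun z => b (F (1 - star z)) (F z)) (verticalStrip 0 1) := by
  have hmaps : Set.MapsTo (fun z : ℂ => 1 - star z) (verticalStrip 0 1) (verticalStrip 0 1) := by
    intro z hz
    simp only [verticalStrip, Set.mem_preimage, Set.mem_Ioo, Complex.sub_re, Complex.one_re,
      RCLike.star_def, Complex.conj_re] at hz ⊢
    constructor <;> linarith [hz.1, hz.2]
  have hopen : IsOpen (verticalStrip 0 1) := isOpen_Ioo.preimage Complex.continuous_re
  refine ⟨fun z hz => ?_, ?_⟩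
  · have hFz := (hF.differentiableAt hopen hz)
    have hFw := (hF.differentiableAt hopen (hmaps hz)).hasDerivAt
    have hg : HasDerivAt (fun z => b (F (1 - star z)))
        (-b (deriv F (1 - star z))) z := by
      rw [hasDerivAt_iff_tendsto_slope] at hFw ⊢
      have hc : Tendsto (fun y : ℂ => 1 - star y) (𝓝[≠] z) (𝓝[≠] (1 - star z)) := by
        refine tendsto_nhdsWithin_of_tendsto_nhds_of_eventually_within _ ?_ ?_
        · exact ((continuous_const.sub continuous_star).tendsto z).mono_left nhdsWithin_le_nhds
        · filter_upwards [self_mem_nhdsWithin] with y hy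
          simp only [Set.mem_compl_iff, Set.mem_singleton_iff, sub_right_inj] at hy ⊢
          exact fun h => hy (star_injective h)
      have := ((b.continuous.tendsto _).comp (hFw.comp hc)).neg
      refine this.congr fun y => ?_
      simp only [Function.comp_apply, slope, vsub_eq_sub]
      rw [ContinuousLinearMap.map_smulₛₗ, map_sub, map_inv₀, ← smul_neg]
      have e : (starRingEnd ℂ) (1 - star y - (1 - star z)) = -(y - z) := by
        simp
      rw [e, inv_neg, neg_smul, smul_neg, neg_neg]
    exact (hg.differentiableAt.clm_apply hFz).differentiableWithinAt
  · have h2 : ContinuousOn (fun z : ℂ => F (1 - star z)) (closure (verticalStrip 0 1)) := by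
      refine hF.continuousOn.comp (by fun_prop) (hmaps.closure (by fun_prop))
    exact (b.continuous.comp_continuousOn h2).clm_apply hF.continuousOn

/-- A linear smoothing operator with values in the continuous functions, bounded for the supremum
norm on `[0,1]`, turns the form into a bounded sesquilinear form on `L₂`. -/
lemma exists_sesq_form (U : L2 →ₗ[ℂ] C(ℝ, ℂ)) {C : ℝ} (hC0 : 0 ≤ C)
    (hC : ∀ f, ∀ x ∈ Set.Icc (0 : ℝ) 1, ‖U f x‖ ≤ C * ‖f‖) :
    ∃ b : L2 →L⋆[ℂ] L2 →L[ℂ] ℂ, ∀ f g, b f g = form (U f) (U g) := by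
  have hI : ∀ p q : C(ℝ, ℂ), IntervalIntegrable (fun x => ((1 - x : ℝ) : ℂ) *
    (3 * (star (p x) * q x) - star (p x) * q (x / 2) - star (p (x / 2)) * q x)) volume 0 1 :=
    fun p q => Continuous.intervalIntegrable (by fun_prop) _ _
  let B : L2 →ₗ⋆[ℂ] L2 →ₗ[ℂ] ℂ := LinearMap.mk₂'ₛₗ (starRingEnd ℂ) (RingHom.id ℂ)
    (fun f g => form (U f) (U g))
    (fun f f' g => by
      rw [form, form, form, ← intervalIntegral.integral_add (hI _ _) (hI _ _)]
      refine intervalIntegral.integral_congr fun x _ => ?_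
      simp only [map_add, ContinuousMap.add_apply, star_add]
      ring)
    (fun c f g => by
      rw [form, form, smul_eq_mul, ← intervalIntegral.integral_const_mul]
      refine intervalIntegral.integral_congr fun x _ => ?_
      simp only [map_smul, ContinuousMap.smul_apply, smul_eq_mul, star_mul', RCLike.star_def]
      ring)
    (fun f g g' => by
      rw [form, form, form, ← intervalIntegral.integral_add (hI _ _) (hI _ _)]
      refine intervalIntegral.integral_congr fun x _ => ?_
      simp only [map_add, ContinuousMap.add_apply]
      ring)
    (fun c f g => by
      rw [form, form, RingHom.id_apply, smul_eq_mul, ← intervalIntegral.integral_const_mul]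
      refine intervalIntegral.integral_congr fun x _ => ?_
      simp only [map_smul, ContinuousMap.smul_apply, smul_eq_mul]
      ring)
  refine ⟨B.mkContinuous₂ (5 * C ^ 2) fun f g => ?_, fun f g => rfl⟩
  have : ‖form (U f) (U g)‖ ≤ 5 * C ^ 2 * ‖f‖ * ‖g‖ * |(1 : ℝ) - 0| := by
    refine intervalIntegral.norm_integral_le_of_norm_le_const fun x hx => ?_
    rw [Set.uIoc_of_le zero_le_one] at hx
    have hx0 : x ∈ Set.Icc (0 : ℝ) 1 := ⟨hx.1.le, hx.2⟩
    have hx2 : x / 2 ∈ Set.Icc (0 : ℝ) 1 := ⟨by linarith [hx.1], by linarith [hx.1, hx.2]⟩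
    have hx1 : ‖((1 - x : ℝ) : ℂ)‖ ≤ 1 := by
      rw [Complex.norm_real, Real.norm_eq_abs, abs_le]
      constructor <;> linarith [hx.1, hx.2]
    rw [norm_mul]
    refine (mul_le_of_le_one_left (norm_nonneg _) hx1).trans ?_
    have hp : ∀ y ∈ Set.Icc (0 : ℝ) 1, ∀ z ∈ Set.Icc (0 : ℝ) 1,
        ‖star (U f y) * U g z‖ ≤ C ^ 2 * ‖f‖ * ‖g‖ := fun y hy z hz => by
      rw [norm_mul, norm_star]
      calc _ ≤ (C * ‖f‖) * (C * ‖g‖) := by gcongr; exacts [hC f y hy, hC g z hz]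
        _ = _ := by ring
    refine (norm_sub_le _ _).trans ((add_le_add_left (norm_sub_le _ _) _).trans ?_)
    rw [norm_mul 3]
    have h1 := hp x hx0 x hx0
    have h2 := hp x hx0 _ hx2
    have h3 := hp _ hx2 x hx0
    simp only [Complex.norm_ofNat]
    linarith
  rw [sub_zero, abs_one, mul_one] at this
  exact this

/-- Let `F` be holomorphic on the strip, and let `U₀`, `U₁`, `U₂` be consecutive derivatives of a
smoothing operator. Then the `U₁`-norm in the middle is controlled by the `U₀`-norm on the left and
the norms of `U₁`, `U₂` on the right: apply the maximum principle to the form of `F (1 - z̄)` and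
`F z`, which is coercive on the line `Re z = 1/2`. -/
lemma weighted_middle_le (U₀ U₁ U₂ : L2 →ₗ[ℂ] C(ℝ, ℂ))
    (h01 : ∀ f x, HasDerivAt (U₀ f) (U₁ f x) x) (h12 : ∀ f x, HasDerivAt (U₁ f) (U₂ f x) x)
    {C : ℝ} (hC0 : 0 ≤ C) (hC : ∀ f, ∀ x ∈ Set.Icc (0 : ℝ) 1, ‖U₁ f x‖ ≤ C * ‖f‖)
    {F : ℂ → L2} (hF : DiffContOnCl ℂ F (verticalStrip 0 1))
    (hb : ∃ C : ℝ, ∀ z ∈ verticalClosedStrip 0 1, ‖F z‖ ≤ C) {m₀ m₁ : ℝ} (hm₀ : 0 ≤ m₀)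
    (h0 : ∀ t : ℝ, ‖cls (U₀ (F (t * I)))‖ ≤ m₀)
    (h1 : ∀ t : ℝ, ‖cls (U₁ (F (1 + t * I)))‖ + ‖cls (U₂ (F (1 + t * I)))‖ ≤ m₁) :
    ∫ x in (0 : ℝ)..1, (1 - x) * ‖U₁ (F (1 / 2)) x‖ ^ 2 ≤ 102 * (m₀ * m₁) := by
  obtain ⟨b, hbf⟩ := exists_sesq_form U₁ hC0 hC
  have hd := diffContOnCl_sesq b hF
  obtain ⟨K, hK⟩ := hb
  have hbd : ∃ C : ℝ, ∀ z ∈ verticalClosedStrip 0 1, ‖b (F (1 - star z)) (F z)‖ ≤ C := by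
    refine ⟨‖b‖ * K * K, fun z hz => ?_⟩
    have hz' : 1 - star z ∈ verticalClosedStrip 0 1 := by
      simp only [verticalClosedStrip, Set.mem_preimage, Set.mem_Icc, Complex.sub_re, Complex.one_re,
        RCLike.star_def, Complex.conj_re] at hz ⊢
      constructor <;> linarith [hz.1, hz.2]
    refine (b.le_opNorm₂ _ _).trans ?_
    have hK0 : 0 ≤ K := (norm_nonneg _).trans (hK z hz)
    gcongr
    exacts [hK _ hz', hK _ hz]
  have key : ∀ t : ℝ, ‖form (U₁ (F (t * I))) (U₁ (F (1 + t * I)))‖ ≤ 17 * (m₀ * m₁) := fun t => by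
    refine (norm_form_le (h01 _) (h12 _)).trans ?_
    rw [mul_assoc]
    gcongr
    exacts [h0 t, h1 t]
  have hle := norm_le_of_strip (M := 17 * (m₀ * m₁)) hd hbd (fun t => ?_) (fun t => ?_)
    (z := 1 / 2) (by simp [verticalClosedStrip]; norm_num)
  · have e : (1 : ℂ) - star (1 / 2) = 1 / 2 := by simp; norm_num
    rw [e, hbf] at hle
    have := (le_norm_form (U₁ (F (1 / 2)))).trans hle
    linarith
  · have e : (1 : ℂ) - star ((t : ℂ) * I) = 1 + t * I := by simp
    rw [e, hbf, form_star, norm_star]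
    exact key t
  · have e : (1 : ℂ) - star (1 + (t : ℂ) * I) = t * I := by simp
    rw [e, hbf]
    exact key t

/-- The weights `1 - x` and `x`, the latter obtained by reflection, sum to one. -/
lemma smooth_middle_le (j i : ℕ) {F : ℂ → L2} (hF : DiffContOnCl ℂ F (verticalStrip 0 1))
    (hb : ∃ C : ℝ, ∀ z ∈ verticalClosedStrip 0 1, ‖F z‖ ≤ C) {m₀ m₁ : ℝ} (hm₀ : 0 ≤ m₀)
    (h0 : ∀ t : ℝ, ‖cls (smooth j i (F (t * I)))‖ ≤ m₀)
    (h1 : ∀ t : ℝ, ‖cls (smooth j (i + 1) (F (1 + t * I)))‖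
      + ‖cls (smooth j (i + 2) (F (1 + t * I)))‖ ≤ m₁) :
    ‖cls (smooth j (i + 1) (F (1 / 2)))‖ ^ 2 ≤ 204 * (m₀ * m₁) := by
  obtain ⟨C, hC0, hC⟩ := exists_smooth_bound j (i + 1)
  have a1 := weighted_middle_le (smooth j i) (smooth j (i + 1)) (smooth j (i + 2))
    (hasDerivAt_smooth j i) (hasDerivAt_smooth j (i + 1)) hC0 (fun f x _ => hC f x) hF hb hm₀ h0 h1
  have a2 := weighted_middle_le (refl ∘ₗ smooth j i) (-(refl ∘ₗ smooth j (i + 1)))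
    (refl ∘ₗ smooth j (i + 2)) (fun f => hasDerivAt_refl (hasDerivAt_smooth j i f))
    (fun f x => by
      simpa using (hasDerivAt_refl (hasDerivAt_smooth j (i + 1) f) x).neg) hC0
    (fun f x _ => by simpa using hC f (1 - x)) hF hb hm₀
    (fun t => by simpa [norm_cls_refl] using h0 t) (fun t => by simpa [norm_cls_refl] using h1 t)
  simp only [LinearMap.neg_apply, ContinuousMap.neg_apply, norm_neg, LinearMap.comp_apply] at a2
  rw [norm_cls_sq_eq_weights]
  linarith

/-- The restriction of a function on the strip to a smaller strip, parametrized affinely. -/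
lemma strip_comp {F : ℂ → L2} (hF : DiffContOnCl ℂ F (verticalStrip 0 1))
    (hb : ∃ C : ℝ, ∀ z ∈ verticalClosedStrip 0 1, ‖F z‖ ≤ C) {c d : ℝ} (hc : 0 ≤ c) (hd : 0 < d)
    (hcd : c + d ≤ 1) (t : ℝ) :
    DiffContOnCl ℂ (fun z => F (c + d * z + t * I)) (verticalStrip 0 1) ∧
    ∃ C : ℝ, ∀ z ∈ verticalClosedStrip 0 1, ‖F (c + d * z + t * I)‖ ≤ C := by
  refine ⟨hF.comp (Differentiable.diffContOnCl (by fun_prop)) fun z hz => ?_, ?_⟩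
  · simp only [verticalStrip, Set.mem_preimage, Set.mem_Ioo] at hz ⊢
    simp
    constructor <;> nlinarith [hz.1, hz.2]
  · obtain ⟨C, hC⟩ := hb
    refine ⟨C, fun z hz => hC _ ?_⟩
    simp only [verticalClosedStrip, Set.mem_preimage, Set.mem_Icc] at hz ⊢
    simp
    constructor <;> nlinarith [hz.1, hz.2]

lemma norm_cls_smooth_le_of_intENorm {m : ℕ} {f : L2} {M : ℝ} (hM : 0 ≤ M)
    (h : intENorm m f ≤ ENNReal.ofReal M) (j : ℕ) {i : ℕ} (hi : i ≤ m) :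
    ‖cls (smooth j i f)‖ ≤ M := by
  obtain ⟨D, hD⟩ := exists_isWeakJet (h.trans_lt ENNReal.ofReal_lt_top)
  have h1 := norm_cls_smooth_le hD.mem_jets j ⟨i, by omega⟩
  rw [hD.1] at h1
  refine h1.trans ?_
  have h2 := (enorm_le_intENorm hD ⟨i, by omega⟩).trans h
  rw [← ofReal_norm, ENNReal.ofReal_le_ofReal_iff hM] at h2
  exact h2

lemma intENorm_le_of_smooth {m : ℕ} {f : L2} {M : ℝ}
    (h : ∀ j : ℕ, ∀ i ≤ m, ‖cls (smooth j i f)‖ ≤ M) :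
    intENorm m f ≤ ENNReal.ofReal ((m + 1) * M) := by
  obtain ⟨D, hD, hDM⟩ := exists_isWeakJet_of_tendsto (l := atTop) (m := m) (M := M)
    (v := fun j i => cls (smooth j i f)) (u := f)
    (Eventually.of_forall fun j i => hasWeakDeriv_cls (hasDerivAt_smooth j i f))
    (Eventually.of_forall fun j i => h j i (Nat.lt_succ_iff.1 i.2))
    (tendsto_cls_smooth f)
  have := intENorm_le_mul hD (M := ENNReal.ofReal M) fun k => by
    rw [← ofReal_norm]; exact ENNReal.ofReal_le_ofReal (hDM k)
  refine this.trans_eq ?_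
  rw [ENNReal.ofReal_mul (by positivity), ← ENNReal.ofReal_natCast]
  push_cast; rfl

/-- The complex interpolation space `[L₂, W²_2]_{1/2}` is contained in `W¹_2`. -/
lemma intENorm_one_le {F : ℂ → L2} {M : ℝ} (hM : 0 ≤ M)
    (hF : DiffContOnCl ℂ F (verticalStrip 0 1))
    (hb : ∃ C : ℝ, ∀ z ∈ verticalClosedStrip 0 1, ‖F z‖ ≤ C)
    (h0 : ∀ t : ℝ, ‖F (t * I)‖ ≤ M)
    (h1 : ∀ t : ℝ, intENorm 2 (F (1 + t * I)) ≤ ENNReal.ofReal M) :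
    intENorm 1 (F (1 / 2)) ≤ ENNReal.ofReal (42 * M) := by
  have hz : ∀ z ∈ verticalClosedStrip 0 1, ∀ j, ‖cls (smooth j 0 (F z))‖ ≤ M := fun z hz j =>
    (norm_cls_smooth_zero_le j _).trans (norm_le_of_strip hF hb h0 (fun t => by
      have h := h1 t
      obtain ⟨D, hD⟩ := exists_isWeakJet (h.trans_lt ENNReal.ofReal_lt_top)
      have h2 := (enorm_le_intENorm hD 0).trans h
      rw [hD.1, ← ofReal_norm, ENNReal.ofReal_le_ofReal_iff hM] at h2
      exact h2) hz)
  have := intENorm_le_of_smooth (m := 1) (f := F (1 / 2)) (M := 21 * M) ?_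
  · convert this using 2
    push_cast; ring
  intro j i hi
  interval_cases i
  · exact (hz _ (by simp [verticalClosedStrip]; norm_num) j).trans (by linarith)
  · have := smooth_middle_le j 0 hF hb hM
      (fun t => (norm_cls_smooth_zero_le j _).trans (h0 t)) (m₁ := 2 * M) (fun t => by
        have e1 := norm_cls_smooth_le_of_intENorm hM (h1 t) j (i := 1) (by norm_num)
        have e2 := norm_cls_smooth_le_of_intENorm hM (h1 t) j (i := 2) (by norm_num)
        linarith)
    refine abs_le_of_sq_le_sq' ?_ (by positivity) |>.2
    nlinarith [sq_nonneg M]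

lemma le_of_mutual_bounds {A M x y : ℝ} (hA : 1 ≤ A) (hM : 0 < M)
    (h1 : x ^ 2 ≤ A * (M * (M + y))) (h2 : y ^ 2 ≤ A * (x * M)) : y ≤ 2 * A * M := by
  by_contra! h
  have hAM : 0 < A * M := by positivity
  have hMy : M ≤ y := by nlinarith
  have hy0 : 0 < y := hM.trans_le hMy
  have h3 : y ^ 4 ≤ 2 * (A * M) ^ 3 * y := by
    calc y ^ 4 = (y ^ 2) ^ 2 := by ring
      _ ≤ (A * (x * M)) ^ 2 := by gcongr
      _ = A ^ 2 * M ^ 2 * x ^ 2 := by ring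
      _ ≤ A ^ 2 * M ^ 2 * (A * (M * (M + y))) := by gcongr
      _ ≤ A ^ 2 * M ^ 2 * (A * (M * (y + y))) := by gcongr
      _ = _ := by ring
  have h4 : y ^ 3 ≤ 2 * (A * M) ^ 3 := le_of_mul_le_mul_right (by linarith [h3]) hy0
  have h5 : (2 * A * M) ^ 3 < y ^ 3 := by gcongr
  nlinarith [pow_pos hAM 3]

/-- The complex interpolation space `[L₂, W³_2]_{2/3}` is contained in `W²_2`: the suprema `N₁`, `N₂`
of the norms of the first derivative on the line `Re z = 1/3` and of the second derivative on the
line `Re z = 2/3` control each other. -/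
lemma intENorm_two_le {F : ℂ → L2} {M : ℝ} (hM : 0 < M)
    (hF : DiffContOnCl ℂ F (verticalStrip 0 1))
    (hb : ∃ C : ℝ, ∀ z ∈ verticalClosedStrip 0 1, ‖F z‖ ≤ C)
    (h0 : ∀ t : ℝ, ‖F (t * I)‖ ≤ M)
    (h1 : ∀ t : ℝ, intENorm 3 (F (1 + t * I)) ≤ ENNReal.ofReal M) :
    intENorm 2 (F (2 / 3)) ≤ ENNReal.ofReal (252000 * M) := by
  have hz : ∀ z ∈ verticalClosedStrip 0 1, ∀ j, ‖cls (smooth j 0 (F z))‖ ≤ M := fun z hz j =>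
    (norm_cls_smooth_zero_le j _).trans (norm_le_of_strip hF hb h0 (fun t => by
      have h := h1 t
      obtain ⟨D, hD⟩ := exists_isWeakJet (h.trans_lt ENNReal.ofReal_lt_top)
      have h2 := (enorm_le_intENorm hD 0).trans h
      rw [hD.1, ← ofReal_norm, ENNReal.ofReal_le_ofReal_iff hM.le] at h2
      exact h2) hz)
  have hm1 : ∀ t : ℝ, (1 / 3 + t * I : ℂ) ∈ verticalClosedStrip 0 1 := fun t => by
    simp [verticalClosedStrip]; norm_num
  have hm2 : ∀ t : ℝ, (2 / 3 + t * I : ℂ) ∈ verticalClosedStrip 0 1 := fun t => by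
    simp [verticalClosedStrip]; norm_num
  have main : ∀ j, ∀ t : ℝ, ‖cls (smooth j 2 (F (2 / 3 + t * I)))‖ ≤ 2 * 41820 * M := by
    intro j
    have hbdd : ∀ (i : ℕ) (s : ℝ → ℂ), (∀ t, s t ∈ verticalClosedStrip 0 1) →
        BddAbove (Set.range fun t => ‖cls (smooth j i (F (s t)))‖) := by
      intro i s hs
      obtain ⟨C, hC0, hC⟩ := exists_smooth_bound j i
      obtain ⟨K, hK⟩ := hb
      refine ⟨C * K, ?_⟩
      rintro _ ⟨t, rfl⟩
      have hK0 : 0 ≤ K := (norm_nonneg _).trans (hK _ (hs t))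
      refine norm_cls_le (by positivity) fun x _ => (hC _ x).trans ?_
      gcongr
      exact hK _ (hs t)
    set N₁ := ⨆ t : ℝ, ‖cls (smooth j 1 (F (1 / 3 + t * I)))‖ with hN₁
    set N₂ := ⨆ t : ℝ, ‖cls (smooth j 2 (F (2 / 3 + t * I)))‖ with hN₂
    have l1 : ∀ t : ℝ, ‖cls (smooth j 1 (F (1 / 3 + t * I)))‖ ≤ N₁ := fun t =>
      le_ciSup (hbdd 1 (fun t : ℝ => 1 / 3 + t * I) hm1) t
    have l2 : ∀ t : ℝ, ‖cls (smooth j 2 (F (2 / 3 + t * I)))‖ ≤ N₂ := fun t =>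
      le_ciSup (hbdd 2 (fun t : ℝ => 2 / 3 + t * I) hm2) t
    have n1 : 0 ≤ N₁ := (norm_nonneg _).trans (l1 0)
    have n2 : 0 ≤ N₂ := (norm_nonneg _).trans (l2 0)
    have b1 : ∀ t : ℝ, ‖cls (smooth j 1 (F (1 / 3 + t * I)))‖ ^ 2 ≤
        204 * (M * (204 * M + 2 * N₂)) := by
      intro t
      obtain ⟨d1, d2⟩ := strip_comp hF hb (c := 0) (d := 2 / 3) le_rfl (by norm_num)
        (by norm_num) t
      have := smooth_middle_le j 0 d1 d2 (m₀ := M) (m₁ := 204 * M + 2 * N₂) hM.le (fun s => ?_)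
        (fun s => ?_)
      · convert this using 6
        push_cast; ring
      · have e : ((0 : ℝ) : ℂ) + ((2 / 3 : ℝ) : ℂ) * (s * I) + t * I
            = ((2 / 3 * s + t : ℝ) : ℂ) * I := by push_cast; ring
        rw [e]
        exact (norm_cls_smooth_zero_le j _).trans (h0 _)
      · have e : ((0 : ℝ) : ℂ) + ((2 / 3 : ℝ) : ℂ) * (1 + s * I) + t * I
            = 2 / 3 + ((2 / 3 * s + t : ℝ) : ℂ) * I := by push_cast; ring
        rw [e]
        have e2 := hz _ (hm2 (2 / 3 * s + t)) j
        have e3 := l2 (2 / 3 * s + t)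
        generalize F (2 / 3 + ((2 / 3 * s + t : ℝ) : ℂ) * I) = g at e2 e3
        have e1 : ‖cls (smooth j 1 g)‖ ≤ 204 * ‖cls (smooth j 0 g)‖ + ‖cls (smooth j 2 g)‖ :=
          norm_cls_deriv_le (hasDerivAt_smooth j 0 g) (hasDerivAt_smooth j 1 g)
        linarith
    have b2 : ∀ t : ℝ, ‖cls (smooth j 2 (F (2 / 3 + t * I)))‖ ^ 2 ≤ 204 * (N₁ * (2 * M)) := by
      intro t
      obtain ⟨d1, d2⟩ := strip_comp hF hb (c := 1 / 3) (d := 2 / 3) (by norm_num) (by norm_num)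
        (by norm_num) t
      have := smooth_middle_le j 1 d1 d2 (m₀ := N₁) (m₁ := 2 * M) n1 (fun s => ?_)
        (fun s => ?_)
      · convert this using 6
        push_cast; ring
      · have e : ((1 / 3 : ℝ) : ℂ) + ((2 / 3 : ℝ) : ℂ) * (s * I) + t * I
            = 1 / 3 + ((2 / 3 * s + t : ℝ) : ℂ) * I := by push_cast; ring
        rw [e]
        exact l1 _
      · have e : ((1 / 3 : ℝ) : ℂ) + ((2 / 3 : ℝ) : ℂ) * (1 + s * I) + t * I
            = 1 + ((2 / 3 * s + t : ℝ) : ℂ) * I := by push_cast; ring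
        rw [e]
        have e1 := norm_cls_smooth_le_of_intENorm hM.le (h1 (2 / 3 * s + t)) j (i := 2)
          (by norm_num)
        have e2 := norm_cls_smooth_le_of_intENorm hM.le (h1 (2 / 3 * s + t)) j (i := 3)
          (by norm_num)
        linarith
    have c1 : N₁ ^ 2 ≤ 41820 * (M * (M + N₂)) := by
      have h : N₁ ≤ √(204 * (M * (204 * M + 2 * N₂))) :=
        ciSup_le fun t => Real.le_sqrt_of_sq_le (b1 t)
      have h' := pow_le_pow_left₀ n1 h 2
      rw [Real.sq_sqrt (by positivity)] at h'
      nlinarith [mul_nonneg hM.le n2, mul_nonneg hM.le hM.le]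
    have c2 : N₂ ^ 2 ≤ 41820 * (N₁ * M) := by
      have h : N₂ ≤ √(204 * (N₁ * (2 * M))) := ciSup_le fun t => Real.le_sqrt_of_sq_le (b2 t)
      have h' := pow_le_pow_left₀ n2 h 2
      rw [Real.sq_sqrt (by positivity)] at h'
      nlinarith [mul_nonneg n1 hM.le]
    exact fun t => (l2 t).trans (le_of_mutual_bounds (by norm_num) hM c1 c2)
  have := intENorm_le_of_smooth (m := 2) (f := F (2 / 3)) (M := 84000 * M) ?_
  · convert this using 2
    push_cast; ring
  intro j i hi
  have e0 : ‖cls (smooth j 0 (F (2 / 3)))‖ ≤ M := hz _ (by simpa using hm2 0) j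
  have e2 : ‖cls (smooth j 2 (F (2 / 3)))‖ ≤ 2 * 41820 * M := by simpa using main j 0
  have e1 : ‖cls (smooth j 1 (F (2 / 3)))‖
      ≤ 204 * ‖cls (smooth j 0 (F (2 / 3)))‖ + ‖cls (smooth j 2 (F (2 / 3)))‖ :=
    norm_cls_deriv_le (hasDerivAt_smooth j 0 _) (hasDerivAt_smooth j 1 _)
  interval_cases i <;> linarith

/-! ### Recursion over the domain of integration -/

/-- The domain `u ≤ y_k ≤ … ≤ y_1 ≤ s + ξ_k(y) ≤ 1`; for `u = 0` it is `Π*_k(s)`. -/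
def region (k : ℕ) (u s : ℝ) : Set (Fin k → ℝ) :=
  {y | Antitone y ∧ (∀ l, u ≤ y l) ∧ (∀ l, y l ≤ s + xi y) ∧ u ≤ s + xi y ∧ s + xi y ≤ 1}

/-- The product `f_1(s + ξ_k(y)) f_2(y_1) ⋯ f_{k+1}(y_k)`, for functions with values in any
commutative semiring. -/
def prodAt {R : Type*} [CommSemiring R] (k : ℕ) (f : Fin (k + 1) → ℝ → R) (s : ℝ) (y : Fin k → ℝ) :
    R :=
  f 0 (s + xi y) * ∏ l : Fin k, f l.succ (y l)

lemma region_zero {k : ℕ} (hk : 1 ≤ k) (s : ℝ) : region k 0 s = PiStar k s := by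
  ext y
  simp only [region, PiStar, Set.mem_ofPred_eq]
  refine ⟨fun h => ⟨h.1, h.2.1, h.2.2.1, h.2.2.2.2⟩, fun h => ⟨h.1, h.2.1, h.2.2.1, ?_, h.2.2.2⟩⟩
  exact (h.2.1 ⟨0, hk⟩).trans (h.2.2.1 ⟨0, hk⟩)

lemma xi_snoc {k : ℕ} (y : Fin k → ℝ) (z : ℝ) :
    xi (Fin.snoc y z : Fin (k + 1) → ℝ) = xi y + (-1) ^ k * z := by
  simp [xi, Fin.sum_univ_castSucc]

lemma antitone_snoc {k : ℕ} (y : Fin k → ℝ) (z : ℝ) :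
    Antitone (Fin.snoc y z : Fin (k + 1) → ℝ) ↔ Antitone y ∧ ∀ l, z ≤ y l := by
  constructor
  · refine fun h => ⟨fun i j hij => ?_, fun l => ?_⟩
    · simpa using h (Fin.castSucc_le_castSucc_iff.2 hij)
    · simpa using h (Fin.le_last l.castSucc)
  · rintro ⟨h1, h2⟩ i j hij
    induction j using Fin.lastCases with
    | last =>
      induction i using Fin.lastCases with
      | last => exact le_rfl
      | cast i => simpa using h2 i
    | cast j =>
      induction i using Fin.lastCases with
      | last => exact absurd hij (not_le.2 (Fin.castSucc_lt_last j))
      | cast i => simpa using h1 (Fin.castSucc_le_castSucc_iff.1 hij)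

lemma snoc_mem_region {k : ℕ} {u s z : ℝ} {y : Fin k → ℝ} :
    (Fin.snoc y z : Fin (k + 1) → ℝ) ∈ region (k + 1) u s ↔
      u ≤ z ∧ y ∈ region k z (s + (-1) ^ k * z) := by
  have e : s + (xi y + (-1) ^ k * z) = s + (-1) ^ k * z + xi y := by ring
  simp only [region, Set.mem_ofPred_eq, xi_snoc, antitone_snoc, Fin.forall_fin_succ', e,
    Fin.snoc_castSucc, Fin.snoc_last]
  constructor
  · rintro ⟨⟨a1, a2⟩, ⟨_, a4⟩, ⟨a5, a6⟩, _, a8⟩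
    exact ⟨a4, a1, a2, a5, a6, a8⟩
  · rintro ⟨a4, a1, a2, a5, a6, a8⟩
    exact ⟨⟨a1, a2⟩, ⟨fun l => a4.trans (a2 l), a4⟩, ⟨a5, a6⟩, a4.trans a6, a8⟩

lemma region_eq_empty {k : ℕ} {u : ℝ} (hu : 1 < u) (s : ℝ) : region k u s = ∅ := by
  ext y
  simp only [region, Set.mem_ofPred_eq, Set.mem_empty_iff_false, iff_false]
  rintro ⟨_, _, _, h1, h2⟩
  linarith

lemma region_le_one {k : ℕ} {u s : ℝ} {y : Fin k → ℝ} (hy : y ∈ region k u s) :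
    (∀ l, y l ∈ Set.Icc u 1) ∧ s + xi y ∈ Set.Icc u 1 :=
  ⟨fun l => ⟨hy.2.1 l, (hy.2.2.1 l).trans hy.2.2.2.2⟩, hy.2.2.2⟩

lemma prodAt_snoc {R : Type*} [CommSemiring R] {k : ℕ} (f : Fin (k + 2) → ℝ → R) (s z : ℝ)
    (y : Fin k → ℝ) :
    prodAt (k + 1) f s (Fin.snoc y z : Fin (k + 1) → ℝ) =
      f (Fin.last _) z * prodAt k (fun l => f l.castSucc) (s + (-1) ^ k * z) y := by
  have e : s + (xi y + (-1) ^ k * z) = s + (-1) ^ k * z + xi y := by ring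
  simp only [prodAt, xi_snoc, Fin.prod_univ_castSucc, Fin.snoc_castSucc, Fin.snoc_last, e,
    Fin.succ_last, Fin.castSucc_zero, Fin.succ_castSucc, Nat.succ_eq_add_one]
  ring

@[fun_prop]
lemma continuous_xi {k : ℕ} : Continuous (xi : (Fin k → ℝ) → ℝ) := by
  unfold xi; fun_prop

lemma measurableSet_region (k : ℕ) :
    MeasurableSet {p : (ℝ × ℝ) × (Fin k → ℝ) | p.2 ∈ region k p.1.1 p.1.2} := by
  have e : {p : (ℝ × ℝ) × (Fin k → ℝ) | p.2 ∈ region k p.1.1 p.1.2} =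
      (⋂ i, ⋂ j, ⋂ (_ : i ≤ j), {p | p.2 j ≤ p.2 i}) ∩ ((⋂ l, {p | p.1.1 ≤ p.2 l}) ∩
      ((⋂ l, {p | p.2 l ≤ p.1.2 + xi p.2}) ∩ ({p | p.1.1 ≤ p.1.2 + xi p.2} ∩
      {p | p.1.2 + xi p.2 ≤ 1}))) := by
    ext p
    simp [region, Antitone]
  rw [e]
  refine IsClosed.measurableSet ?_
  refine IsClosed.inter (isClosed_iInter fun i => isClosed_iInter fun j => isClosed_iInter fun _ =>
    isClosed_le (by fun_prop) (by fun_prop)) (IsClosed.inter (isClosed_iInter fun l =>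
    isClosed_le (by fun_prop) (by fun_prop)) (IsClosed.inter (isClosed_iInter fun l =>
    isClosed_le (by fun_prop) (by fun_prop)) (IsClosed.inter
    (isClosed_le (by fun_prop) (by fun_prop)) (isClosed_le (by fun_prop) (by fun_prop)))))

lemma measurableSet_region' (k : ℕ) (u s : ℝ) : MeasurableSet (region k u s) :=
  measurable_prodMk_left (x := (u, s)) (measurableSet_region k)

lemma measurePreserving_snoc (k : ℕ) :
    MeasurePreserving (fun p : ℝ × (Fin k → ℝ) => (Fin.snoc p.2 p.1 : Fin (k + 1) → ℝ)) := by
  have h := (volume_preserving_piFinSuccAbove (fun _ : Fin (k + 1) => ℝ) (Fin.last k)).symm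
  convert h using 1
  funext p
  simp [MeasurableEquiv.piFinSuccAbove]
  rfl

lemma lintegral_snoc {k : ℕ} {G : (Fin (k + 1) → ℝ) → ℝ≥0∞} (hG : Measurable G) :
    ∫⁻ y, G y = ∫⁻ z : ℝ, ∫⁻ y : Fin k → ℝ, G (Fin.snoc y z : Fin (k + 1) → ℝ) := by
  have h := measurePreserving_snoc k
  rw [← h.lintegral_comp hG, Measure.volume_eq_prod, lintegral_prod]
  exact (hG.comp h.measurable).aemeasurable

lemma integral_snoc {k : ℕ} {G : (Fin (k + 1) → ℝ) → ℂ} (hG : Integrable G) :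
    ∫ y, G y = ∫ z : ℝ, ∫ y : Fin k → ℝ, G (Fin.snoc y z : Fin (k + 1) → ℝ) := by
  have h := (volume_preserving_piFinSuccAbove (fun _ : Fin (k + 1) => ℝ) (Fin.last k)).symm
  have h2 := measurePreserving_snoc k
  have e : ∀ p, (MeasurableEquiv.piFinSuccAbove (fun _ : Fin (k + 1) => ℝ) (Fin.last k)).symm p
      = (Fin.snoc p.2 p.1 : Fin (k + 1) → ℝ) := fun p => by
    simp [MeasurableEquiv.piFinSuccAbove]
    rfl
  rw [← h.integral_comp' G, Measure.volume_eq_prod, integral_prod]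
  · simp only [e]
  · have := h.integrable_comp_emb (MeasurableEquiv.measurableEmbedding _) (g := G)
    exact this.2 hG

/-! ### The square-integral bound for `I_n` -/

lemma measurable_prodAt {R : Type*} [CommSemiring R] [MeasurableSpace R] [MeasurableMul₂ R] {k : ℕ}
    {f : Fin (k + 1) → ℝ → R} (hf : ∀ l, Measurable (f l)) :
    Measurable fun p : ℝ × (Fin k → ℝ) => prodAt k f p.1 p.2 := by
  unfold prodAt
  refine ((hf 0).comp ?_).mul (Finset.measurable_fun_prod _ fun l _ => (hf _).comp ?_)
  · exact Continuous.measurable (by fun_prop)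
  · exact Continuous.measurable (by fun_prop)

/-- The integral of `f_1(s + ξ_k(y)) f_2(y_1) ⋯ f_{k+1}(y_k)` over `region k u s`, for functions with
values in `[0,∞]`. -/
def lIn (k : ℕ) (f : Fin (k + 1) → ℝ → ℝ≥0∞) (u s : ℝ) : ℝ≥0∞ :=
  ∫⁻ y in region k u s, prodAt k f s y

lemma lIn_eq_indicator (k : ℕ) (f : Fin (k + 1) → ℝ → ℝ≥0∞) (u s : ℝ) :
    lIn k f u s = ∫⁻ y, (region k u s).indicator (prodAt k f s) y :=
  (lintegral_indicator (measurableSet_region' k u s) _).symm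

lemma measurable_lIn {k : ℕ} {f : Fin (k + 1) → ℝ → ℝ≥0∞} (hf : ∀ l, Measurable (f l)) :
    Measurable fun p : ℝ × ℝ => lIn k f p.1 p.2 := by
  simp only [lIn_eq_indicator]
  have h : Measurable (({p : (ℝ × ℝ) × (Fin k → ℝ) | p.2 ∈ region k p.1.1 p.1.2}).indicator
      fun p => prodAt k f p.1.2 p.2) := by
    refine Measurable.indicator ?_ (measurableSet_region k)
    exact (measurable_prodAt hf).comp (by fun_prop : Measurable
      fun p : (ℝ × ℝ) × (Fin k → ℝ) => (p.1.2, p.2))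
  have h2 := h.lintegral_prod_right' (ν := (volume : Measure (Fin k → ℝ)))
  exact h2

lemma lIn_succ {k : ℕ} {f : Fin (k + 2) → ℝ → ℝ≥0∞} (hf : ∀ l, Measurable (f l)) (u s : ℝ) :
    lIn (k + 1) f u s = ∫⁻ z in Set.Icc u 1,
      f (Fin.last _) z * lIn k (fun l => f l.castSucc) z (s + (-1) ^ k * z) := by
  have hm : Measurable (prodAt (k + 1) f s) := (measurable_prodAt hf).comp measurable_prodMk_left
  rw [lIn_eq_indicator, lintegral_snoc (hm.indicator (measurableSet_region' _ _ _)),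
    ← lintegral_indicator measurableSet_Icc]
  refine lintegral_congr fun z => ?_
  have hm' : Measurable (prodAt k (fun l => f l.castSucc) (s + (-1) ^ k * z)) :=
    (measurable_prodAt fun l => hf _).comp measurable_prodMk_left
  by_cases hz : z ∈ Set.Icc u 1
  · rw [Set.indicator_of_mem hz, lIn_eq_indicator, ← lintegral_const_mul _
      (hm'.indicator (measurableSet_region' _ _ _))]
    refine lintegral_congr fun y => ?_
    by_cases hy : y ∈ region k z (s + (-1) ^ k * z)
    · rw [Set.indicator_of_mem (snoc_mem_region.2 ⟨hz.1, hy⟩), Set.indicator_of_mem hy, prodAt_snoc]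
    · rw [Set.indicator_of_notMem (fun h => hy (snoc_mem_region.1 h).2),
        Set.indicator_of_notMem hy, mul_zero]
  · rw [Set.indicator_of_notMem hz, lintegral_eq_zero_of_ae_eq_zero]
    refine Eventually.of_forall fun y => Set.indicator_of_notMem (fun h => ?_) _
    rw [snoc_mem_region] at h
    refine hz ⟨h.1, ?_⟩
    by_contra! h1
    rw [region_eq_empty h1] at h
    exact h.2

lemma lintegral_mul_sq_le {X : Type*} [MeasurableSpace X] {ν : Measure X} {f g : X → ℝ≥0∞}
    (hf : AEMeasurable f ν) (hg : AEMeasurable g ν) :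
    (∫⁻ x, f x * g x ∂ν) ^ 2 ≤ (∫⁻ x, f x ^ 2 ∂ν) * ∫⁻ x, g x ^ 2 ∂ν := by
  have h := ENNReal.lintegral_mul_le_Lp_mul_Lq ν Real.HolderConjugate.two_two hf hg
  have e : ∀ a : ℝ≥0∞, (a ^ (1 / 2 : ℝ)) ^ 2 = a := fun a => by
    rw [← ENNReal.rpow_natCast, ← ENNReal.rpow_mul]; norm_num
  have h2 := pow_le_pow_left' h 2
  rw [mul_pow, e, e] at h2
  simpa using h2

lemma lintegral_simplex (k : ℕ) {u : ℝ} (hu : u ≤ 1) :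
    ∫⁻ z in Set.Icc u 1, ENNReal.ofReal ((1 - z) ^ k / k.factorial)
      = ENNReal.ofReal ((1 - u) ^ (k + 1) / (k + 1).factorial) := by
  rw [← ofReal_integral_eq_lintegral_ofReal]
  · congr 1
    rw [integral_Icc_eq_integral_Ioc, ← intervalIntegral.integral_of_le hu,
      intervalIntegral.integral_div,
      intervalIntegral.integral_comp_sub_left (fun z => z ^ k) 1, integral_pow]
    simp [Nat.factorial_succ]
    field_simp
  · exact (Continuous.integrableOn_Icc (by fun_prop))
  · refine (ae_restrict_iff' measurableSet_Icc).2 (Eventually.of_forall fun z hz => ?_)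
    have : 0 ≤ 1 - z := by linarith [hz.2]
    simp only [Pi.zero_apply]
    positivity

/-- The square-integral bound for `I_n`, by induction on the number of functions. -/
lemma lintegral_lIn_sq_le (k : ℕ) {f : Fin (k + 1) → ℝ → ℝ≥0∞} (hf : ∀ l, Measurable (f l))
    {u : ℝ} (hu : u ≤ 1) :
    ∫⁻ s, lIn k f u s ^ 2 ≤
      ENNReal.ofReal ((1 - u) ^ k / k.factorial) * ∏ l, ∫⁻ x, f l x ^ 2 := by
  induction k generalizing u with
  | zero =>
    simp only [pow_zero, Nat.factorial_zero, Nat.cast_one, div_one, ENNReal.ofReal_one, one_mul]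
    refine le_trans (b := ∫⁻ x, f 0 x ^ 2) ?_ (by simp)
    refine lintegral_mono fun s => pow_le_pow_left' ?_ 2
    rw [lIn]
    refine (setLIntegral_le_lintegral _ _).trans_eq ?_
    rw [lintegral_unique]
    simp [prodAt, xi, volume_pi]
  | succ k ih =>
    set g : Fin (k + 1) → ℝ → ℝ≥0∞ := fun l => f l.castSucc with hg
    have hgm : ∀ l, Measurable (g l) := fun l => hf _
    have hL : Measurable fun p : ℝ × ℝ => lIn k g p.2 (p.1 + (-1) ^ k * p.2) :=
      (measurable_lIn hgm).comp (by fun_prop : Measurable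
        fun p : ℝ × ℝ => (p.2, p.1 + (-1) ^ k * p.2))
    have hpt : ∀ s, lIn (k + 1) f u s ^ 2 ≤ (∫⁻ z, f (Fin.last _) z ^ 2) *
        ∫⁻ z in Set.Icc u 1, lIn k g z (s + (-1) ^ k * z) ^ 2 := fun s => by
      rw [lIn_succ hf]
      refine (lintegral_mul_sq_le (hf _).aemeasurable
        (hL.comp measurable_prodMk_left).aemeasurable).trans ?_
      exact mul_le_mul' (lintegral_mono' Measure.restrict_le_self le_rfl) le_rfl
    calc ∫⁻ s, lIn (k + 1) f u s ^ 2
        ≤ ∫⁻ s, (∫⁻ z, f (Fin.last _) z ^ 2) *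
          ∫⁻ z in Set.Icc u 1, lIn k g z (s + (-1) ^ k * z) ^ 2 := lintegral_mono hpt
      _ = (∫⁻ z, f (Fin.last _) z ^ 2) *
          ∫⁻ z in Set.Icc u 1, ∫⁻ s, lIn k g z (s + (-1) ^ k * z) ^ 2 := by
        rw [lintegral_const_mul _ ((hL.pow_const 2).lintegral_prod_right'
          (ν := volume.restrict (Set.Icc u 1))), lintegral_lintegral_swap]
        exact (hL.pow_const 2).aemeasurable
      _ ≤ (∫⁻ z, f (Fin.last _) z ^ 2) * ∫⁻ z in Set.Icc u 1,
          ENNReal.ofReal ((1 - z) ^ k / k.factorial) * ∏ l, ∫⁻ x, g l x ^ 2 := by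
        refine mul_le_mul' le_rfl ?_
        refine setLIntegral_mono' measurableSet_Icc fun z hz => ?_
        rw [lintegral_add_right_eq_self (fun s => lIn k g z s ^ 2)]
        exact ih hgm hz.2
      _ = _ := by
        rw [lintegral_mul_const _ (by fun_prop), lintegral_simplex k hu,
          Fin.prod_univ_castSucc fun l => ∫⁻ x, f l x ^ 2, mul_left_comm,
          mul_comm (∫⁻ x, f (Fin.last _) x ^ 2)]

/-! ### The multilinear operator `I_n` on `L₂` -/

lemma eLpNorm_two_sq (u : ℝ → ℂ) : eLpNorm u 2 μ ^ 2 = ∫⁻ x, ‖u x‖ₑ ^ 2 ∂μ := by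
  rw [eLpNorm_eq_lintegral_rpow_enorm_toReal (by norm_num) (by norm_num), ← ENNReal.rpow_natCast,
    ← ENNReal.rpow_mul]
  norm_num

lemma In_eq {k : ℕ} (hk : 1 ≤ k) (f : Fin (k + 1) → ℝ → ℂ) (s : ℝ) :
    In (k + 1) f s = ∫ y in region k 0 s, prodAt k f s y := by
  rw [region_zero hk]; rfl

/-- The product `f_1(s + ξ_k(y)) f_2(y_1) ⋯ f_{k+1}(y_k)` depends only on the classes of the
functions: as `k ≥ 1`, each of its arguments is a nonzero affine function of `y`. -/
lemma prodAt_congr {k : ℕ} (hk : 1 ≤ k) {f g : Fin (k + 1) → ℝ → ℂ} (h : ∀ l, f l =ᵐ[μ] g l)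
    (s : ℝ) : prodAt k f s =ᵐ[volume.restrict (region k 0 s)] prodAt k g s := by
  have h0 : ∀ᵐ x : ℝ, x ∈ Set.Icc (0 : ℝ) 1 → ∀ l, f l x = g l x := by
    have h1 : ∀ᵐ x : ℝ, x ∈ Set.Ioo (0 : ℝ) 1 → ∀ l, f l x = g l x :=
      (ae_restrict_iff' measurableSet_Ioo).1 (ae_all_iff.2 h)
    have h2 : ∀ᵐ x : ℝ, x ≠ 0 := by simp [ae_iff]
    have h3 : ∀ᵐ x : ℝ, x ≠ 1 := by simp [ae_iff]
    filter_upwards [h1, h2, h3] with x a1 a2 a3 hx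
    exact a1 ⟨lt_of_le_of_ne hx.1 a2.symm, lt_of_le_of_ne hx.2 a3⟩
  obtain ⟨T, hT, hTm, hT0⟩ := exists_measurable_superset_of_null (ae_iff.1 h0)
  have hTc : ∀ᵐ x : ℝ, x ∈ Tᶜ := by
    rw [ae_iff]; simpa using hT0
  have hgood : ∀ x ∈ Tᶜ, x ∈ Set.Icc (0 : ℝ) 1 → ∀ l, f l x = g l x := fun x hx => by
    by_contra hcon
    exact hx (hT hcon)
  have e1 : ∀ᵐ y : Fin k → ℝ, ∀ l, y l ∈ Tᶜ := ae_all_iff.2 fun l =>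
    (Measure.quasiMeasurePreserving_eval (μ := fun _ : Fin k => (volume : Measure ℝ)) l).ae hTc
  have e2 : ∀ᵐ y : Fin k → ℝ, s + xi y ∈ Tᶜ := by
    let L : (Fin k → ℝ) →ₗ[ℝ] ℝ := ∑ l : Fin k, (-1 : ℝ) ^ (l : ℕ) • LinearMap.proj l
    have hL : ∀ y, L y = xi y := fun y => by simp [L, xi]
    have hsurj : Function.Surjective L := fun r => by
      refine ⟨Pi.single ⟨0, hk⟩ r, ?_⟩
      rw [hL, xi, Finset.sum_eq_single ⟨0, hk⟩]
      · simp
      · intro b _ hb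
        simp [hb]
      · simp
    have hTs : ∀ᵐ x : ℝ, x ∈ (fun x => s + x) ⁻¹' Tᶜ :=
      (quasiMeasurePreserving_add_left (volume : Measure ℝ) s).ae hTc
    have := (ae_comp_linearMap_mem_iff L (volume : Measure (Fin k → ℝ)) volume hsurj
      (hTm.compl.preimage (measurable_const_add s))).2 hTs
    filter_upwards [this] with y hy
    rw [← hL]; exact hy
  refine (ae_restrict_iff' (measurableSet_region' k 0 s)).2 ?_
  filter_upwards [e1, e2] with y h1 h2 hy
  obtain ⟨a1, a2⟩ := region_le_one hy
  rw [prodAt, prodAt, hgood _ h2 a2 0]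
  congr 1
  exact Finset.prod_congr rfl fun l _ => hgood _ (h1 l) (a1 l) l.succ

lemma In_congr {k : ℕ} (hk : 1 ≤ k) {f g : Fin (k + 1) → ℝ → ℂ} (h : ∀ l, f l =ᵐ[μ] g l) :
    In (k + 1) f = In (k + 1) g := by
  funext s
  rw [In_eq hk, In_eq hk]
  exact integral_congr_ae (prodAt_congr hk h s)

lemma enorm_prodAt {k : ℕ} (f : Fin (k + 1) → ℝ → ℂ) (s : ℝ) (y : Fin k → ℝ) :
    ‖prodAt k f s y‖ₑ = prodAt k (fun l x => ‖f l x‖ₑ) s y := by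
  simp only [prodAt, enorm_mul]
  congr 1
  simp only [enorm_eq_nnnorm, nnnorm_prod]
  push_cast
  rfl

lemma exists_measurable_rep {k : ℕ} {f : Fin (k + 1) → ℝ → ℂ} (hf : ∀ l, MemLp (f l) 2 μ) :
    ∃ g : Fin (k + 1) → ℝ → ℂ, (∀ l, StronglyMeasurable (g l)) ∧ ∀ l, f l =ᵐ[μ] g l :=
  ⟨fun l => (hf l).1.mk, fun l => (hf l).1.stronglyMeasurable_mk, fun l => (hf l).1.ae_eq_mk⟩

lemma lintegral_prodAt_sq_le {k : ℕ} (hk : 1 ≤ k) {f : Fin (k + 1) → ℝ → ℂ}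
    (hf : ∀ l, MemLp (f l) 2 μ) :
    ∫⁻ s, (∫⁻ y in region k 0 s, ‖prodAt k f s y‖ₑ) ^ 2 ≤
      ENNReal.ofReal (1 / k.factorial) * ∏ l, eLpNorm (f l) 2 μ ^ 2 := by
  obtain ⟨g, hg, hfg⟩ := exists_measurable_rep hf
  let G : Fin (k + 1) → ℝ → ℝ≥0∞ := fun l => (Set.Icc (0 : ℝ) 1).indicator fun x => ‖g l x‖ₑ
  have hG : ∀ l, Measurable (G l) := fun l => (hg l).measurable.enorm.indicator measurableSet_Icc
  have h := lintegral_lIn_sq_le k hG zero_le_one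
  have e1 : ∀ s, ∫⁻ y in region k 0 s, ‖prodAt k f s y‖ₑ = lIn k G 0 s := fun s => by
    rw [lIn]
    have : ∫⁻ y in region k 0 s, ‖prodAt k f s y‖ₑ = ∫⁻ y in region k 0 s, ‖prodAt k g s y‖ₑ := by
      refine lintegral_congr_ae ?_
      filter_upwards [prodAt_congr hk hfg s] with y hy
      rw [hy]
    rw [this]
    refine setLIntegral_congr_fun (measurableSet_region' k 0 s) fun y hy => ?_
    obtain ⟨a1, a2⟩ := region_le_one hy
    rw [enorm_prodAt, prodAt, prodAt]
    congr 1
    · exact (Set.indicator_of_mem a2 fun x => ‖g 0 x‖ₑ).symm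
    · exact Finset.prod_congr rfl fun l _ =>
        (Set.indicator_of_mem (a1 l) fun x => ‖g l.succ x‖ₑ).symm
  have e2 : ∀ l, ∫⁻ x, G l x ^ 2 = eLpNorm (f l) 2 μ ^ 2 := fun l => by
    rw [eLpNorm_congr_ae (hfg l), eLpNorm_two_sq, μ, restrict_Ioo_eq_restrict_Icc,
      ← lintegral_indicator measurableSet_Icc]
    refine lintegral_congr fun x => ?_
    by_cases hx : x ∈ Set.Icc (0 : ℝ) 1 <;> simp [G, hx]
  simp only [e1]
  simpa [e2] using h

lemma ae_integrableOn {k : ℕ} (hk : 1 ≤ k) {f : Fin (k + 1) → ℝ → ℂ}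
    (hf : ∀ l, MemLp (f l) 2 μ) :
    ∀ᵐ s : ℝ, IntegrableOn (prodAt k f s) (region k 0 s) := by
  obtain ⟨g, hg, hfg⟩ := exists_measurable_rep hf
  have hgL : ∀ l, MemLp (g l) 2 μ := fun l => (memLp_congr_ae (hfg l)).1 (hf l)
  have h := lintegral_prodAt_sq_le hk hgL
  have hlt : ENNReal.ofReal (1 / k.factorial) * ∏ l, eLpNorm (g l) 2 μ ^ 2 < ⊤ :=
    ENNReal.mul_lt_top ENNReal.ofReal_lt_top
      (ENNReal.prod_lt_top fun l _ => ENNReal.pow_lt_top (hgL l).2)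
  have hmeas : Measurable fun s => ∫⁻ y in region k 0 s, ‖prodAt k g s y‖ₑ := by
    simp only [enorm_prodAt]
    have hm : ∀ l, Measurable fun x => ‖g l x‖ₑ := fun l => (hg l).measurable.enorm
    exact (measurable_lIn hm).comp measurable_prodMk_left
  have hae := ae_lt_top (hmeas.pow_const 2) (h.trans_lt hlt).ne
  filter_upwards [hae] with s hs
  have hm : Measurable (prodAt k g s) :=
    (measurable_prodAt fun l => (hg l).measurable).comp measurable_prodMk_left
  refine Integrable.congr ⟨hm.aestronglyMeasurable, ?_⟩ (prodAt_congr hk hfg s).symm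
  rw [hasFiniteIntegral_iff_enorm]
  simpa using hs

lemma memLp_In {k : ℕ} (hk : 1 ≤ k) {f : Fin (k + 1) → ℝ → ℂ} (hf : ∀ l, MemLp (f l) 2 μ) :
    MemLp (In (k + 1) f) 2 μ ∧
    eLpNorm (In (k + 1) f) 2 μ ^ 2 ≤
      ENNReal.ofReal (1 / k.factorial) * ∏ l, eLpNorm (f l) 2 μ ^ 2 := by
  obtain ⟨g, hg, hfg⟩ := exists_measurable_rep hf
  have hb : eLpNorm (In (k + 1) f) 2 μ ^ 2 ≤
      ENNReal.ofReal (1 / k.factorial) * ∏ l, eLpNorm (f l) 2 μ ^ 2 := by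
    rw [eLpNorm_two_sq]
    refine le_trans ?_ (lintegral_prodAt_sq_le hk hf)
    refine (setLIntegral_le_lintegral _ _).trans (lintegral_mono fun s => ?_)
    refine pow_le_pow_left' ?_ 2
    rw [In_eq hk]
    exact enorm_integral_le_lintegral_enorm _
  refine ⟨⟨?_, ?_⟩, hb⟩
  · rw [In_congr hk hfg]
    have h : StronglyMeasurable
        (({p : (ℝ × ℝ) × (Fin k → ℝ) | p.2 ∈ region k p.1.1 p.1.2}).indicator
        fun p => prodAt k g p.1.2 p.2) := by
      refine StronglyMeasurable.indicator (Measurable.stronglyMeasurable ?_) (measurableSet_region k)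
      exact (measurable_prodAt fun l => (hg l).measurable).comp (by fun_prop : Measurable
        fun p : (ℝ × ℝ) × (Fin k → ℝ) => (p.1.2, p.2))
    have h2 := (h.integral_prod_right' (ν := (volume : Measure (Fin k → ℝ)))).comp_measurable
      (measurable_prodMk_left (x := (0 : ℝ)))
    refine (StronglyMeasurable.aestronglyMeasurable ?_)
    convert h2 using 1
    funext s
    rw [In_eq hk, ← integral_indicator (measurableSet_region' k 0 s)]
    rfl
  · have : eLpNorm (In (k + 1) f) 2 μ ^ 2 < ⊤ := hb.trans_lt (ENNReal.mul_lt_top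
      ENNReal.ofReal_lt_top (ENNReal.prod_lt_top fun l _ => ENNReal.pow_lt_top (hf l).2))
    by_contra hcon
    rw [not_lt, top_le_iff] at hcon
    simp [hcon] at this

lemma prodAt_eq_prod {k : ℕ} (f : Fin (k + 1) → ℝ → ℂ) (s : ℝ) (y : Fin k → ℝ) :
    prodAt k f s y = ∏ l, f l ((Fin.cons (s + xi y) y : Fin (k + 1) → ℝ) l) := by
  rw [Fin.prod_univ_succ]
  simp [prodAt]

lemma prodAt_update_add {k : ℕ} (f : Fin (k + 1) → ℝ → ℂ) (i : Fin (k + 1)) (a b : ℝ → ℂ) (s : ℝ)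
    (y : Fin k → ℝ) : prodAt k (Function.update f i (a + b)) s y =
      prodAt k (Function.update f i a) s y + prodAt k (Function.update f i b) s y := by
  set arg : Fin (k + 1) → ℝ := Fin.cons (s + xi y) y
  have e : ∀ c : ℝ → ℂ, prodAt k (Function.update f i c) s y =
      MultilinearMap.mkPiAlgebra ℂ (Fin (k + 1)) ℂ
        (Function.update (fun l => f l (arg l)) i (c (arg i))) := fun c => by
    rw [prodAt_eq_prod, MultilinearMap.mkPiAlgebra_apply]
    refine Finset.prod_congr rfl fun l _ => ?_
    by_cases h : l = i
    · subst h; simp [arg]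
    · simp [h, arg]
  rw [e, e, e, Pi.add_apply, MultilinearMap.map_update_add]

lemma prodAt_update_smul {k : ℕ} (f : Fin (k + 1) → ℝ → ℂ) (i : Fin (k + 1)) (c : ℂ) (a : ℝ → ℂ)
    (s : ℝ) (y : Fin k → ℝ) : prodAt k (Function.update f i (c • a)) s y =
      c * prodAt k (Function.update f i a) s y := by
  set arg : Fin (k + 1) → ℝ := Fin.cons (s + xi y) y
  have e : ∀ c : ℝ → ℂ, prodAt k (Function.update f i c) s y =
      MultilinearMap.mkPiAlgebra ℂ (Fin (k + 1)) ℂ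
        (Function.update (fun l => f l (arg l)) i (c (arg i))) := fun c => by
    rw [prodAt_eq_prod, MultilinearMap.mkPiAlgebra_apply]
    refine Finset.prod_congr rfl fun l _ => ?_
    by_cases h : l = i
    · subst h; simp [arg]
    · simp [h, arg]
  rw [e, e, Pi.smul_apply, MultilinearMap.map_update_smul, smul_eq_mul]

lemma memLp_update {k : ℕ} {f : Fin (k + 1) → ℝ → ℂ} (hf : ∀ l, MemLp (f l) 2 μ) (i : Fin (k + 1))
    {a : ℝ → ℂ} (ha : MemLp a 2 μ) (l : Fin (k + 1)) : MemLp (Function.update f i a l) 2 μ := by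
  by_cases h : l = i
  · subst h; simpa using ha
  · simpa [h] using hf l

/-- The operator `I_{k+1}` as a multilinear map on classes of functions. -/
def Iop (k : ℕ) (hk : 1 ≤ k) : MultilinearMap ℂ (fun _ : Fin (k + 1) => L2) L2 :=
  MultilinearMap.mk'
    (fun f => (memLp_In hk fun l => Lp.memLp (f l)).1.toLp (In (k + 1) fun l => f l))
    (fun f i a b => by
      have hup : ∀ (c : L2) (c' : ℝ → ℂ), c =ᵐ[μ] c' →
          In (k + 1) (fun l => Function.update f i c l) =
          In (k + 1) (Function.update (fun l => (f l : ℝ → ℂ)) i c') := fun c c' hc => by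
        refine In_congr hk fun l => ?_
        by_cases h : l = i
        · subst h; simpa using hc
        · simp [h]
      rw [← MemLp.toLp_add]
      refine (MemLp.toLp_eq_toLp_iff _ _).2 ?_
      rw [hup _ _ (Lp.coeFn_add a b), hup a a (ae_eq_refl _), hup b b (ae_eq_refl _)]
      have i1 := ae_integrableOn hk (memLp_update (fun l => Lp.memLp (f l)) i (Lp.memLp a))
      have i2 := ae_integrableOn hk (memLp_update (fun l => Lp.memLp (f l)) i (Lp.memLp b))
      filter_upwards [ae_restrict_of_ae i1, ae_restrict_of_ae i2] with s h1 h2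
      rw [Pi.add_apply, In_eq hk, In_eq hk, In_eq hk, ← integral_add h1 h2]
      simp only [prodAt_update_add])
    (fun f i c a => by
      have hup : ∀ (c : L2) (c' : ℝ → ℂ), c =ᵐ[μ] c' →
          In (k + 1) (fun l => Function.update f i c l) =
          In (k + 1) (Function.update (fun l => (f l : ℝ → ℂ)) i c') := fun c c' hc => by
        refine In_congr hk fun l => ?_
        by_cases h : l = i
        · subst h; simpa using hc
        · simp [h]
      rw [← MemLp.toLp_const_smul]
      refine (MemLp.toLp_eq_toLp_iff _ _).2 (Eventually.of_forall fun s => ?_)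
      rw [hup _ _ (Lp.coeFn_smul c a), hup a a (ae_eq_refl _)]
      rw [Pi.smul_apply, In_eq hk, In_eq hk, smul_eq_mul, ← integral_const_mul]
      simp only [prodAt_update_smul])

lemma Iop_toLp {k : ℕ} (hk : 1 ≤ k) {f : Fin (k + 1) → ℝ → ℂ} (hf : ∀ l, MemLp (f l) 2 μ) :
    Iop k hk (fun l => (hf l).toLp (f l)) = (memLp_In hk hf).1.toLp (In (k + 1) f) := by
  refine (MemLp.toLp_eq_toLp_iff (memLp_In hk fun l => Lp.memLp ((hf l).toLp (f l))).1
    (memLp_In hk hf).1).2 ?_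
  rw [In_congr hk fun l => (hf l).coeFn_toLp]

lemma norm_Iop_le {k : ℕ} (hk : 1 ≤ k) (f : Fin (k + 1) → L2) :
    ‖Iop k hk f‖ ≤ 1 / √(k.factorial : ℝ) * ∏ l, ‖f l‖ := by
  have h := (memLp_In hk fun l => Lp.memLp (f l)).2
  have h2 : ‖Iop k hk f‖ ^ 2 ≤ 1 / k.factorial * ∏ l, ‖f l‖ ^ 2 := by
    have e : ‖Iop k hk f‖ₑ = eLpNorm (In (k + 1) fun l => f l) 2 μ := Lp.enorm_toLp (memLp_In hk fun l => Lp.memLp (f l)).1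
    simp only [← Lp.enorm_def] at h
    rw [← e] at h
    have := ENNReal.toReal_mono ?_ h
    · simpa [ENNReal.toReal_mul, ENNReal.toReal_prod] using this
    · exact (ENNReal.mul_lt_top ENNReal.ofReal_lt_top
        (ENNReal.prod_lt_top fun l _ => ENNReal.pow_lt_top enorm_lt_top)).ne
  refine abs_le_of_sq_le_sq' ?_ (by positivity) |>.2
  refine h2.trans_eq ?_
  rw [mul_pow, div_pow, Real.sq_sqrt (by positivity), Finset.prod_pow, one_pow]

/-! ### The integral operators of the recursion, for continuous functions -/

/-- Differentiation of an integral whose upper limit and integrand depend on a parameter. -/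
lemma hasDerivAt_integral_upper {Φ Φ' : ℝ → ℝ → ℂ} (hΦ : Continuous ↿Φ) (hΦ' : Continuous ↿Φ')
    (hd : ∀ x r, HasDerivAt (fun x => Φ x r) (Φ' x r) x) (c : ℝ) {b : ℝ → ℝ} {b' x : ℝ}
    (hb : HasDerivAt b b' x) :
    HasDerivAt (fun x => ∫ r in c..b x, Φ x r) (b' * Φ x (b x) + ∫ r in c..b x, Φ' x r) x := by
  let G : ℝ → ℝ → ℂ := fun x y => ∫ r in c..y, Φ x r
  have d1 : ∀ x y, HasDerivAt (fun x => G x y) (∫ r in c..y, Φ' x r) x := by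
    intro x y
    have hcomp : IsCompact (Metric.closedBall x 1 ×ˢ Set.uIcc c y) :=
      (isCompact_closedBall x 1).prod isCompact_uIcc
    obtain ⟨K, hK⟩ := hcomp.exists_bound_of_continuousOn hΦ'.continuousOn
    refine (intervalIntegral.hasDerivAt_integral_of_dominated_loc_of_deriv_le (F := Φ) (F' := Φ')
      (s := Metric.closedBall x 1) (bound := fun _ => K)
      (Metric.closedBall_mem_nhds x one_pos) ?_ ?_ ?_ ?_ ?_ ?_).2
    · exact Eventually.of_forall fun z =>
        (hΦ.comp (Continuous.prodMk_right z)).aestronglyMeasurable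
    · exact (hΦ.comp (Continuous.prodMk_right x)).intervalIntegrable _ _
    · exact (hΦ'.comp (Continuous.prodMk_right x)).aestronglyMeasurable
    · exact Eventually.of_forall fun r hr z hz => hK (z, r) ⟨hz, Set.uIoc_subset_uIcc hr⟩
    · exact intervalIntegrable_const
    · exact Eventually.of_forall fun r _ z _ => hd z r
  have d2 : ∀ x y, HasDerivAt (fun y => G x y) (Φ x y) y := fun x y =>
    intervalIntegral.integral_hasDerivAt_right
      ((hΦ.comp (Continuous.prodMk_right x)).intervalIntegrable _ _)
      (hΦ.comp (Continuous.prodMk_right x)).aestronglyMeasurable.stronglyMeasurableAtFilter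
      (hΦ.comp (Continuous.prodMk_right x)).continuousAt
  have hc1 : Continuous fun p : ℝ × ℝ => ∫ r in c..p.2, Φ' p.1 r :=
    intervalIntegral.continuous_parametric_intervalIntegral_of_continuous
      (f := fun (p : ℝ × ℝ) r => Φ' p.1 r)
      (hΦ'.comp (by fun_prop : Continuous fun q : (ℝ × ℝ) × ℝ => (q.1.1, q.2))) continuous_snd
  have hG : HasStrictFDerivAt ↿G _ (x, b x) := hasStrictFDerivAt_uncurry_coprod (𝕜 := ℝ)
    (f₁ := fun x y => ContinuousLinearMap.toSpanSingleton ℝ (∫ r in c..y, Φ' x r))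
    (f₂ := fun x y => ContinuousLinearMap.toSpanSingleton ℝ (Φ x y))
    (Eventually.of_forall fun v => (d1 v.1 v.2).hasFDerivAt)
    (Eventually.of_forall fun v => (d2 v.1 v.2).hasFDerivAt)
    (((ContinuousLinearMap.toSpanSingletonCLE (𝕜 := ℝ) (E := ℂ)).continuous.comp hc1).continuousAt)
    (((ContinuousLinearMap.toSpanSingletonCLE (𝕜 := ℝ) (E := ℂ)).continuous.comp hΦ).continuousAt)
  have := hG.hasFDerivAt.comp_hasDerivAt x ((hasDerivAt_id x).prodMk hb)
  refine HasDerivAt.congr_deriv this ?_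
  simp [Function.HasUncurry.uncurry]
  ring

/-- A function of the first variable, as a function of two variables. -/
def lift₁ : C(ℝ, ℂ) →ₗ[ℂ] C(ℝ × ℝ, ℂ) where
  toFun h := ⟨fun p => h p.1, by fun_prop⟩
  map_add' _ _ := rfl
  map_smul' _ _ := rfl

@[simp] lemma lift₁_apply (h : C(ℝ, ℂ)) (p : ℝ × ℝ) : lift₁ h p = h p.1 := rfl

/-- The operator `V_f B (x, v) = ∫_x^v f(τ) B(τ - x, τ) dτ` by which an additional function enters
the integral `I_n`, the variable `v` being the upper limit for all variables of integration. -/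
def V (f : C(ℝ, ℂ)) : C(ℝ × ℝ, ℂ) →ₗ[ℂ] C(ℝ × ℝ, ℂ) where
  toFun B :=
    { toFun := fun p => ∫ τ in p.1..p.2, f τ * B (τ - p.1, τ)
      continuous_toFun := by
        have h : Continuous (Function.uncurry fun (p : ℝ × ℝ) (τ : ℝ) => f τ * B (τ - p.1, τ)) := by
          simp only [Function.uncurry_def]
          fun_prop
        have e : ∀ p : ℝ × ℝ, ∫ τ in p.1..p.2, f τ * B (τ - p.1, τ)
            = (∫ τ in (0 : ℝ)..p.2, f τ * B (τ - p.1, τ))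
              - ∫ τ in (0 : ℝ)..p.1, f τ * B (τ - p.1, τ) := fun p =>
          (intervalIntegral.integral_interval_sub_left
            (Continuous.intervalIntegrable (by fun_prop) _ _)
            (Continuous.intervalIntegrable (by fun_prop) _ _)).symm
        simp only [e]
        exact (intervalIntegral.continuous_parametric_intervalIntegral_of_continuous h
          continuous_snd).sub
          (intervalIntegral.continuous_parametric_intervalIntegral_of_continuous h continuous_fst) }
  map_add' A B := by
    ext p
    simp only [ContinuousMap.coe_mk, ContinuousMap.add_apply, mul_add]
    exact intervalIntegral.integral_add (Continuous.intervalIntegrable (by fun_prop) _ _)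
      (Continuous.intervalIntegrable (by fun_prop) _ _)
  map_smul' c B := by
    ext p
    simp only [ContinuousMap.coe_mk, ContinuousMap.smul_apply, smul_eq_mul, RingHom.id_apply]
    rw [← intervalIntegral.integral_const_mul]
    exact intervalIntegral.integral_congr fun τ _ => by ring

lemma V_apply (f : C(ℝ, ℂ)) (B : C(ℝ × ℝ, ℂ)) (p : ℝ × ℝ) :
    V f B p = ∫ τ in p.1..p.2, f τ * B (τ - p.1, τ) := rfl

lemma V_apply' (f : C(ℝ, ℂ)) (B : C(ℝ × ℝ, ℂ)) (x v : ℝ) :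
    V f B (x, v) = ∫ r in (0 : ℝ)..v - x, f (x + r) * B (r, x + r) := by
  have := intervalIntegral.integral_comp_add_left (a := 0) (b := v - x)
    (fun τ => f τ * B (τ - x, τ)) x
  simp only [add_sub_cancel_left, add_zero, add_sub_cancel] at this
  exact this.symm

/-- The boundary term `f(v) B(v - x, v)`. -/
def endp (f : C(ℝ, ℂ)) (B : C(ℝ × ℝ, ℂ)) : C(ℝ × ℝ, ℂ) :=
  ⟨fun p => f p.2 * B (p.2 - p.1, p.2), by fun_prop⟩

@[simp] lemma endp_apply (f : C(ℝ, ℂ)) (B : C(ℝ × ℝ, ℂ)) (p : ℝ × ℝ) :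
    endp f B p = f p.2 * B (p.2 - p.1, p.2) := rfl

/-- The restriction to the line where the first variable vanishes. -/
def atZero (B : C(ℝ × ℝ, ℂ)) : C(ℝ, ℂ) := ⟨fun s => B (0, s), by fun_prop⟩

@[simp] lemma atZero_apply (B : C(ℝ × ℝ, ℂ)) (s : ℝ) : atZero B s = B (0, s) := rfl

/-- The primitive vanishing at `0`. -/
def prim (f : C(ℝ, ℂ)) : C(ℝ, ℂ) :=
  ⟨fun x => ∫ t in (0 : ℝ)..x, f t,
    intervalIntegral.continuous_primitive (fun _ _ => f.continuous.intervalIntegrable _ _) 0⟩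

lemma prim_apply (f : C(ℝ, ℂ)) (x : ℝ) : prim f x = ∫ t in (0 : ℝ)..x, f t := rfl

lemma hasDerivAt_prim (f : C(ℝ, ℂ)) (x : ℝ) : HasDerivAt (prim f) (f x) x :=
  intervalIntegral.integral_hasDerivAt_right (f.continuous.intervalIntegrable _ _)
    f.continuous.aestronglyMeasurable.stronglyMeasurableAtFilter f.continuous.continuousAt

/-- `B₁` is the partial derivative of `B` in the first variable. -/
def HasD (B B₁ : C(ℝ × ℝ, ℂ)) : Prop :=
  ∀ x v, HasDerivAt (fun x => B (x, v)) (B₁ (x, v)) x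

/-- Differentiation of `V f B` with the derivative falling on `B`. -/
lemma HasD.V {B B₁ : C(ℝ × ℝ, ℂ)} (h : HasD B B₁) (f : C(ℝ, ℂ)) :
    HasD (V f B) (-V f B₁ - lift₁ (f * atZero B)) := by
  intro x v
  have hΦ : Continuous ↿(fun x τ : ℝ => f τ * B (τ - x, τ)) := by
    simp only [Function.HasUncurry.uncurry]; fun_prop
  have hΦ' : Continuous ↿(fun x τ : ℝ => -(f τ * B₁ (τ - x, τ))) := by
    simp only [Function.HasUncurry.uncurry]; fun_prop
  have hd : ∀ x τ, HasDerivAt (fun x : ℝ => f τ * B (τ - x, τ)) (-(f τ * B₁ (τ - x, τ))) x := by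
    intro x τ
    have := ((h (τ - x) τ).scomp x ((hasDerivAt_id x).const_sub τ)).const_mul (f τ)
    refine HasDerivAt.congr_deriv this ?_
    simp
  have := (hasDerivAt_integral_upper hΦ hΦ' hd v (hasDerivAt_id x)).neg
  refine (this.congr_deriv ?_).congr_of_eventuallyEq (Eventually.of_forall fun y => ?_)
  · simp only [id, intervalIntegral.integral_neg, ContinuousMap.sub_apply, ContinuousMap.neg_apply,
      V_apply, lift₁_apply, ContinuousMap.mul_apply, atZero_apply, sub_self]
    rw [intervalIntegral.integral_symm x v]
    push_cast
    ring
  · simp only [id, V_apply, Pi.neg_apply]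
    rw [intervalIntegral.integral_symm]

/-- Differentiation of `V f B` with the derivative falling on `f`; the domain of integration is
moved by the substitution `τ = x + r`. -/
lemma hasD_V_of_left {B B₂ : C(ℝ × ℝ, ℂ)} (h : ∀ x v, HasDerivAt (fun v => B (x, v)) (B₂ (x, v)) v)
    {f f' : C(ℝ, ℂ)} (hf : ∀ x, HasDerivAt f (f' x) x) :
    HasD (V f B) (V f' B + V f B₂ - endp f B) := by
  intro x v
  have hΦ : Continuous ↿(fun x r : ℝ => f (x + r) * B (r, x + r)) := by
    simp only [Function.HasUncurry.uncurry]; fun_prop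
  have hΦ' : Continuous ↿(fun x r : ℝ => f' (x + r) * B (r, x + r) + f (x + r) * B₂ (r, x + r)) := by
    simp only [Function.HasUncurry.uncurry]; fun_prop
  have hd : ∀ x r, HasDerivAt (fun x : ℝ => f (x + r) * B (r, x + r))
      (f' (x + r) * B (r, x + r) + f (x + r) * B₂ (r, x + r)) x := by
    intro x r
    exact ((hf (x + r)).comp_add_const x r).mul ((h r (x + r)).comp_add_const x r)
  have hb : HasDerivAt (fun x => v - x) (-1) x := by simpa using (hasDerivAt_id x).const_sub v
  have := hasDerivAt_integral_upper hΦ hΦ' hd 0 hb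
  refine (this.congr_deriv ?_).congr_of_eventuallyEq (Eventually.of_forall fun y => ?_)
  · rw [intervalIntegral.integral_add (Continuous.intervalIntegrable (by fun_prop) _ _)
      (Continuous.intervalIntegrable (by fun_prop) _ _)]
    simp only [ContinuousMap.sub_apply, ContinuousMap.add_apply, V_apply', endp_apply]
    rw [show x + (v - x) = v by ring]
    push_cast
    ring
  · simp only [V_apply']

lemma V_diag (f : C(ℝ, ℂ)) (B : C(ℝ × ℝ, ℂ)) (τ : ℝ) : V f B (τ, τ) = 0 := by
  simp [V_apply]

lemma V_zero (f : C(ℝ, ℂ)) (B : C(ℝ × ℝ, ℂ)) (s : ℝ) :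
    V f B (0, s) = ∫ τ in (0 : ℝ)..s, f τ * B (τ, τ) := by
  simp [V_apply]

/-- The operators `V_f` for the functions `f` of a list, applied one after the other. -/
def applyAll : List C(ℝ, ℂ) → C(ℝ × ℝ, ℂ) →ₗ[ℂ] C(ℝ × ℝ, ℂ)
  | [] => LinearMap.id
  | f :: l => applyAll l ∘ₗ V f

@[simp] lemma applyAll_nil (B : C(ℝ × ℝ, ℂ)) : applyAll [] B = B := rfl

@[simp] lemma applyAll_cons (f : C(ℝ, ℂ)) (l : List C(ℝ, ℂ)) (B : C(ℝ × ℝ, ℂ)) :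
    applyAll (f :: l) B = applyAll l (V f B) := rfl

lemma applyAll_append (l l' : List C(ℝ, ℂ)) (B : C(ℝ × ℝ, ℂ)) :
    applyAll (l ++ l') B = applyAll l' (applyAll l B) := by
  induction l generalizing B with
  | nil => rfl
  | cons f l ih => exact ih _

/-- There are no boundary terms for functions vanishing on the boundary lines. -/
lemma HasD.applyAll {B B₁ : C(ℝ × ℝ, ℂ)} (h : HasD B B₁) (h0 : ∀ s, B (0, s) = 0)
    (hdiag : ∀ τ, B (τ, τ) = 0) (l : List C(ℝ, ℂ)) :
    HasD (applyAll l B) ((-1 : ℂ) ^ l.length • applyAll l B₁) := by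
  induction l generalizing B B₁ with
  | nil => simpa using h
  | cons f l ih =>
    have hz : f * atZero B = 0 := by ext s; simp [h0]
    have h1 := h.V f
    rw [hz, map_zero, sub_zero] at h1
    have h2 := ih h1 (fun s => by simp [V_zero, hdiag]) (fun τ => V_diag f B τ)
    have e : (-1 : ℂ) ^ l.length • IntervalSobolev.applyAll l (-IntervalSobolev.V f B₁) =
        (-1 : ℂ) ^ (f :: l).length • IntervalSobolev.applyAll (f :: l) B₁ := by
      rw [map_neg, applyAll_cons, List.length_cons, pow_succ]
      module
    rwa [e] at h2

lemma hasD_lift₁ {h h' : C(ℝ, ℂ)} (hh : ∀ x, HasDerivAt h (h' x) x) :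
    HasD (lift₁ h) (lift₁ h') := fun x _ => hh x

lemma atZero_V_lift₁ (f k : C(ℝ, ℂ)) : atZero (V f (lift₁ k)) = prim (f * k) := by
  ext s; simp [V_zero, prim_apply]

/-- The derivative of `V f h`, falling on the innermost function `h`. -/
lemma hasD_inner_two {h h' : C(ℝ, ℂ)} (hh : ∀ x, HasDerivAt h (h' x) x) (f : C(ℝ, ℂ)) :
    HasD (V f (lift₁ h)) (-V f (lift₁ h') - h 0 • lift₁ f) := by
  have := (hasD_lift₁ hh).V f
  rw [show f * atZero (lift₁ h) = h 0 • f by ext s; simp [mul_comm], map_smul] at this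
  exact this

/-- The derivative of `V g (V f h)`, falling on the innermost function `h`. -/
lemma hasD_inner_three {h h' : C(ℝ, ℂ)} (hh : ∀ x, HasDerivAt h (h' x) x) (f g : C(ℝ, ℂ)) :
    HasD (V g (V f (lift₁ h)))
      (V g (V f (lift₁ h')) + h 0 • V g (lift₁ f) - lift₁ (g * prim (f * h))) := by
  have := (hasD_inner_two hh f).V g
  rw [atZero_V_lift₁, map_sub, map_neg, map_smul] at this
  convert this using 1
  abel

lemma hasD_second_two {f f' : C(ℝ, ℂ)} (hf : ∀ x, HasDerivAt f (f' x) x) (k : C(ℝ, ℂ)) :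
    HasD (V f (lift₁ k)) (V f' (lift₁ k) - endp f (lift₁ k)) := by
  have := hasD_V_of_left (B := lift₁ k) (B₂ := 0) (fun x v => by
    simpa using hasDerivAt_const v (k x)) hf
  simpa using this

/-- The function `k(x) Q(v)`. -/
def prodFn (k Q : C(ℝ, ℂ)) : C(ℝ × ℝ, ℂ) := ⟨fun p => k p.1 * Q p.2, by fun_prop⟩

@[simp] lemma prodFn_apply (k Q : C(ℝ, ℂ)) (p : ℝ × ℝ) : prodFn k Q p = k p.1 * Q p.2 := rfl

lemma V_endp_lift₁ (f g k : C(ℝ, ℂ)) :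
    V g (endp f (lift₁ k)) = prodFn k (prim (g * f)) - lift₁ (k * prim (g * f)) := by
  ext p
  simp only [V_apply, endp_apply, lift₁_apply, ContinuousMap.sub_apply, prodFn_apply,
    ContinuousMap.mul_apply, prim_apply, sub_sub_cancel]
  rw [← mul_sub, intervalIntegral.integral_interval_sub_left
    (Continuous.intervalIntegrable (by fun_prop) _ _)
    (Continuous.intervalIntegrable (by fun_prop) _ _), ← intervalIntegral.integral_const_mul]
  exact intervalIntegral.integral_congr fun τ _ => by ring

lemma V_prodFn (e k Q : C(ℝ, ℂ)) : V e (prodFn k Q) = V (e * Q) (lift₁ k) := by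
  ext p
  simp only [V_apply, prodFn_apply, lift₁_apply, ContinuousMap.mul_apply]
  exact intervalIntegral.integral_congr fun τ _ => by ring

/-- The derivative of `V g (V f k)`, falling on `f`. -/
lemma hasD_second_three {f f' : C(ℝ, ℂ)} (hf : ∀ x, HasDerivAt f (f' x) x) (k g : C(ℝ, ℂ)) :
    HasD (V g (V f (lift₁ k)))
      (-V g (V f' (lift₁ k)) + prodFn k (prim (g * f)) - lift₁ (k * prim (g * f))
        - lift₁ (g * prim (f * k))) := by
  have := (hasD_second_two hf k).V g
  rw [atZero_V_lift₁, map_sub, V_endp_lift₁] at this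
  convert this using 1
  abel

/-- The derivative of `V g (V l k)`, falling on `g`. -/
lemma hasD_third {g g' : C(ℝ, ℂ)} (hg : ∀ x, HasDerivAt g (g' x) x) (k l : C(ℝ, ℂ)) :
    HasD (V g (V l (lift₁ k)))
      (V g' (V l (lift₁ k)) + prodFn k (prim (g * l)) - lift₁ (k * prim (g * l))
        - endp g (V l (lift₁ k))) := by
  have h2 : ∀ x v, HasDerivAt (fun v => V l (lift₁ k) (x, v)) (endp l (lift₁ k) (x, v)) v := by
    intro x v
    have hc : Continuous fun τ => l τ * k (τ - x) := by fun_prop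
    exact intervalIntegral.integral_hasDerivAt_right (hc.intervalIntegrable _ _)
      hc.aestronglyMeasurable.stronglyMeasurableAtFilter hc.continuousAt
  have := hasD_V_of_left h2 hg
  rw [V_endp_lift₁] at this
  convert this using 1
  abel

/-! ### Mean square bounds for the recursion -/

/-- The Cauchy–Schwarz inequality on an interval. -/
lemma sq_norm_integral_mul_le {F G : ℝ → ℂ} (hF : Continuous F) (hG : Continuous G) {a b : ℝ}
    (hab : a ≤ b) : ‖∫ x in a..b, F x * G x‖ ^ 2 ≤
      (∫ x in a..b, ‖F x‖ ^ 2) * ∫ x in a..b, ‖G x‖ ^ 2 := by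
  have hm : ∀ {H : ℝ → ℂ}, Continuous H →
      MemLp (fun x => ‖H x‖) 2 (volume.restrict (Set.Ioc a b)) := fun {H} hH =>
    (memLp_two_iff_integrable_sq (hH.norm.aestronglyMeasurable)).2
      ((Continuous.integrableOn_Icc (by fun_prop)).mono_set Set.Ioc_subset_Icc_self)
  simp only [intervalIntegral.integral_of_le hab]
  refine le_trans ?_ (sq_integral_mul_le (hm hF) (hm hG))
  gcongr
  exact (norm_integral_le_integral_norm _).trans_eq (by simp)

/-- Exchange of the integrations over the triangle `0 ≤ x ≤ τ ≤ v`. -/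
lemma integral_triangle {g : ℝ → ℝ → ℂ} (hg : Continuous ↿g) (v : ℝ) :
    ∫ x in (0 : ℝ)..v, ∫ τ in x..v, g x τ = ∫ τ in (0 : ℝ)..v, ∫ x in (0 : ℝ)..τ, g x τ := by
  have hg1 : ∀ x, Continuous (g x) := fun x => hg.comp (Continuous.prodMk_right x)
  have hΦ : Continuous ↿(fun v x : ℝ => ∫ τ in x..v, g x τ) := by
    have e : ∀ p : ℝ × ℝ, ∫ τ in p.2..p.1, g p.2 τ
        = (∫ τ in (0 : ℝ)..p.1, g p.2 τ) - ∫ τ in (0 : ℝ)..p.2, g p.2 τ := fun p =>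
      (intervalIntegral.integral_interval_sub_left ((hg1 _).intervalIntegrable _ _)
        ((hg1 _).intervalIntegrable _ _)).symm
    have h : Continuous (Function.uncurry fun (p : ℝ × ℝ) (τ : ℝ) => g p.2 τ) :=
      hg.comp (by fun_prop : Continuous fun q : (ℝ × ℝ) × ℝ => (q.1.2, q.2))
    simp only [Function.HasUncurry.uncurry, id, e]
    exact (intervalIntegral.continuous_parametric_intervalIntegral_of_continuous h
      continuous_fst).sub
      (intervalIntegral.continuous_parametric_intervalIntegral_of_continuous h continuous_snd)
  have hΦ' : Continuous ↿(fun v x : ℝ => g x v) :=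
    hg.comp (by fun_prop : Continuous fun q : ℝ × ℝ => (q.2, q.1))
  have hd : ∀ w, HasDerivAt (fun v => ∫ x in (0 : ℝ)..v, ∫ τ in x..v, g x τ)
      (∫ x in (0 : ℝ)..w, g x w) w := by
    intro w
    have := hasDerivAt_integral_upper hΦ hΦ' (fun v x =>
      intervalIntegral.integral_hasDerivAt_right ((hg1 x).intervalIntegrable _ _)
        (hg1 x).aestronglyMeasurable.stronglyMeasurableAtFilter (hg1 x).continuousAt) 0
      (hasDerivAt_id w)
    simpa using this
  have hc : Continuous fun w => ∫ x in (0 : ℝ)..w, g x w :=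
    intervalIntegral.continuous_parametric_intervalIntegral_of_continuous
      (f := fun w x => g x w) hΦ' continuous_id
  have := intervalIntegral.integral_eq_sub_of_hasDerivAt (fun w _ => hd w)
    (hc.intervalIntegrable 0 v)
  simpa using this.symm

lemma integral_triangle_real {g : ℝ → ℝ → ℝ} (hg : Continuous ↿g) (v : ℝ) :
    ∫ x in (0 : ℝ)..v, ∫ τ in x..v, g x τ = ∫ τ in (0 : ℝ)..v, ∫ x in (0 : ℝ)..τ, g x τ := by
  have := integral_triangle (g := fun x τ => (g x τ : ℂ)) (continuous_ofReal.comp hg) v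
  simp only [intervalIntegral.integral_ofReal] at this
  exact_mod_cast this

/-- The bound `∫_0^v |B(x, v)|² dx ≤ M² v^q / q!`. -/
def SqBound (M : ℝ) (q : ℕ) (B : C(ℝ × ℝ, ℂ)) : Prop :=
  ∀ v ∈ Set.Icc (0 : ℝ) 1, ∫ x in (0 : ℝ)..v, ‖B (x, v)‖ ^ 2 ≤ M ^ 2 * (v ^ q / q.factorial)

lemma integral_sq_le_norm_cls (f : C(ℝ, ℂ)) {a b : ℝ} (ha : 0 ≤ a) (hab : a ≤ b) (hb : b ≤ 1) :
    ∫ x in a..b, ‖f x‖ ^ 2 ≤ ‖cls f‖ ^ 2 := by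
  rw [norm_cls_sq]
  exact intervalIntegral.integral_mono_interval ha hab hb
    (Eventually.of_forall fun x => by positivity) (Continuous.intervalIntegrable (by fun_prop) _ _)

/-- Each operator `V_f` costs a factor `|f|₀` and gains an integration in the variable `v`. -/
lemma SqBound.V {M : ℝ} {q : ℕ} {B : C(ℝ × ℝ, ℂ)} (h : SqBound M q B) (f : C(ℝ, ℂ)) :
    SqBound (M * ‖cls f‖) (q + 1) (V f B) := by
  intro v hv
  have hg : Continuous ↿(fun x τ : ℝ => ‖B (τ - x, τ)‖ ^ 2) := by
    simp only [Function.HasUncurry.uncurry, id]; fun_prop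
  calc ∫ x in (0 : ℝ)..v, ‖IntervalSobolev.V f B (x, v)‖ ^ 2
      ≤ ∫ x in (0 : ℝ)..v, ‖cls f‖ ^ 2 * ∫ τ in x..v, ‖B (τ - x, τ)‖ ^ 2 := by
        refine intervalIntegral.integral_mono_on hv.1
          (Continuous.intervalIntegrable (by fun_prop) _ _)
          (Continuous.intervalIntegrable ?_ _ _) fun x hx => ?_
        · refine continuous_const.mul ?_
          have e : ∀ x : ℝ, ∫ τ in x..v, ‖B (τ - x, τ)‖ ^ 2
              = - ∫ τ in v..x, ‖B (τ - x, τ)‖ ^ 2 := fun x => intervalIntegral.integral_symm _ _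
          simp only [e]
          exact (intervalIntegral.continuous_parametric_intervalIntegral_of_continuous
            (f := fun x τ => ‖B (τ - x, τ)‖ ^ 2)
            (by simp only [Function.uncurry_def]; fun_prop) continuous_id).neg
        · rw [V_apply]
          refine (sq_norm_integral_mul_le (by fun_prop) (by fun_prop) hx.2).trans ?_
          refine mul_le_mul_of_nonneg_right (integral_sq_le_norm_cls f hx.1 hx.2 hv.2) ?_
          exact intervalIntegral.integral_nonneg hx.2 fun _ _ => by positivity
    _ = ‖cls f‖ ^ 2 * ∫ τ in (0 : ℝ)..v, ∫ x in (0 : ℝ)..τ, ‖B (x, τ)‖ ^ 2 := by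
        rw [intervalIntegral.integral_const_mul, integral_triangle_real hg]
        congr 1
        refine intervalIntegral.integral_congr fun τ _ => ?_
        simpa using intervalIntegral.integral_comp_sub_left (a := 0) (b := τ)
          (fun x => ‖B (x, τ)‖ ^ 2) τ
    _ ≤ ‖cls f‖ ^ 2 * ∫ τ in (0 : ℝ)..v, M ^ 2 * (τ ^ q / q.factorial) := by
        gcongr
        refine intervalIntegral.integral_mono_on hv.1 (Continuous.intervalIntegrable ?_ _ _)
          (Continuous.intervalIntegrable (by fun_prop) _ _)
          fun τ hτ => h τ ⟨hτ.1, hτ.2.trans hv.2⟩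
        exact intervalIntegral.continuous_parametric_intervalIntegral_of_continuous
          (f := fun τ x => ‖B (x, τ)‖ ^ 2)
          (by simp only [Function.uncurry_def]; fun_prop) continuous_id
    _ = (M * ‖cls f‖) ^ 2 * (v ^ (q + 1) / (q + 1).factorial) := by
        rw [intervalIntegral.integral_const_mul, intervalIntegral.integral_div, integral_pow,
          Nat.factorial_succ]
        push_cast
        field_simp
        simp

/-- The product of the `L₂` norms of the functions of a list. -/
def nprod (l : List C(ℝ, ℂ)) : ℝ := (l.map fun f => ‖cls f‖).prod

@[simp] lemma nprod_nil : nprod [] = 1 := rfl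

@[simp] lemma nprod_cons (f : C(ℝ, ℂ)) (l : List C(ℝ, ℂ)) :
    nprod (f :: l) = ‖cls f‖ * nprod l := by simp [nprod]

lemma nprod_nonneg (l : List C(ℝ, ℂ)) : 0 ≤ nprod l := by
  induction l with
  | nil => simp
  | cons f l ih => rw [nprod_cons]; positivity

lemma SqBound.applyAll {M : ℝ} {q : ℕ} {B : C(ℝ × ℝ, ℂ)} (h : SqBound M q B) (l : List C(ℝ, ℂ)) :
    SqBound (M * nprod l) (q + l.length) (applyAll l B) := by
  induction l generalizing M q B with
  | nil => simpa using h
  | cons f l ih =>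
    have := ih (h.V f)
    rwa [nprod_cons, ← mul_assoc, List.length_cons, add_comm l.length, ← add_assoc]

lemma SqBound.forget {M : ℝ} {q : ℕ} {B : C(ℝ × ℝ, ℂ)} (h : SqBound M q B) : SqBound M 0 B := by
  intro v hv
  refine (h v hv).trans (mul_le_mul_of_nonneg_left ?_ (sq_nonneg M))
  rw [pow_zero, Nat.factorial_zero, Nat.cast_one, div_one]
  exact div_le_one_of_le₀ ((pow_le_one₀ hv.1 hv.2).trans (by exact_mod_cast q.factorial_pos))
    (by positivity)

lemma sqBound_lift₁ (k : C(ℝ, ℂ)) : SqBound ‖cls k‖ 0 (lift₁ k) := fun v hv => by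
  simpa using integral_sq_le_norm_cls k le_rfl hv.1 hv.2

lemma sqBound_prodFn (k : C(ℝ, ℂ)) {Q : C(ℝ, ℂ)} {S : ℝ}
    (hQ : ∀ x ∈ Set.Icc (0 : ℝ) 1, ‖Q x‖ ≤ S) : SqBound (‖cls k‖ * S) 0 (prodFn k Q) := by
  intro v hv
  simp only [prodFn_apply, norm_mul, mul_pow, intervalIntegral.integral_mul_const, pow_zero,
    Nat.factorial_zero, Nat.cast_one, div_one, mul_one]
  have := hQ v hv
  gcongr
  exact integral_sq_le_norm_cls k le_rfl hv.1 hv.2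

lemma SqBound.endp {M : ℝ} {q : ℕ} {B : C(ℝ × ℝ, ℂ)} (h : SqBound M q B) {f : C(ℝ, ℂ)} {S : ℝ}
    (hf : ∀ x ∈ Set.Icc (0 : ℝ) 1, ‖f x‖ ≤ S) : SqBound (S * M) q (endp f B) := by
  intro v hv
  have e : ∫ x in (0 : ℝ)..v, ‖B (v - x, v)‖ ^ 2 = ∫ x in (0 : ℝ)..v, ‖B (x, v)‖ ^ 2 := by
    simpa using intervalIntegral.integral_comp_sub_left (a := 0) (b := v)
      (fun x => ‖B (x, v)‖ ^ 2) v
  simp only [endp_apply, norm_mul, mul_pow, intervalIntegral.integral_const_mul]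
  rw [e, mul_assoc]
  have h1 := hf v hv
  have h2 := h v hv
  have h3 : 0 ≤ ∫ x in (0 : ℝ)..v, ‖B (x, v)‖ ^ 2 :=
    intervalIntegral.integral_nonneg hv.1 fun _ _ => by positivity
  gcongr

/-- The function `x ↦ B(x, 1)`. -/
def ev1 : C(ℝ × ℝ, ℂ) →ₗ[ℂ] C(ℝ, ℂ) where
  toFun B := ⟨fun x => B (x, 1), by fun_prop⟩
  map_add' _ _ := rfl
  map_smul' _ _ := rfl

@[simp] lemma ev1_apply (B : C(ℝ × ℝ, ℂ)) (x : ℝ) : ev1 B x = B (x, 1) := rfl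

/-- The gain `1 / √(n!)`. -/
def wt (n : ℕ) : ℝ := 1 / √(n.factorial : ℝ)

lemma wt_pos (n : ℕ) : 0 < wt n := by
  have := n.factorial_pos
  unfold wt
  positivity

lemma wt_anti : Antitone wt := fun m n h => by
  have := m.factorial_pos
  unfold wt
  gcongr

@[simp] lemma wt_zero : wt 0 = 1 := by simp [wt]

lemma SqBound.norm_cls_le {M : ℝ} (hM : 0 ≤ M) {q : ℕ} {B : C(ℝ × ℝ, ℂ)} (h : SqBound M q B) :
    ‖cls (ev1 B)‖ ≤ M * wt q := by
  refine abs_le_of_sq_le_sq' ?_ (mul_nonneg hM (wt_pos q).le) |>.2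
  rw [norm_cls_sq, mul_pow]
  refine (h 1 (by simp)).trans_eq ?_
  simp [wt]

lemma norm_cls_applyAll_le {M : ℝ} (hM : 0 ≤ M) {B : C(ℝ × ℝ, ℂ)} (h : SqBound M 0 B)
    (l : List C(ℝ, ℂ)) : ‖cls (ev1 (applyAll l B))‖ ≤ M * nprod l * wt l.length := by
  have := (h.applyAll l).norm_cls_le (mul_nonneg hM (nprod_nonneg l))
  rwa [zero_add] at this

lemma norm_prim_le (f g : C(ℝ, ℂ)) {x : ℝ} (hx : x ∈ Set.Icc (0 : ℝ) 1) :
    ‖prim (f * g) x‖ ≤ ‖cls f‖ * ‖cls g‖ := by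
  rw [prim_apply]
  refine (intervalIntegral.norm_integral_le_integral_norm hx.1).trans
    (le_trans ?_ (integral_norm_mul_le f g))
  simp only [ContinuousMap.mul_apply, norm_mul]
  exact intervalIntegral.integral_mono_interval le_rfl hx.1 hx.2
    (Eventually.of_forall fun x => by positivity) (Continuous.intervalIntegrable (by fun_prop) _ _)

lemma norm_cls_mul_le (f : C(ℝ, ℂ)) {Q : C(ℝ, ℂ)} {S : ℝ}
    (hQ : ∀ x ∈ Set.Icc (0 : ℝ) 1, ‖Q x‖ ≤ S) : ‖cls (f * Q)‖ ≤ ‖cls f‖ * S := by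
  have hS : 0 ≤ S := (norm_nonneg _).trans (hQ 0 (by simp))
  refine abs_le_of_sq_le_sq' ?_ (by positivity) |>.2
  rw [norm_cls_sq, mul_pow, norm_cls_sq, ← intervalIntegral.integral_mul_const]
  refine intervalIntegral.integral_mono_on zero_le_one
    (Continuous.intervalIntegrable (by fun_prop) _ _)
    (Continuous.intervalIntegrable (by fun_prop) _ _) fun x hx => ?_
  rw [ContinuousMap.mul_apply, norm_mul, mul_pow]
  have := hQ x hx
  gcongr

/-! ### Regularity of the integrals of continuously differentiable functions -/

/-- `u` has continuous derivatives up to the order `m`, which all have `L₂` norm at most `M`. -/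
def Reg : ℕ → C(ℝ, ℂ) → ℝ → Prop
  | 0, u, M => ‖cls u‖ ≤ M
  | m + 1, u, M => ‖cls u‖ ≤ M ∧ ∃ u' : C(ℝ, ℂ), (∀ x, HasDerivAt u (u' x) x) ∧ Reg m u' M

lemma Reg.mono {m : ℕ} {u : C(ℝ, ℂ)} {M N : ℝ} (h : Reg m u M) (hMN : M ≤ N) : Reg m u N := by
  induction m generalizing u with
  | zero => exact le_trans h hMN
  | succ m ih =>
    obtain ⟨h1, u', h2, h3⟩ := h
    exact ⟨h1.trans hMN, u', h2, ih h3⟩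

lemma Reg.add {m : ℕ} {u v : C(ℝ, ℂ)} {M N : ℝ} (hu : Reg m u M) (hv : Reg m v N) :
    Reg m (u + v) (M + N) := by
  induction m generalizing u v with
  | zero => rw [Reg, map_add]; exact norm_add_le_of_le hu hv
  | succ m ih =>
    obtain ⟨h1, u', h2, h3⟩ := hu
    obtain ⟨g1, v', g2, g3⟩ := hv
    exact ⟨by rw [map_add]; exact norm_add_le_of_le h1 g1, u' + v', fun x => (h2 x).add (g2 x),
      ih h3 g3⟩

lemma Reg.smul {m : ℕ} {u : C(ℝ, ℂ)} {M : ℝ} (h : Reg m u M) (c : ℂ) :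
    Reg m (c • u) (‖c‖ * M) := by
  induction m generalizing u with
  | zero => rw [Reg, map_smul, norm_smul]; exact mul_le_mul_of_nonneg_left h (norm_nonneg c)
  | succ m ih =>
    obtain ⟨h1, u', h2, h3⟩ := h
    exact ⟨by rw [map_smul, norm_smul]; exact mul_le_mul_of_nonneg_left h1 (norm_nonneg c), c • u',
      fun x => (h2 x).const_smul c, ih h3⟩

lemma Reg.neg {m : ℕ} {u : C(ℝ, ℂ)} {M : ℝ} (h : Reg m u M) : Reg m (-u) M := by
  have e : -u = (-1 : ℂ) • u := by ext; simp
  rw [e]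
  simpa using h.smul (-1)

lemma Reg.sub {m : ℕ} {u v : C(ℝ, ℂ)} {M N : ℝ} (hu : Reg m u M) (hv : Reg m v N) :
    Reg m (u - v) (M + N) := by
  rw [sub_eq_add_neg]; exact hu.add hv.neg

lemma Reg.sign_smul {m : ℕ} {u : C(ℝ, ℂ)} {M : ℝ} (h : Reg m u M) (n : ℕ) :
    Reg m ((-1 : ℂ) ^ n • u) M := by
  simpa using h.smul ((-1) ^ n)

lemma Reg.exists_isWeakJet {m : ℕ} {u : C(ℝ, ℂ)} {M : ℝ} (h : Reg m u M) :
    ∃ D, IsWeakJet m (cls u) D ∧ ∀ k, ‖D k‖ ≤ M := by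
  induction m generalizing u with
  | zero => exact ⟨fun _ => cls u, ⟨rfl, fun k => k.elim0⟩, fun _ => h⟩
  | succ m ih =>
    obtain ⟨h1, u', h2, h3⟩ := h
    obtain ⟨D, ⟨hD0, hD⟩, hDM⟩ := ih h3
    refine ⟨Fin.cons (cls u) D, ⟨rfl, fun k => ?_⟩, fun k => ?_⟩
    · refine Fin.cases ?_ (fun j => ?_) k
      · simpa [hD0] using hasWeakDeriv_cls h2
      · simpa only [Fin.castSucc_succ, Fin.cons_succ] using hD j
    · exact Fin.cases (by simpa using h1) (fun j => by simpa using hDM j) k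

/-- A continuously differentiable function `fn` with `|fn|₀ ≤ a`, `|fn'|₀ ≤ K a` and `|fn| ≤ K a` on
`[0,1]`. -/
structure BddFn (K : ℝ) where
  fn : C(ℝ, ℂ)
  fn' : C(ℝ, ℂ)
  a : ℝ
  hasDerivAt : ∀ x, HasDerivAt fn (fn' x) x
  norm_le : ‖cls fn‖ ≤ a
  norm_le' : ‖cls fn'‖ ≤ K * a
  sup_le : ∀ x ∈ Set.Icc (0 : ℝ) 1, ‖fn x‖ ≤ K * a

lemma BddFn.a_nonneg {K : ℝ} (f : BddFn K) : 0 ≤ f.a := (norm_nonneg _).trans f.norm_le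

/-- A bound with a larger constant. -/
def BddFn.weaken {K K' : ℝ} (h : K ≤ K') (f : BddFn K) : BddFn K' where
  fn := f.fn
  fn' := f.fn'
  a := f.a
  hasDerivAt := f.hasDerivAt
  norm_le := f.norm_le
  norm_le' := f.norm_le'.trans (mul_le_mul_of_nonneg_right h f.a_nonneg)
  sup_le x hx := (f.sup_le x hx).trans (mul_le_mul_of_nonneg_right h f.a_nonneg)

lemma BddFn.norm_prim_le {K : ℝ} (f g : BddFn K) {x : ℝ} (hx : x ∈ Set.Icc (0 : ℝ) 1) :
    ‖prim (f.fn * g.fn) x‖ ≤ f.a * g.a :=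
  (IntervalSobolev.norm_prim_le _ _ hx).trans
    (mul_le_mul f.norm_le g.norm_le (norm_nonneg _) f.a_nonneg)

/-- The function `g(x) ∫_0^x f h`. -/
def BddFn.mulPrim {K : ℝ} (hK : 1 ≤ K) (g f h : BddFn K) : BddFn (2 * K ^ 2) where
  fn := g.fn * prim (f.fn * h.fn)
  fn' := g.fn' * prim (f.fn * h.fn) + h.fn * (g.fn * f.fn)
  a := g.a * (f.a * h.a)
  hasDerivAt x := by
    refine ((g.hasDerivAt x).mul (hasDerivAt_prim (f.fn * h.fn) x)).congr_deriv ?_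
    simp only [ContinuousMap.add_apply, ContinuousMap.mul_apply]
    ring
  norm_le := by
    have := f.a_nonneg
    have := h.a_nonneg
    exact (norm_cls_mul_le _ fun x hx => f.norm_prim_le h hx).trans
      (mul_le_mul_of_nonneg_right g.norm_le (by positivity))
  norm_le' := by
    have hf := f.a_nonneg
    have hg := g.a_nonneg
    have hh := h.a_nonneg
    have h1 := (norm_cls_mul_le g.fn' fun x hx => f.norm_prim_le h hx).trans
      (mul_le_mul_of_nonneg_right g.norm_le' (by positivity))
    have h2 : ‖cls (h.fn * (g.fn * f.fn))‖ ≤ h.a * (K * g.a * (K * f.a)) :=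
      (norm_cls_mul_le h.fn (S := K * g.a * (K * f.a)) fun x hx => by
        rw [ContinuousMap.mul_apply, norm_mul]
        exact mul_le_mul (g.sup_le x hx) (f.sup_le x hx) (norm_nonneg _) (by positivity)).trans
      (mul_le_mul_of_nonneg_right h.norm_le (by positivity))
    rw [map_add]
    refine (norm_add_le_of_le h1 h2).trans ?_
    have : K * (g.a * (f.a * h.a)) ≤ K ^ 2 * (g.a * (f.a * h.a)) :=
      mul_le_mul_of_nonneg_right (by nlinarith) (by positivity)
    nlinarith
  sup_le x hx := by
    have hf := f.a_nonneg
    have hg := g.a_nonneg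
    have hh := h.a_nonneg
    rw [ContinuousMap.mul_apply, norm_mul]
    refine (mul_le_mul (g.sup_le x hx) (f.norm_prim_le h hx) (norm_nonneg _)
      (by positivity)).trans ?_
    rw [mul_assoc]
    exact mul_le_mul_of_nonneg_right (by nlinarith) (by positivity)

/-- The function `x ↦ (V_{f_j} ⋯ V_{f_1} k)(x, 1)`, for the list `l = [f_1, …, f_j]`. -/
def iter (k : C(ℝ, ℂ)) (l : List C(ℝ, ℂ)) : C(ℝ, ℂ) := ev1 (applyAll l (lift₁ k))

lemma HasD.ev1 {B B₁ : C(ℝ × ℝ, ℂ)} (h : HasD B B₁) (x : ℝ) :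
    HasDerivAt (ev1 B) (ev1 B₁ x) x := h x 1

lemma norm_cls_applyAll_le_of_le {M N : ℝ} (hM : 0 ≤ M) {B : C(ℝ × ℝ, ℂ)} (h : SqBound M 0 B)
    (l : List C(ℝ, ℂ)) (hN : M * nprod l ≤ N) {n : ℕ} (hn : n ≤ l.length) :
    ‖cls (ev1 (applyAll l B))‖ ≤ N * wt n := by
  refine (norm_cls_applyAll_le hM h l).trans ?_
  have := nprod_nonneg l
  exact mul_le_mul hN (wt_anti hn) (wt_pos _).le ((by positivity : 0 ≤ M * nprod l).trans hN)

lemma norm_iter_le (k : C(ℝ, ℂ)) (l : List C(ℝ, ℂ)) {N : ℝ} (hN : ‖cls k‖ * nprod l ≤ N) {n : ℕ}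
    (hn : n ≤ l.length) : ‖cls (iter k l)‖ ≤ N * wt n :=
  norm_cls_applyAll_le_of_le (norm_nonneg _) (sqBound_lift₁ k) l hN hn

/-- The derivative of the integral is controlled by one derivative of the second function. -/
lemma reg_one_second {K : ℝ} (hK : 1 ≤ K) (k : C(ℝ, ℂ)) (f : BddFn K) (l : List C(ℝ, ℂ)) {N : ℝ}
    (hN : ‖cls k‖ * (f.a * nprod l) ≤ N) {n : ℕ} (hn : n ≤ l.length - 1) :
    Reg 1 (iter k (f.fn :: l)) (4 * K * N * wt n) := by
  have ha := f.a_nonneg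
  have hl := nprod_nonneg l
  have hN0 : 0 ≤ N := le_trans (by positivity) hN
  have hw := (wt_pos n).le
  have hK0 : 0 ≤ K := zero_le_one.trans hK
  have hfl : ‖cls k‖ * nprod (f.fn :: l) ≤ N := by
    rw [nprod_cons]
    exact le_trans (by gcongr; exact f.norm_le) hN
  have hfl' : ‖cls k‖ * nprod (f.fn' :: l) ≤ K * N := by
    rw [nprod_cons]
    calc ‖cls k‖ * (‖cls f.fn'‖ * nprod l) ≤ ‖cls k‖ * (K * f.a * nprod l) := by
          gcongr; exact f.norm_le'
      _ = K * (‖cls k‖ * (f.a * nprod l)) := by ring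
      _ ≤ K * N := by gcongr
  have hKN : N ≤ K * N := le_mul_of_one_le_left hN0 hK
  have h0 : ‖cls (iter k (f.fn :: l))‖ ≤ 4 * K * N * wt n := by
    refine (norm_iter_le k _ hfl (n := n) (by rw [List.length_cons]; omega)).trans ?_
    gcongr
    linarith
  refine ⟨h0, ?_⟩
  cases l with
  | nil =>
    refine ⟨_, (hasD_second_two f.hasDerivAt k).ev1, ?_⟩
    rw [Reg, map_sub, map_sub]
    have h1 : ‖cls (ev1 (V f.fn' (lift₁ k)))‖ ≤ K * N * wt n :=
      norm_iter_le k [f.fn'] hfl' (by simpa using hn.trans (Nat.sub_le _ _) |>.trans (by simp))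
    have h2 : ‖cls (ev1 (endp f.fn (lift₁ k)))‖ ≤ K * N * wt n :=
      norm_cls_applyAll_le_of_le (by positivity) ((sqBound_lift₁ k).endp f.sup_le) [] (by
        rw [nprod_nil, mul_one] at *
        nlinarith) hn
    refine (norm_sub_le_of_le h1 h2).trans ?_
    nlinarith [mul_nonneg (mul_nonneg hK0 hN0) hw]
  | cons g r =>
    have hn' : n ≤ r.length := by simpa using hn
    rw [nprod_cons] at hN
    have hr := nprod_nonneg r
    have hQ : ∀ x ∈ Set.Icc (0 : ℝ) 1, ‖prim (g * f.fn) x‖ ≤ ‖cls g‖ * f.a := fun x hx =>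
      (norm_prim_le _ _ hx).trans (by gcongr; exact f.norm_le)
    have hQ' : ∀ x ∈ Set.Icc (0 : ℝ) 1, ‖prim (f.fn * k) x‖ ≤ f.a * ‖cls k‖ := fun x hx =>
      (norm_prim_le _ _ hx).trans (by gcongr; exact f.norm_le)
    refine ⟨_, ((hasD_second_three f.hasDerivAt k g).applyAll (fun s => by simp [V_zero, V_diag])
      (fun τ => V_diag _ _ τ) r).ev1, ?_⟩
    rw [map_smul]
    refine Reg.sign_smul (m := 0) ?_ _
    simp only [map_sub, map_add, map_neg, Reg]
    have h1 : ‖cls (ev1 (applyAll r (V g (V f.fn' (lift₁ k)))))‖ ≤ K * N * wt n :=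
      norm_iter_le k (f.fn' :: g :: r) hfl' (by simp only [List.length_cons]; omega)
    have h2 : ‖cls (ev1 (applyAll r (prodFn k (prim (g * f.fn)))))‖ ≤ N * wt n :=
      norm_cls_applyAll_le_of_le (by positivity) (sqBound_prodFn k hQ) r (by linarith) hn'
    have h3 : ‖cls (ev1 (applyAll r (lift₁ (k * prim (g * f.fn)))))‖ ≤ N * wt n :=
      norm_iter_le _ r (by
        refine le_trans ?_ hN
        calc _ ≤ ‖cls k‖ * (‖cls g‖ * f.a) * nprod r := by gcongr; exact norm_cls_mul_le k hQ
          _ = _ := by ring) hn'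
    have h4 : ‖cls (ev1 (applyAll r (lift₁ (g * prim (f.fn * k)))))‖ ≤ N * wt n :=
      norm_iter_le _ r (by
        refine le_trans ?_ hN
        calc _ ≤ ‖cls g‖ * (f.a * ‖cls k‖) * nprod r := by gcongr; exact norm_cls_mul_le g hQ'
          _ = _ := by ring) hn'
    refine (norm_sub_le_of_le (norm_sub_le_of_le
      (norm_add_le_of_le ((norm_neg _).trans_le h1) h2) h3) h4).trans ?_
    nlinarith [mul_nonneg (sub_nonneg.2 hKN) hw]

/-- The derivative of the integral is controlled by one derivative of the third function. -/
lemma reg_one_third {K : ℝ} (hK : 1 ≤ K) (k l : C(ℝ, ℂ)) (g : BddFn K) (r : List C(ℝ, ℂ)) {N : ℝ}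
    (hN : ‖cls k‖ * (‖cls l‖ * (g.a * nprod r)) ≤ N) {n : ℕ} (hn : n ≤ r.length) :
    Reg 1 (iter k (l :: g.fn :: r)) (4 * K * N * wt n) := by
  have ha := g.a_nonneg
  have hr := nprod_nonneg r
  have hN0 : 0 ≤ N := le_trans (by positivity) hN
  have hw := (wt_pos n).le
  have hK0 : 0 ≤ K := zero_le_one.trans hK
  have hKN : N ≤ K * N := le_mul_of_one_le_left hN0 hK
  have hQ : ∀ x ∈ Set.Icc (0 : ℝ) 1, ‖prim (g.fn * l) x‖ ≤ g.a * ‖cls l‖ := fun x hx =>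
    (norm_prim_le _ _ hx).trans (by gcongr; exact g.norm_le)
  refine ⟨?_, _, ((hasD_third g.hasDerivAt k l).applyAll (fun s => by simp [V_zero, V_diag])
    (fun τ => V_diag _ _ τ) r).ev1, ?_⟩
  · refine (norm_iter_le k (l :: g.fn :: r) (N := N) (n := n) ?_
      (by simp only [List.length_cons]; omega)).trans ?_
    · simp only [nprod_cons]
      exact le_trans (by gcongr; exact g.norm_le) hN
    · gcongr
      linarith
  · rw [map_smul]
    refine Reg.sign_smul (m := 0) ?_ _
    simp only [map_sub, map_add, Reg]
    have h1 : ‖cls (ev1 (applyAll r (V g.fn' (V l (lift₁ k)))))‖ ≤ K * N * wt n :=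
      norm_iter_le k (l :: g.fn' :: r) (by
        simp only [nprod_cons]
        calc _ ≤ ‖cls k‖ * (‖cls l‖ * (K * g.a * nprod r)) := by gcongr; exact g.norm_le'
          _ = K * (‖cls k‖ * (‖cls l‖ * (g.a * nprod r))) := by ring
          _ ≤ K * N := by gcongr) (by simp only [List.length_cons]; omega)
    have h2 : ‖cls (ev1 (applyAll r (prodFn k (prim (g.fn * l)))))‖ ≤ N * wt n :=
      norm_cls_applyAll_le_of_le (by positivity) (sqBound_prodFn k hQ) r (by linarith) hn
    have h3 : ‖cls (ev1 (applyAll r (lift₁ (k * prim (g.fn * l)))))‖ ≤ N * wt n :=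
      norm_iter_le _ r (by
        refine le_trans ?_ hN
        calc _ ≤ ‖cls k‖ * (g.a * ‖cls l‖) * nprod r := by gcongr; exact norm_cls_mul_le k hQ
          _ = _ := by ring) hn
    have h4 : ‖cls (ev1 (applyAll r (endp g.fn (V l (lift₁ k)))))‖ ≤ K * N * wt n :=
      norm_cls_applyAll_le_of_le (by positivity) ((((sqBound_lift₁ k).V l).forget).endp g.sup_le) r (by
        calc _ = K * (‖cls k‖ * (‖cls l‖ * (g.a * nprod r))) := by ring
          _ ≤ K * N := by gcongr) hn
    refine (norm_sub_le_of_le (norm_sub_le_of_le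
      (norm_add_le_of_le h1 h2) h3) h4).trans ?_
    nlinarith [mul_nonneg (sub_nonneg.2 hKN) hw]

/-- The functions of a list. -/
def fns {K : ℝ} (l : List (BddFn K)) : List C(ℝ, ℂ) := l.map BddFn.fn

/-- The product of the bounds of the functions of a list. -/
def wprod {K : ℝ} (l : List (BddFn K)) : ℝ := (l.map BddFn.a).prod

@[simp] lemma fns_nil {K : ℝ} : fns ([] : List (BddFn K)) = [] := rfl

@[simp] lemma fns_cons {K : ℝ} (f : BddFn K) (l : List (BddFn K)) :
    fns (f :: l) = f.fn :: fns l := rfl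

@[simp] lemma wprod_nil {K : ℝ} : wprod ([] : List (BddFn K)) = 1 := rfl

@[simp] lemma wprod_cons {K : ℝ} (f : BddFn K) (l : List (BddFn K)) :
    wprod (f :: l) = f.a * wprod l := by simp [wprod]

@[simp] lemma length_fns {K : ℝ} (l : List (BddFn K)) : (fns l).length = l.length := by simp [fns]

lemma fns_weaken {K K' : ℝ} (h : K ≤ K') (l : List (BddFn K)) :
    fns (l.map (BddFn.weaken h)) = fns l := by
  simp [fns, BddFn.weaken]

lemma wprod_weaken {K K' : ℝ} (h : K ≤ K') (l : List (BddFn K)) :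
    wprod (l.map (BddFn.weaken h)) = wprod l := by
  simp [wprod, BddFn.weaken, Function.comp_def]

lemma wprod_nonneg {K : ℝ} (l : List (BddFn K)) : 0 ≤ wprod l := by
  induction l with
  | nil => simp
  | cons f l ih => rw [wprod_cons]; exact mul_nonneg f.a_nonneg ih

lemma nprod_fns_le {K : ℝ} (l : List (BddFn K)) : nprod (fns l) ≤ wprod l := by
  induction l with
  | nil => simp
  | cons f l ih =>
    rw [fns_cons, nprod_cons, wprod_cons]
    exact mul_le_mul f.norm_le ih (nprod_nonneg _) f.a_nonneg

lemma reg_one {K : ℝ} (hK : 1 ≤ K) (w : BddFn K) (l : List (BddFn K)) :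
    Reg 1 (iter w.fn (fns l)) (4 * K * (w.a * wprod l) * wt (l.length - 2)) := by
  have hw := w.a_nonneg
  cases l with
  | nil =>
    refine Reg.mono (M := K * w.a) ⟨w.norm_le.trans (le_mul_of_one_le_left hw hK), _,
      w.hasDerivAt, w.norm_le'⟩ ?_
    simp only [wprod_nil, mul_one, List.length_nil, Nat.zero_sub, wt_zero]
    nlinarith
  | cons f l =>
    refine reg_one_second hK w.fn f (fns l) ?_ (by simp)
    rw [wprod_cons]
    have := nprod_fns_le l
    have := nprod_nonneg (fns l)
    have := f.a_nonneg
    gcongr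
    exact w.norm_le

/-- For differentiable functions the integral has two derivatives: the first one is put on the
innermost function, and the derivatives of the resulting integrals on the second function. -/
lemma reg_two {K : ℝ} (hK : 1 ≤ K) (h f : BddFn K) (l : List (BddFn K)) :
    Reg 2 (iter h.fn (fns (f :: l)))
      (16 * K ^ 2 * (h.a * wprod (f :: l)) * wt (l.length - 3)) := by
  have hh := h.a_nonneg
  have hf := f.a_nonneg
  have hl := wprod_nonneg l
  have hnl := nprod_nonneg (fns l)
  have hl' := nprod_fns_le l
  have hK0 : 0 ≤ K := zero_le_one.trans hK
  set W := h.a * wprod (f :: l) with hW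
  rw [wprod_cons] at hW
  have hW0 : 0 ≤ W := by rw [hW]; positivity
  have hK2 : K ≤ K ^ 2 := by nlinarith
  have hwt := (wt_pos (l.length - 3)).le
  have h0 : ‖cls (iter h.fn (fns (f :: l)))‖ ≤ 16 * K ^ 2 * W * wt (l.length - 3) := by
    refine (norm_iter_le h.fn (fns (f :: l)) (N := W) (n := l.length - 3) ?_ ?_).trans ?_
    · rw [fns_cons, nprod_cons, hW]
      gcongr
      exacts [h.norm_le, f.norm_le]
    · simp only [length_fns, List.length_cons]
      omega
    · gcongr
      nlinarith
  have hh0 : ‖h.fn 0‖ ≤ K * h.a := h.sup_le 0 (by simp)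
  have t1 : Reg 1 (iter h.fn' (fns (f :: l))) (4 * K * (K * W) * wt (l.length - 3)) := by
    refine reg_one_second hK h.fn' f (fns l) ?_ (by rw [length_fns]; omega)
    calc _ ≤ K * h.a * (f.a * wprod l) := by gcongr; exact h.norm_le'
      _ = K * W := by rw [hW]; ring
  refine ⟨h0, ?_⟩
  cases l with
  | nil =>
    refine ⟨_, (hasD_inner_two h.hasDerivAt f.fn).ev1, ?_⟩
    rw [map_sub, map_neg, map_smul]
    have t2 : Reg 1 (ev1 (lift₁ f.fn)) (4 * K * (f.a * 1) * wt (([] : List (BddFn K)).length - 2)) :=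
      reg_one hK f []
    refine (t1.neg.sub (t2.smul _)).mono ?_
    simp only [List.length_nil, Nat.zero_sub, wt_zero, mul_one, wprod_nil] at hW ⊢
    have : ‖h.fn 0‖ * (4 * K * f.a) ≤ K * h.a * (4 * K * f.a) := by gcongr
    rw [hW]
    nlinarith [mul_nonneg (sq_nonneg K) (mul_nonneg hh hf)]
  | cons g r =>
    have hg := g.a_nonneg
    have hr := wprod_nonneg r
    simp only [List.length_cons] at *
    rw [wprod_cons] at hW
    refine ⟨_, ((hasD_inner_three h.hasDerivAt f.fn g.fn).applyAll
      (fun s => by simp [V_zero, V_diag]) (fun τ => V_diag _ _ τ) (fns r)).ev1, ?_⟩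
    rw [map_smul]
    refine Reg.sign_smul ?_ _
    rw [map_sub, map_sub, map_add, map_add, map_smul, map_smul]
    have t2 : Reg 1 (ev1 (applyAll (fns r) (V g.fn (lift₁ f.fn)))) _ := reg_one hK f (g :: r)
    have hK' : K ≤ 2 * K ^ 2 := by nlinarith
    have t3 : Reg 1 (ev1 (applyAll (fns r) (lift₁ (g.fn * prim (f.fn * h.fn)))))
        (4 * (2 * K ^ 2) * ((BddFn.mulPrim hK g f h).a * wprod r) * wt (r.length - 2)) := by
      have := reg_one (K := 2 * K ^ 2) (by nlinarith) (BddFn.mulPrim hK g f h)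
        (r.map (BddFn.weaken hK'))
      rw [fns_weaken, wprod_weaken, List.length_map] at this
      exact this
    refine ((t1.add (t2.smul _)).sub t3).mono ?_
    have w2 := wt_anti (show r.length + 1 - 3 ≤ (g :: r).length - 2 by
      rw [List.length_cons]; omega)
    have w3 := wt_anti (show r.length + 1 - 3 ≤ r.length - 2 by omega)
    have p2 := (wt_pos ((g :: r).length - 2)).le
    have e2 : ‖h.fn 0‖ * (4 * K * (f.a * wprod (g :: r)) * wt ((g :: r).length - 2)) ≤
        4 * K ^ 2 * W * wt (r.length + 1 - 3) := by
      rw [wprod_cons]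
      calc _ ≤ K * h.a * (4 * K * (f.a * (g.a * wprod r)) * wt (r.length + 1 - 3)) := by gcongr
        _ = _ := by rw [hW]; ring
    have e3 : 4 * (2 * K ^ 2) * ((BddFn.mulPrim hK g f h).a * wprod r) * wt (r.length - 2) ≤
        8 * K ^ 2 * W * wt (r.length + 1 - 3) := by
      have e : (BddFn.mulPrim hK g f h).a * wprod r = W := by
        rw [hW]; simp only [BddFn.mulPrim]; ring
      rw [e]
      calc _ ≤ 4 * (2 * K ^ 2) * W * wt (r.length + 1 - 3) := by gcongr
        _ = _ := by ring
    refine (add_le_add (add_le_add le_rfl e2) e3).trans_eq ?_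
    ring

/-- With a square integrable innermost function there are two derivatives, if the three following
functions are differentiable: the first derivative is put on `f`, the second one on `g` in the term
with `f'`, and on the second function in the boundary terms. -/
lemma reg_two_second {K : ℝ} (hK : 1 ≤ K) (k : C(ℝ, ℂ)) (f g e : BddFn K) (r : List C(ℝ, ℂ))
    {N : ℝ} (hN : ‖cls k‖ * (f.a * (g.a * (e.a * nprod r))) ≤ N) {n : ℕ} (hn : n ≤ r.length - 1) :
    Reg 2 (iter k (f.fn :: g.fn :: e.fn :: r)) (20 * K ^ 2 * N * wt n) := by
  have hf := f.a_nonneg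
  have hg := g.a_nonneg
  have he := e.a_nonneg
  have hr := nprod_nonneg r
  have hN0 : 0 ≤ N := le_trans (by positivity) hN
  have hw := (wt_pos n).le
  have hK0 : 0 ≤ K := zero_le_one.trans hK
  have hK2 : K ≤ K ^ 2 := by nlinarith
  refine ⟨?_, _, ((hasD_second_three f.hasDerivAt k g.fn).applyAll
    (fun s => by simp [V_zero, V_diag]) (fun τ => V_diag _ _ τ) (e.fn :: r)).ev1, ?_⟩
  · refine (norm_iter_le k _ (N := N) (n := n) ?_ ?_).trans ?_
    · simp only [nprod_cons]
      refine le_trans ?_ hN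
      gcongr
      exacts [f.norm_le, g.norm_le, e.norm_le]
    · simp only [List.length_cons]
      omega
    · gcongr
      nlinarith
  · rw [map_smul]
    refine Reg.sign_smul ?_ _
    simp only [map_sub, map_add, map_neg]
    have t1 : Reg 1 (ev1 (applyAll (e.fn :: r) (V g.fn (V f.fn' (lift₁ k)))))
        (4 * K * (K * N) * wt n) := by
      refine reg_one_third hK k f.fn' g (e.fn :: r) ?_ (by rw [List.length_cons]; omega)
      rw [nprod_cons]
      calc _ ≤ ‖cls k‖ * (K * f.a * (g.a * (e.a * nprod r))) := by
            gcongr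
            exacts [f.norm_le', e.norm_le]
        _ = K * (‖cls k‖ * (f.a * (g.a * (e.a * nprod r)))) := by ring
        _ ≤ K * N := by gcongr
    have t2 : Reg 1 (ev1 (applyAll (e.fn :: r) (prodFn k (prim (g.fn * f.fn)))))
        (4 * (2 * K ^ 2) * N * wt n) := by
      rw [applyAll_cons, V_prodFn]
      refine reg_one_second (by nlinarith) k (BddFn.mulPrim hK e g f) r ?_ hn
      refine le_of_eq_of_le ?_ hN
      simp only [BddFn.mulPrim]
      ring
    have t3 : Reg 1 (ev1 (applyAll (e.fn :: r) (lift₁ (k * prim (g.fn * f.fn)))))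
        (4 * K * N * wt n) := by
      refine reg_one_second hK _ e r ?_ hn
      refine le_trans ?_ hN
      calc _ ≤ ‖cls k‖ * (g.a * f.a) * (e.a * nprod r) := by
            gcongr
            exact norm_cls_mul_le k fun x hx => g.norm_prim_le f hx
        _ = _ := by ring
    have t4 : Reg 1 (ev1 (applyAll (e.fn :: r) (lift₁ (g.fn * prim (f.fn * k)))))
        (4 * K * N * wt n) := by
      refine reg_one_second hK _ e r ?_ hn
      refine le_trans ?_ hN
      calc _ ≤ g.a * (f.a * ‖cls k‖) * (e.a * nprod r) := by
            gcongr
            refine (norm_cls_mul_le g.fn (S := f.a * ‖cls k‖) fun x hx => ?_).trans ?_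
            · exact (norm_prim_le _ _ hx).trans (by gcongr; exact f.norm_le)
            · gcongr
              exact g.norm_le
        _ = _ := by ring
    refine (((t1.neg.add t2).sub t3).sub t4).mono ?_
    have h1 : K * (N * wt n) ≤ K ^ 2 * (N * wt n) := by gcongr
    nlinarith

/-- For at least four differentiable functions the integral has three derivatives. The first one is
put on the innermost function `h`. The integral with `h'` has two more by `reg_two_second`, the
boundary terms by `reg_two`. -/
lemma reg_three {K : ℝ} (hK : 1 ≤ K) (h f g e : BddFn K) (r : List (BddFn K)) :
    Reg 3 (iter h.fn (fns (f :: g :: e :: r)))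
      (100 * K ^ 4 * (h.a * wprod (f :: g :: e :: r)) * wt (r.length - 3)) := by
  have hh := h.a_nonneg
  have hf := f.a_nonneg
  have hg := g.a_nonneg
  have he := e.a_nonneg
  have hl := wprod_nonneg r
  have hnl := nprod_nonneg (fns r)
  have hl' := nprod_fns_le r
  have hK0 : 0 ≤ K := zero_le_one.trans hK
  have hK' : K ≤ 2 * K ^ 2 := by nlinarith
  set W := h.a * wprod (f :: g :: e :: r) with hW
  simp only [wprod_cons] at hW
  have hW0 : 0 ≤ W := by rw [hW]; positivity
  have hwt := (wt_pos (r.length - 3)).le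
  have hK2 : (1 : ℝ) ≤ K ^ 2 := one_le_pow₀ hK
  have hK34 : K ^ 3 ≤ K ^ 4 := pow_le_pow_right₀ hK (by norm_num)
  have hK4 : (1 : ℝ) ≤ K ^ 4 := one_le_pow₀ hK
  have hh0 : ‖h.fn 0‖ ≤ K * h.a := h.sup_le 0 (by simp)
  refine ⟨?_, _, ((hasD_inner_three h.hasDerivAt f.fn g.fn).applyAll
      (fun s => by simp [V_zero, V_diag]) (fun τ => V_diag _ _ τ) (fns (e :: r))).ev1, ?_⟩
  · refine (norm_iter_le h.fn (fns (f :: g :: e :: r)) (N := W) (n := r.length - 3) ?_ ?_).trans ?_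
    · simp only [fns_cons, nprod_cons]
      rw [hW]
      gcongr
      exacts [h.norm_le, f.norm_le, g.norm_le, e.norm_le]
    · simp only [length_fns, List.length_cons]
      omega
    · gcongr
      exact le_mul_of_one_le_left hW0 (by linarith)
  · rw [map_smul]
    refine Reg.sign_smul ?_ _
    rw [map_sub, map_sub, map_add, map_add, map_smul, map_smul]
    have t1 : Reg 2 (ev1 (applyAll (fns (e :: r)) (V g.fn (V f.fn (lift₁ h.fn')))))
        (20 * K ^ 2 * (K * W) * wt (r.length - 3)) := by
      refine reg_two_second hK h.fn' f g e (fns r) ?_ (by rw [length_fns]; omega)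
      calc _ ≤ K * h.a * (f.a * (g.a * (e.a * wprod r))) := by gcongr; exact h.norm_le'
        _ = K * W := by rw [hW]; ring
    have t2 : Reg 2 (ev1 (applyAll (fns (e :: r)) (V g.fn (lift₁ f.fn)))) _ :=
      reg_two hK f g (e :: r)
    have t3 : Reg 2 (ev1 (applyAll (fns (e :: r)) (lift₁ (g.fn * prim (f.fn * h.fn)))))
        (16 * (2 * K ^ 2) ^ 2 * ((BddFn.mulPrim hK g f h).a * wprod (e :: r)) *
          wt (r.length - 3)) := by
      have := reg_two (K := 2 * K ^ 2) (by nlinarith) (BddFn.mulPrim hK g f h) (e.weaken hK')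
        (r.map (BddFn.weaken hK'))
      rw [← List.map_cons (f := BddFn.weaken hK'), fns_weaken, wprod_weaken,
        List.length_map] at this
      exact this
    refine ((t1.add (t2.smul _)).sub t3).mono ?_
    have w2 := wt_anti (show r.length - 3 ≤ (e :: r).length - 3 by simp; omega)
    have p2 := (wt_pos ((e :: r).length - 3)).le
    have e2 : ‖h.fn 0‖ * (16 * K ^ 2 * (f.a * wprod (g :: e :: r)) * wt ((e :: r).length - 3)) ≤
        16 * K ^ 3 * W * wt (r.length - 3) := by
      simp only [wprod_cons]
      calc _ ≤ K * h.a * (16 * K ^ 2 * (f.a * (g.a * (e.a * wprod r))) * wt (r.length - 3)) := by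
            gcongr
        _ = _ := by rw [hW]; ring
    have e3 : (BddFn.mulPrim hK g f h).a * wprod (e :: r) = W := by
      rw [hW, wprod_cons]; simp only [BddFn.mulPrim]; ring
    rw [e3]
    have h1 : K ^ 3 * (W * wt (r.length - 3)) ≤ K ^ 4 * (W * wt (r.length - 3)) := by gcongr
    nlinarith

/-! ### The integrals of continuous functions as iterated operators -/

/-- The variable in which `I_{k+1}` is an iterated operator applied to reflected functions. -/
def coord (k : ℕ) (s : ℝ) : ℝ := if Even k then 1 - s else s

lemma coord_succ (k : ℕ) (s z : ℝ) :
    coord k (s + (-1) ^ k * z) = 1 - z - coord (k + 1) s := by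
  by_cases h : Even k
  · simp [coord, h, Nat.even_add_one, h.neg_one_pow]; ring
  · simp [coord, h, Nat.even_add_one, (Nat.not_even_iff_odd.1 h).neg_one_pow]; ring

/-- The integral over `region k (1 - v) s` as a function of the coordinate of `s` and of `v`, for
the functions `g_l(1 - ·)`. -/
def regionFn (k : ℕ) (g : Fin (k + 1) → C(ℝ, ℂ)) : C(ℝ × ℝ, ℂ) :=
  applyAll (List.ofFn fun i : Fin k => g i.succ) (lift₁ (g 0))

lemma regionFn_succ (k : ℕ) (g : Fin (k + 2) → C(ℝ, ℂ)) :
    regionFn (k + 1) g = V (g (Fin.last _)) (regionFn k fun l => g l.castSucc) := by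
  rw [regionFn, List.ofFn_succ_last, applyAll_append]
  simp only [applyAll_cons, applyAll_nil, Fin.succ_last, regionFn, Fin.succ_castSucc,
    Fin.castSucc_zero]

lemma continuous_prodAt {k : ℕ} (f : Fin (k + 1) → C(ℝ, ℂ)) (s : ℝ) :
    Continuous (prodAt k (fun l => ⇑(f l)) s) := by
  unfold prodAt
  fun_prop

lemma integrableOn_prodAt {k : ℕ} (f : Fin (k + 1) → C(ℝ, ℂ)) (u s : ℝ) :
    IntegrableOn (prodAt k (fun l => ⇑(f l)) s) (region k u s) := by
  refine IntegrableOn.mono_set (t := Set.Icc (fun _ => u) fun _ => 1)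
    ((continuous_prodAt f s).continuousOn.integrableOn_compact isCompact_Icc) fun y hy => ?_
  exact ⟨fun l => ((region_le_one hy).1 l).1, fun l => ((region_le_one hy).1 l).2⟩

/-- By induction, with the last variable `z` integrated out last; `τ = 1 - z` is the variable of
integration of the operator `V`. -/
lemma setIntegral_prodAt (k : ℕ) (g : Fin (k + 1) → C(ℝ, ℂ)) (u s : ℝ) :
    ∫ y in region k u s, prodAt k (fun l => ⇑(refl (g l))) s y =
      if 0 ≤ coord k s ∧ coord k s ≤ 1 - u then regionFn k g (coord k s, 1 - u) else 0 := by
  induction k generalizing u s with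
  | zero =>
    have h : (0 ≤ coord 0 s ∧ coord 0 s ≤ 1 - u) ↔ u ≤ s ∧ s ≤ 1 := by
      simp only [coord, Even.zero, if_true]
      constructor <;> rintro ⟨h1, h2⟩ <;> constructor <;> linarith
    rw [← integral_indicator (measurableSet_region' _ _ _), integral_unique]
    by_cases hs : u ≤ s ∧ s ≤ 1
    · rw [if_pos (h.2 hs), Set.indicator_of_mem]
      · have h1 : (volume : Measure (Fin 0 → ℝ)) Set.univ = 1 := by
          rw [volume_pi, Measure.pi_of_empty]
          simp
        simp [prodAt, xi, regionFn, coord, Measure.real, h1]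
      · simp [region, xi, hs.1, hs.2, Subsingleton.antitone]
    · rw [if_neg (fun h' => hs (h.1 h')), Set.indicator_of_notMem, smul_zero]
      exact fun hy => hs (by simpa [xi] using hy.2.2.2)
  | succ k ih =>
    have hm := measurableSet_region' (k + 1) u s
    rw [← integral_indicator hm,
      integral_snoc ((integrable_indicator_iff hm).2 (integrableOn_prodAt _ u s))]
    set x := coord (k + 1) s with hx
    have e : ∀ z, ∫ y : Fin k → ℝ, (region (k + 1) u s).indicator
        (prodAt (k + 1) (fun l => ⇑(refl (g l))) s) (Fin.snoc y z : Fin (k + 1) → ℝ) =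
        if u ≤ z ∧ 0 ≤ x ∧ x ≤ 1 - z then
          g (Fin.last _) (1 - z) * regionFn k (fun l => g l.castSucc) (1 - z - x, 1 - z)
        else 0 := by
      intro z
      by_cases hz : u ≤ z
      · have hi : ∀ y : Fin k → ℝ, (region (k + 1) u s).indicator
            (prodAt (k + 1) (fun l => ⇑(refl (g l))) s) (Fin.snoc y z : Fin (k + 1) → ℝ) =
            g (Fin.last _) (1 - z) * (region k z (s + (-1) ^ k * z)).indicator
              (prodAt k (fun l => ⇑(refl (g l.castSucc))) (s + (-1) ^ k * z)) y := by
          intro y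
          by_cases hy : y ∈ region k z (s + (-1) ^ k * z)
          · rw [Set.indicator_of_mem (snoc_mem_region.2 ⟨hz, hy⟩), Set.indicator_of_mem hy,
              prodAt_snoc]
            rfl
          · rw [Set.indicator_of_notMem (fun h => hy (snoc_mem_region.1 h).2),
              Set.indicator_of_notMem hy, mul_zero]
        simp only [hi]
        rw [integral_const_mul, integral_indicator (measurableSet_region' _ _ _), ih,
          coord_succ, ← hx]
        have h : (0 ≤ 1 - z - x ∧ 1 - z - x ≤ 1 - z) ↔ (u ≤ z ∧ 0 ≤ x ∧ x ≤ 1 - z) :=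
          ⟨fun h => ⟨hz, by linarith [h.2], by linarith [h.1]⟩,
            fun h => ⟨by linarith [h.2.2], by linarith [h.2.1]⟩⟩
        simp only [h]
        split_ifs <;> simp
      · rw [if_neg fun h => hz h.1]
        refine integral_eq_zero_of_ae (Eventually.of_forall fun y => ?_)
        exact Set.indicator_of_notMem (fun h => hz (snoc_mem_region.1 h).1) _
    simp only [e]
    by_cases h : 0 ≤ x ∧ x ≤ 1 - u
    · rw [if_pos h, regionFn_succ, V_apply]
      have h1 : ∀ z, (if u ≤ z ∧ 0 ≤ x ∧ x ≤ 1 - z then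
          g (Fin.last _) (1 - z) * regionFn k (fun l => g l.castSucc) (1 - z - x, 1 - z) else 0) =
          (Set.Icc u (1 - x)).indicator (fun z => g (Fin.last _) (1 - z) *
            regionFn k (fun l => g l.castSucc) (1 - z - x, 1 - z)) z := by
        intro z
        rw [Set.indicator_apply]
        congr 1
        simp only [Set.mem_Icc, eq_iff_iff]
        exact ⟨fun h => ⟨h.1, by linarith [h.2.2]⟩, fun h' => ⟨h'.1, h.1, by linarith [h'.2]⟩⟩
      simp only [h1]
      rw [integral_indicator measurableSet_Icc, integral_Icc_eq_integral_Ioc,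
        ← intervalIntegral.integral_of_le (by linarith [h.2])]
      have := intervalIntegral.integral_comp_sub_left (a := u) (b := 1 - x) (fun τ =>
        g (Fin.last _) τ * regionFn k (fun l => g l.castSucc) (τ - x, τ)) 1
      rw [this, sub_sub_cancel]
    · rw [if_neg h]
      refine integral_eq_zero_of_ae (Eventually.of_forall fun z => ?_)
      exact if_neg fun h' => h ⟨h'.2.1, by linarith [h'.1, h'.2.2]⟩

lemma In_refl {k : ℕ} (hk : 1 ≤ k) (g : Fin (k + 1) → C(ℝ, ℂ)) {s : ℝ}
    (hs : s ∈ Set.Icc (0 : ℝ) 1) :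
    In (k + 1) (fun l => ⇑(refl (g l))) s = ev1 (regionFn k g) (coord k s) := by
  rw [In_eq hk, setIntegral_prodAt, if_pos]
  · simp
  · unfold coord
    split_ifs
    · exact ⟨by linarith [hs.2], by linarith [hs.1]⟩
    · simpa using hs

lemma refl_refl (f : C(ℝ, ℂ)) : refl (refl f) = f := by ext x; simp

lemma Reg.refl {m : ℕ} {u : C(ℝ, ℂ)} {M : ℝ} (h : Reg m u M) : Reg m (refl u) M := by
  induction m generalizing u with
  | zero => exact (norm_cls_refl u).trans_le h
  | succ m ih =>
    obtain ⟨h1, u', h2, h3⟩ := h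
    exact ⟨(norm_cls_refl u).trans_le h1, _, fun x => hasDerivAt_refl h2 x, (ih h3).neg⟩

/-- The bounds for the iterated operators are bounds for `I_{k+1}`, as the coordinate of `s` is `s` or
`1 - s`. -/
lemma exists_isWeakJet_Iop {m k : ℕ} (hk : 1 ≤ k) (g : Fin (k + 1) → C(ℝ, ℂ)) {M : ℝ}
    (h : Reg m (iter (g 0) (List.ofFn fun i : Fin k => g i.succ)) M) :
    ∃ D, IsWeakJet m (Iop k hk fun l => cls (refl (g l))) D ∧ ∀ j, ‖D j‖ ≤ M := by
  have e : ∃ u, Reg m u M ∧ Iop k hk (fun l => cls (refl (g l))) = cls u := by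
    have key : ∀ u : C(ℝ, ℂ), (∀ s ∈ Set.Icc (0 : ℝ) 1, ev1 (regionFn k g) (coord k s) = u s) →
        Iop k hk (fun l => cls (refl (g l))) = cls u := by
      intro u hu
      rw [show (fun l => cls (refl (g l))) = fun l => (memLp_continuous (refl (g l))).toLp _ from
        rfl, Iop_toLp]
      refine (MemLp.toLp_eq_toLp_iff _ (memLp_continuous u)).2 ?_
      refine (ae_restrict_iff' measurableSet_Ioo).2 (Eventually.of_forall fun s hs => ?_)
      rw [In_refl hk g (Set.Ioo_subset_Icc_self hs), hu s (Set.Ioo_subset_Icc_self hs)]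
    by_cases hE : Even k
    · exact ⟨_, h.refl, key _ fun s _ => by simp [coord, hE, iter, regionFn]⟩
    · exact ⟨_, h, key _ fun s _ => by simp [coord, hE, iter, regionFn]⟩
  obtain ⟨u, hu, he⟩ := e
  rw [he]
  exact hu.exists_isWeakJet

/-! ### The operator `I_n` on functions with a weak derivative -/

/-- The Sobolev inequality `|f(x)| ≤ |f|₀ + |f'|₀` on `[0,1]`. -/
lemma norm_le_norm_cls_add {f f' : C(ℝ, ℂ)} (h : ∀ x, HasDerivAt f (f' x) x) {x : ℝ}
    (hx : x ∈ Set.Icc (0 : ℝ) 1) : ‖f x‖ ≤ ‖cls f‖ + ‖cls f'‖ := by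
  have h1 : ‖cls (1 : C(ℝ, ℂ))‖ ≤ 1 := norm_cls_le zero_le_one (by simp)
  have hint : ∀ g : C(ℝ, ℂ), ∫ x in (0 : ℝ)..1, ‖g x‖ ≤ ‖cls g‖ := fun g => by
    have := integral_norm_mul_le g 1
    simp only [ContinuousMap.one_apply, norm_one, mul_one] at this
    exact this.trans (mul_le_of_le_one_right (norm_nonneg _) h1)
  have key : ∀ y ∈ Set.Icc (0 : ℝ) 1, ‖f x‖ ≤ ‖f y‖ + ‖cls f'‖ := by
    intro y hy
    have e : ∫ t in y..x, f' t = f x - f y := intervalIntegral.integral_eq_sub_of_hasDerivAt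
      (fun t _ => h t) (f'.continuous.intervalIntegrable _ _)
    have h2 : ‖∫ t in y..x, f' t‖ ≤ ‖cls f'‖ := by
      refine (intervalIntegral.norm_integral_le_integral_norm_uIoc).trans ((hint f').trans' ?_)
      rw [intervalIntegral.integral_of_le zero_le_one]
      refine setIntegral_mono_set (Continuous.integrableOn_Ioc (by fun_prop))
        (Eventually.of_forall fun t => norm_nonneg _) (LE.le.eventuallyLE ?_)
      rw [Set.uIoc]
      exact Set.Ioc_subset_Ioc (le_min hy.1 hx.1) (max_le hy.2 hx.2)
    calc ‖f x‖ = ‖f y + ∫ t in y..x, f' t‖ := by rw [e, add_sub_cancel]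
      _ ≤ _ := norm_add_le_of_le le_rfl h2
  have h3 := intervalIntegral.integral_mono_on (μ := volume) (a := 0) (b := 1) zero_le_one
    (f := fun _ => ‖f x‖) (g := fun y => ‖f y‖ + ‖cls f'‖)
    (Continuous.intervalIntegrable (by fun_prop) _ _)
    (Continuous.intervalIntegrable (by fun_prop) _ _) key
  rw [intervalIntegral.integral_add (Continuous.intervalIntegrable (by fun_prop) _ _)
    (Continuous.intervalIntegrable (by fun_prop) _ _)] at h3
  simp only [intervalIntegral.integral_const, sub_zero, one_smul] at h3
  exact h3.trans (add_le_add_left (hint f) _)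

/-- The reflection of a smoothing of a function with a weak derivative. -/
def BddFn.ofJet {K a : ℝ} {f f' : L2} (h : HasWeakDeriv f f') (hf : ‖f‖ ≤ a) (hf' : ‖f'‖ ≤ K * a)
    (j : ℕ) : BddFn (1 + K) :=
  have ha : 0 ≤ a := (norm_nonneg _).trans hf
  have hD : ![f, f'] ∈ jets 1 := IsWeakJet.mem_jets (f := f) ⟨rfl, fun k => by
    fin_cases k; exact h⟩
  have h1 : ‖cls (smooth j 1 f)‖ ≤ K * a := (norm_cls_smooth_le hD j 1).trans hf'
  { fn := refl (smooth j 0 f)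
    fn' := -refl (smooth j 1 f)
    a := a
    hasDerivAt := fun x => hasDerivAt_refl (hasDerivAt_smooth j 0 f) x
    norm_le := (norm_cls_refl _).trans_le ((norm_cls_smooth_zero_le j f).trans hf)
    norm_le' := by
      rw [map_neg, norm_neg, norm_cls_refl]
      linarith
    sup_le := fun x hx => by
      refine (norm_le_norm_cls_add (hasDerivAt_smooth j 0 f)
        (x := 1 - x) ⟨by linarith [hx.2], by linarith [hx.1]⟩).trans ?_
      have := (norm_cls_smooth_zero_le j f).trans hf
      linarith }

/-- `I_{k+1}` as a continuous multilinear map. -/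
def IopL (k : ℕ) (hk : 1 ≤ k) : ContinuousMultilinearMap ℂ (fun _ : Fin (k + 1) => L2) L2 :=
  (Iop k hk).mkContinuous _ (norm_Iop_le hk)

/-- Bounds for continuously differentiable functions extend to functions with a weak derivative: the
integrals of smoothings converge in `L₂` and have bounded jets. -/
lemma exists_isWeakJet_of_reg {m k : ℕ} (hk : 1 ≤ k) {K C : ℝ}
    (hreg : ∀ g : Fin (k + 1) → BddFn (1 + K),
      Reg m (iter (g 0).fn (fns (List.ofFn fun i : Fin k => g i.succ))) (C * ∏ l, (g l).a))
    {f f' : Fin (k + 1) → L2} {a : Fin (k + 1) → ℝ} (h : ∀ l, HasWeakDeriv (f l) (f' l))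
    (hf : ∀ l, ‖f l‖ ≤ a l) (hf' : ∀ l, ‖f' l‖ ≤ K * a l) :
    ∃ D, IsWeakJet m (Iop k hk f) D ∧ ∀ j, ‖D j‖ ≤ C * ∏ l, a l := by
  have key : ∀ j : ℕ, ∃ D, IsWeakJet m (Iop k hk fun l => cls (smooth j 0 (f l))) D ∧
      ∀ i, ‖D i‖ ≤ C * ∏ l, a l := by
    intro j
    let g : Fin (k + 1) → BddFn (1 + K) := fun l => BddFn.ofJet (h l) (hf l) (hf' l) j
    have h1 : Reg m (iter (g 0).fn (List.ofFn fun i : Fin k => (g i.succ).fn))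
        (C * ∏ l, a l) := by
      have := hreg g
      rwa [fns, List.map_ofFn] at this
    have h2 := exists_isWeakJet_Iop hk (fun l => (g l).fn) h1
    simp only [g, BddFn.ofJet, refl_refl] at h2
    exact h2
  choose D hD hDM using key
  refine exists_isWeakJet_of_tendsto (l := atTop) (v := D)
    (Eventually.of_forall fun j => (hD j).mem_jets) (Eventually.of_forall hDM) ?_
  simp only [(hD _).1]
  have : Tendsto (fun j => fun l => cls (smooth j 0 (f l))) atTop (𝓝 f) :=
    tendsto_pi_nhds.2 fun l => tendsto_cls_smooth (f l)
  exact ((IopL k hk).cont.tendsto f).comp this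

lemma exists_isWeakJet_two {k : ℕ} (hk : 1 ≤ k) {K : ℝ} (hK : 0 ≤ K)
    {f f' : Fin (k + 1) → L2} {a : Fin (k + 1) → ℝ} (h : ∀ l, HasWeakDeriv (f l) (f' l))
    (hf : ∀ l, ‖f l‖ ≤ a l) (hf' : ∀ l, ‖f' l‖ ≤ K * a l) :
    ∃ D, IsWeakJet 2 (Iop k hk f) D ∧
      ∀ j, ‖D j‖ ≤ 16 * (1 + K) ^ 2 * wt (k - 4) * ∏ l, a l := by
  refine exists_isWeakJet_of_reg hk (fun g => ?_) h hf hf'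
  obtain ⟨k, rfl⟩ := Nat.exists_eq_add_of_le' hk
  have := reg_two (K := 1 + K) (by linarith) (g 0) (g 1) (List.ofFn fun i : Fin k => g i.succ.succ)
  rw [List.ofFn_succ]
  refine this.mono (le_of_eq ?_)
  rw [wprod_cons, wprod, List.map_ofFn, List.prod_ofFn, List.length_ofFn, Fin.prod_univ_succ,
    Fin.prod_univ_succ, show k + 1 - 4 = k - 3 by omega]
  simp only [Function.comp_apply, Fin.succ_zero_eq_one]
  ring

lemma exists_isWeakJet_three {k : ℕ} (hk : 3 ≤ k) (hk' : 1 ≤ k) {K : ℝ} (hK : 0 ≤ K)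
    {f f' : Fin (k + 1) → L2} {a : Fin (k + 1) → ℝ} (h : ∀ l, HasWeakDeriv (f l) (f' l))
    (hf : ∀ l, ‖f l‖ ≤ a l) (hf' : ∀ l, ‖f' l‖ ≤ K * a l) :
    ∃ D, IsWeakJet 3 (Iop k hk' f) D ∧
      ∀ j, ‖D j‖ ≤ 100 * (1 + K) ^ 4 * wt (k - 6) * ∏ l, a l := by
  refine exists_isWeakJet_of_reg hk' (fun g => ?_) h hf hf'
  obtain ⟨k, rfl⟩ := Nat.exists_eq_add_of_le' hk
  have := reg_three (K := 1 + K) (by linarith) (g 0) (g (Fin.succ 0)) (g (Fin.succ (Fin.succ 0)))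
    (g (Fin.succ (Fin.succ (Fin.succ 0)))) (List.ofFn fun i : Fin k => g i.succ.succ.succ.succ)
  rw [List.ofFn_succ, List.ofFn_succ, List.ofFn_succ]
  refine this.mono (le_of_eq ?_)
  rw [wprod_cons, wprod_cons, wprod_cons, wprod, List.map_ofFn, List.prod_ofFn, List.length_ofFn,
    Fin.prod_univ_succ, Fin.prod_univ_succ, Fin.prod_univ_succ, Fin.prod_univ_succ,
    show k + 3 - 6 = k - 3 by omega]
  simp only [Function.comp_apply]
  ring

open HadamardThreeLines

/-! ### Curves in Sobolev spaces -/

/-- A curve that is continuous with respect to `intENorm` is a continuous curve of jets. -/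
lemma exists_lift {X : Type*} [TopologicalSpace X] {m : ℕ} {u : X → L2}
    (hu : ∀ t, intENorm m (u t) < ⊤)
    (hc : ∀ t₀, Tendsto (fun t => intENorm m (u t - u t₀)) (𝓝 t₀) (𝓝 0)) :
    ∃ J : X → jets m, Continuous J ∧ ∀ t, (J t).1 0 = u t := by
  choose D hD using fun t => exists_isWeakJet (hu t)
  let J : X → jets m := fun t => ⟨D t, (hD t).mem_jets⟩
  have hJ : ∀ t, (J t).1 0 = u t := fun t => (hD t).1
  refine ⟨J, continuous_iff_continuousAt.2 fun t₀ => ?_, hJ⟩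
  rw [ContinuousAt, tendsto_iff_edist_tendsto_0]
  refine tendsto_of_tendsto_of_tendsto_of_le_of_le tendsto_const_nhds (hc t₀) (fun _ => zero_le)
    fun t => ?_
  rw [edist_eq_enorm_sub]
  refine (enorm_jet_le _).trans_eq ?_
  simp [← hJ]

lemma tendsto_intENorm_sub {X : Type*} [TopologicalSpace X] {m : ℕ} {J : X → jets m}
    (hJ : Continuous J) (t₀ : X) :
    Tendsto (fun t => intENorm m ((J t).1 0 - (J t₀).1 0)) (𝓝 t₀) (𝓝 0) := by
  have h1 : Tendsto (fun t => ((m + 1 : ℕ) : ℝ≥0∞) * ‖J t - J t₀‖ₑ) (𝓝 t₀) (𝓝 0) := by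
    have h2 : Tendsto (fun t => ‖J t - J t₀‖ₑ) (𝓝 t₀) (𝓝 0) := by
      simpa only [edist_eq_enorm_sub] using tendsto_iff_edist_tendsto_0.1 (hJ.tendsto t₀)
    have := ENNReal.Tendsto.const_mul (a := ((m + 1 : ℕ) : ℝ≥0∞)) h2
      (Or.inr (ENNReal.natCast_ne_top _))
    rwa [mul_zero] at this
  exact tendsto_of_tendsto_of_tendsto_of_le_of_le tendsto_const_nhds h1 (fun _ => zero_le)
    fun t => intENorm_jet_le (J t - J t₀)

lemma norm_cexp_sq_sub_sq_le (θ : ℝ) {z : ℂ} (hz : z ∈ verticalClosedStrip 0 1) :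
    ‖cexp (z ^ 2 - θ ^ 2)‖ ≤ Real.exp 1 * Real.exp (-z.im ^ 2) := by
  rw [Complex.norm_exp, ← Real.exp_add, Real.exp_le_exp]
  have h : (z ^ 2 - (θ : ℂ) ^ 2).re = z.re ^ 2 - z.im ^ 2 - θ ^ 2 := by
    simp [pow_two]
  rw [h]
  have h1 : 0 ≤ z.re := hz.1
  have h2 : z.re ≤ 1 := hz.2
  nlinarith [sq_nonneg θ]

lemma tendsto_exp_neg_sq : Tendsto (fun t : ℝ => Real.exp (-t ^ 2)) (cocompact ℝ) (𝓝 0) := by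
  refine Real.tendsto_exp_atBot.comp (tendsto_neg_atTop_atBot.comp ?_)
  have h := tendsto_norm_cocompact_atTop (E := ℝ)
  have h2 := (tendsto_pow_atTop (α := ℝ) two_ne_zero).comp h
  simpa [Function.comp_def] using h2

/-- A bounded holomorphic function on the strip with the right boundary values is made admissible
by a Gaussian factor. -/
lemma interpENorm_le {m : ℕ} {θ M : ℝ} {F : ℂ → L2} (hM : 0 ≤ M)
    (hd : DiffContOnCl ℂ F (verticalStrip 0 1))
    (hb : ∃ C : ℝ, ∀ z ∈ verticalClosedStrip 0 1, ‖F z‖ ≤ C)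
    (h0 : ∀ t : ℝ, ‖F (t * I)‖ ≤ M)
    (h1 : ∀ t : ℝ, intENorm m (F (1 + t * I)) ≤ ENNReal.ofReal M)
    (hc : ∀ t₀ : ℝ,
      Tendsto (fun t : ℝ => intENorm m (F (1 + t * I) - F (1 + t₀ * I))) (𝓝 t₀) (𝓝 0)) :
    interpENorm m θ (F θ) ≤ ENNReal.ofReal ((m + 1) * (Real.exp 1 * M)) := by
  have he := Real.exp_pos 1
  have he1 : 1 ≤ Real.exp 1 := Real.one_le_exp zero_le_one
  obtain ⟨J, hJc, hJ⟩ := exists_lift (u := fun t : ℝ => F (1 + t * I))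
    (fun t => (h1 t).trans_lt ENNReal.ofReal_lt_top) hc
  have hJM : ∀ t, ‖J t‖ ≤ M := fun t => by
    have := (enorm_jet_le (J t)).trans ((congrArg (intENorm m) (hJ t)).trans_le (h1 t))
    rwa [← ofReal_norm, ENNReal.ofReal_le_ofReal_iff hM] at this
  let e : ℂ → ℂ := fun z => cexp (z ^ 2 - θ ^ 2)
  have he_cont : Continuous e := by fun_prop
  let JG : ℝ → jets m := fun t => e (1 + t * I) • J t
  have hJG : ∀ t, (JG t).1 0 = e (1 + t * I) • F (1 + t * I) := fun t => by
    simp [JG, ← hJ]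
  have hJGc : Continuous JG := by
    have h2 : Continuous fun t : ℝ => e (1 + t * I) := he_cont.comp (by fun_prop)
    exact h2.smul hJc
  have strip0 : ∀ t : ℝ, (t * I : ℂ) ∈ verticalClosedStrip 0 1 := fun t => by
    simp [verticalClosedStrip]
  have strip1 : ∀ t : ℝ, (1 + t * I : ℂ) ∈ verticalClosedStrip 0 1 := fun t => by
    simp [verticalClosedStrip]
  have hJGn : ∀ t, ‖JG t‖ ≤ Real.exp 1 * Real.exp (-t ^ 2) * M := fun t => by
    rw [norm_smul]
    refine mul_le_mul ?_ (hJM t) (norm_nonneg _) (by positivity)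
    simpa using norm_cexp_sq_sub_sq_le θ (strip1 t)
  have hG0 : ∀ t : ℝ, ‖e (t * I) • F (t * I)‖ ≤ Real.exp 1 * Real.exp (-t ^ 2) * M := fun t => by
    rw [norm_smul]
    refine mul_le_mul ?_ (h0 t) (norm_nonneg _) (by positivity)
    simpa using norm_cexp_sq_sub_sq_le θ (strip0 t)
  have hle : ∀ t : ℝ, Real.exp 1 * Real.exp (-t ^ 2) * M ≤ Real.exp 1 * M := fun t => by
    have : Real.exp (-t ^ 2) ≤ 1 := Real.exp_le_one_iff.2 (by nlinarith [sq_nonneg t])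
    calc _ ≤ Real.exp 1 * 1 * M := by gcongr
      _ = _ := by ring
  have hlim : Tendsto (fun t : ℝ => Real.exp 1 * Real.exp (-t ^ 2) * M) (cocompact ℝ) (𝓝 0) := by
    simpa using (tendsto_exp_neg_sq.const_mul (Real.exp 1)).mul_const M
  have hadm : Admissible m fun z => e z • F z := by
    refine ⟨(Differentiable.diffContOnCl (by fun_prop)).smul hd, ?_, ?_, ?_, ?_, ?_⟩
    · obtain ⟨C, hC⟩ := hb
      refine ⟨Real.exp 1 * C, fun z hz => ?_⟩
      rw [norm_smul]
      refine mul_le_mul ?_ (hC z hz) (norm_nonneg _) he.le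
      refine (norm_cexp_sq_sub_sq_le θ hz).trans (mul_le_of_le_one_right he.le ?_)
      exact Real.exp_le_one_iff.2 (by nlinarith [sq_nonneg z.im])
    · exact squeeze_zero_norm hG0 hlim
    · intro t
      rw [← hJG]
      exact intENorm_lt_top (isWeakJet_of_mem_jets (JG t).2)
    · intro t₀
      simpa only [hJG] using tendsto_intENorm_sub hJGc t₀
    · simp only [← hJG]
      have h2 : Tendsto (fun t => ‖JG t‖ₑ) (cocompact ℝ) (𝓝 0) := by
        have h3 : Tendsto JG (cocompact ℝ) (𝓝 0) := squeeze_zero_norm hJGn hlim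
        simpa only [edist_zero_right] using tendsto_iff_edist_tendsto_0.1 h3
      have h4 := ENNReal.Tendsto.const_mul (a := ((m + 1 : ℕ) : ℝ≥0∞)) h2
        (Or.inr (ENNReal.natCast_ne_top _))
      rw [mul_zero] at h4
      exact tendsto_of_tendsto_of_tendsto_of_le_of_le tendsto_const_nhds h4 (fun _ => zero_le)
        fun t => intENorm_jet_le (JG t)
  have hval : e θ • F θ = F θ := by simp [e]
  refine (iInf₂_le _ ⟨hadm, hval⟩).trans (max_le (iSup_le fun t => ?_) (iSup_le fun t => ?_))
  · rw [← ofReal_norm]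
    refine ENNReal.ofReal_le_ofReal (((hG0 t).trans (hle t)).trans ?_)
    have : 0 ≤ (m : ℝ) * (Real.exp 1 * M) := by positivity
    linarith
  · rw [← hJG]
    refine (intENorm_jet_le (JG t)).trans ?_
    rw [ENNReal.ofReal_mul (by positivity), ← ofReal_norm]
    have : ENNReal.ofReal ((m : ℝ) + 1) = ((m + 1 : ℕ) : ℝ≥0∞) := by
      rw [← ENNReal.ofReal_natCast]; push_cast; rfl
    rw [this]
    gcongr
    exact (hJGn t).trans (hle t)

/-- A bound in the interior of the strip, on the line `Re z = σ`. -/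
def LineBound (m m' : ℕ) (σ C : ℝ) : Prop :=
  ∀ (F : ℂ → L2) (M : ℝ), 0 < M → DiffContOnCl ℂ F (verticalStrip 0 1) →
    (∃ C : ℝ, ∀ z ∈ verticalClosedStrip 0 1, ‖F z‖ ≤ C) → (∀ t : ℝ, ‖F (t * I)‖ ≤ M) →
    (∀ t : ℝ, intENorm m (F (1 + t * I)) ≤ ENNReal.ofReal M) →
    intENorm m' (F σ) ≤ ENNReal.ofReal (C * M)

lemma lineBound_one : LineBound 2 1 (1 / 2) 42 := fun F M hM hd hb h0 h1 => by
  simpa using intENorm_one_le hM.le hd hb h0 h1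

lemma lineBound_two : LineBound 3 2 (2 / 3) 252000 := fun F M hM hd hb h0 h1 => by
  simpa using intENorm_two_le hM hd hb h0 h1

lemma strip_translate {F : ℂ → L2} (hF : DiffContOnCl ℂ F (verticalStrip 0 1))
    (hb : ∃ C : ℝ, ∀ z ∈ verticalClosedStrip 0 1, ‖F z‖ ≤ C) (t : ℝ) :
    DiffContOnCl ℂ (fun z => F (z + t * I)) (verticalStrip 0 1) ∧
    ∃ C : ℝ, ∀ z ∈ verticalClosedStrip 0 1, ‖F (z + t * I)‖ ≤ C := by
  simpa using strip_comp hF hb le_rfl one_pos (by simp) t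

/-- By translation the bound holds on the whole line. -/
lemma LineBound.le {m m' : ℕ} {σ C : ℝ} (h : LineBound m m' σ C) {F : ℂ → L2}
    (hF : Admissible m F) {M : ℝ} (hM : 0 < M) (h0 : ∀ t : ℝ, ‖F (t * I)‖ ≤ M)
    (h1 : ∀ t : ℝ, intENorm m (F (1 + t * I)) ≤ ENNReal.ofReal M) (t : ℝ) :
    intENorm m' (F (σ + t * I)) ≤ ENNReal.ofReal (C * M) := by
  obtain ⟨hd, hb⟩ := strip_translate hF.diffContOnCl hF.bounded t
  refine h (fun z => F (z + t * I)) M hM hd hb (fun s => ?_) (fun s => ?_)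
  · have := h0 (s + t)
    push_cast at this
    rwa [add_mul] at this
  · have := h1 (s + t)
    push_cast at this
    rwa [add_mul, ← add_assoc] at this

/-- The values on the line `Re z = σ` form a continuous curve: the boundary values are uniformly
continuous, so the bound applies to the difference of two translates of `F`. -/
lemma LineBound.tendsto {m m' : ℕ} {σ C : ℝ} (h : LineBound m m' σ C) {F : ℂ → L2}
    (hF : Admissible m F) (t₀ : ℝ) :
    Tendsto (fun t : ℝ => intENorm m' (F (σ + t * I) - F (σ + t₀ * I))) (𝓝 t₀) (𝓝 0) := by
  obtain ⟨J, hJc, hJ⟩ := exists_lift (u := fun t : ℝ => F (1 + t * I)) hF.mem_right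
    hF.continuous_right
  have hJ0 : Tendsto J (cocompact ℝ) (𝓝 0) := by
    rw [tendsto_iff_edist_tendsto_0]
    refine tendsto_of_tendsto_of_tendsto_of_le_of_le tendsto_const_nhds hF.zero_right
      (fun _ => zero_le) fun t => ?_
    rw [edist_zero_right, ← hJ]
    exact enorm_jet_le _
  have hE : Continuous fun t : ℝ => F (t * I) := by
    have hcl := hF.diffContOnCl.continuousOn
    rw [closure_strip] at hcl
    exact hcl.comp_continuous (by fun_prop) fun t => by simp [verticalClosedStrip]
  have uJ := hJc.uniformContinuous_of_tendsto_cocompact hJ0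
  have uE := hE.uniformContinuous_of_tendsto_cocompact hF.zero_left
  rw [Metric.uniformContinuous_iff] at uJ uE
  have key : ∀ ε > 0, ∀ᶠ t : ℝ in 𝓝 t₀,
      intENorm m' (F (σ + t * I) - F (σ + t₀ * I)) ≤ ENNReal.ofReal (C * ε) := by
    intro ε hε
    obtain ⟨δ₁, hδ₁, H₁⟩ := uJ (ε / (m + 1)) (by positivity)
    obtain ⟨δ₂, hδ₂, H₂⟩ := uE ε hε
    filter_upwards [Metric.ball_mem_nhds t₀ (lt_min hδ₁ hδ₂)] with t ht
    rw [Metric.mem_ball, lt_min_iff] at ht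
    have hdist : ∀ s : ℝ, dist (s + t) (s + t₀) = dist t t₀ := fun s => dist_add_left s t t₀
    obtain ⟨hd, hb⟩ := strip_translate hF.diffContOnCl hF.bounded t
    obtain ⟨hd', hb'⟩ := strip_translate hF.diffContOnCl hF.bounded t₀
    refine h (fun z => F (z + t * I) - F (z + t₀ * I)) ε hε (hd.sub hd') ?_ (fun s => ?_)
      (fun s => ?_)
    · obtain ⟨C₁, h₁⟩ := hb
      obtain ⟨C₂, h₂⟩ := hb'
      exact ⟨C₁ + C₂, fun z hz => norm_sub_le_of_le (h₁ z hz) (h₂ z hz)⟩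
    · have := (H₂ (a := s + t) (b := s + t₀) ((hdist s).trans_lt ht.2)).le
      rw [dist_eq_norm] at this
      push_cast at this
      rwa [add_mul, add_mul] at this
    · have h3 := (H₁ (a := s + t) (b := s + t₀) ((hdist s).trans_lt ht.1)).le
      rw [dist_eq_norm] at h3
      have h4 := intENorm_jet_le (J (s + t) - J (s + t₀))
      have e1 : (J (s + t) - J (s + t₀)).1 0 =
          F (1 + s * I + t * I) - F (1 + s * I + t₀ * I) := by
        have : (J (s + t) - J (s + t₀)).1 0 = (J (s + t)).1 0 - (J (s + t₀)).1 0 := rfl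
        rw [this, hJ, hJ]
        push_cast
        simp only [add_mul, add_assoc]
      rw [e1] at h4
      refine h4.trans ?_
      rw [← ofReal_norm, ← ENNReal.ofReal_natCast, ← ENNReal.ofReal_mul (by positivity)]
      refine ENNReal.ofReal_le_ofReal ?_
      push_cast
      rwa [le_div_iff₀' (by positivity)] at h3
  have hlim : Tendsto (fun ε : ℝ => ENNReal.ofReal (C * ε)) (𝓝[>] 0) (𝓝 0) := by
    have : Continuous fun ε : ℝ => ENNReal.ofReal (C * ε) :=
      ENNReal.continuous_ofReal.comp (by fun_prop)
    have h2 := this.tendsto 0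
    rw [mul_zero, ENNReal.ofReal_zero] at h2
    exact h2.mono_left nhdsWithin_le_nhds
  rw [ENNReal.tendsto_nhds_zero]
  intro η hη
  obtain ⟨ε, hε, hε0⟩ := ((hlim.eventually (ge_mem_nhds hη)).and self_mem_nhdsWithin).exists
  filter_upwards [key ε hε0] with t ht
  exact ht.trans hε

open HadamardThreeLines

/-! ### Interpolation of the estimates for `I_n` -/

lemma norm_le_of_intENorm_le {m : ℕ} {f : L2} {M : ℝ} (hM : 0 ≤ M)
    (h : intENorm m f ≤ ENNReal.ofReal M) : ‖f‖ ≤ M := by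
  obtain ⟨D, hD⟩ := exists_isWeakJet (h.trans_lt ENNReal.ofReal_lt_top)
  have h1 := (enorm_le_intENorm hD 0).trans h
  rwa [hD.1, ← ofReal_norm, ENNReal.ofReal_le_ofReal_iff hM] at h1

lemma Admissible.norm_le {m : ℕ} {F : ℂ → L2} (hF : Admissible m F) {M : ℝ} (hM : 0 ≤ M)
    (h0 : ∀ t : ℝ, ‖F (t * I)‖ ≤ M)
    (h1 : ∀ t : ℝ, intENorm m (F (1 + t * I)) ≤ ENNReal.ofReal M) {z : ℂ}
    (hz : z ∈ verticalClosedStrip 0 1) : ‖F z‖ ≤ M :=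
  norm_le_of_strip hF.diffContOnCl hF.bounded h0 (fun t => norm_le_of_intENorm_le hM (h1 t)) hz

/-- `I_{k+1}` maps functions with `|f_l|₀ ≤ a_l`, `|f_l'|₀ ≤ K a_l` to functions with derivatives up
to the order `m` bounded by `c(K) ∏ a_l`. -/
def JetBound (m k : ℕ) (hk : 1 ≤ k) (c : ℝ → ℝ) : Prop :=
  ∀ (K : ℝ) (f f' : Fin (k + 1) → L2) (a : Fin (k + 1) → ℝ), 0 ≤ K →
    (∀ l, HasWeakDeriv (f l) (f' l)) → (∀ l, ‖f l‖ ≤ a l) → (∀ l, ‖f' l‖ ≤ K * a l) →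
    ∃ D, IsWeakJet m (Iop k hk f) D ∧ ∀ j, ‖D j‖ ≤ c K * ∏ l, a l

/-- The value of a jet, as a linear map. -/
def evalJet (m : ℕ) : jets m →ₗ[ℂ] L2 :=
  (LinearMap.proj (R := ℂ) (φ := fun _ : Fin (m + 1) => L2) 0) ∘ₗ (jets m).subtype

@[simp] lemma evalJet_apply {m : ℕ} (D : jets m) : evalJet m D = D.1 0 := rfl

lemma evalJet_injective (m : ℕ) : Function.Injective (evalJet m) := fun D E h =>
  Subtype.ext (jets_ext D.2 E.2 h)

/-- `I_{k+1}` as a continuous multilinear map between spaces of jets. -/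
lemma JetBound.exists_lift {m k : ℕ} {hk : 1 ≤ k} {c : ℝ → ℝ} (h : JetBound m k hk c) :
    ∃ T : ContinuousMultilinearMap ℂ (fun _ : Fin (k + 1) => jets 1) (jets m),
      ∀ D, (T D).1 0 = Iop k hk fun l => (D l).1 0 := by
  have hD : ∀ D : Fin (k + 1) → jets 1, ∃ E, IsWeakJet m (Iop k hk fun l => (D l).1 0) E ∧
      ∀ j, ‖E j‖ ≤ c 1 * ∏ l, ‖D l‖ := fun D => by
    refine h 1 _ (fun l => (D l).1 1) _ zero_le_one (fun l => (D l).2 0)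
      (fun l => norm_le_pi_norm (D l).1 0) fun l => ?_
    rw [one_mul]
    exact norm_le_pi_norm (D l).1 1
  let T₀ : MultilinearMap ℂ (fun _ : Fin (k + 1) => jets 1) L2 :=
    (Iop k hk).compLinearMap fun _ => evalJet 1
  have hT₀ : ∀ D, T₀ D ∈ LinearMap.range (evalJet m) := fun D => by
    obtain ⟨E, hE, -⟩ := hD D
    exact ⟨⟨E, hE.mem_jets⟩, hE.1⟩
  let T₁ : MultilinearMap ℂ (fun _ : Fin (k + 1) => jets 1) (jets m) :=
    (LinearEquiv.ofInjective (evalJet m) (evalJet_injective m)).symm.toLinearMap.compMultilinearMap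
      (T₀.codRestrict _ hT₀)
  have hT₁ : ∀ D, (T₁ D).1 0 = Iop k hk fun l => (D l).1 0 := fun D => by
    have := LinearEquiv.apply_symm_apply
      (LinearEquiv.ofInjective (evalJet m) (evalJet_injective m)) (T₀.codRestrict _ hT₀ D)
    exact congrArg Subtype.val this
  refine ⟨T₁.mkContinuous (c 1) fun D => ?_, hT₁⟩
  obtain ⟨E, hE, hEn⟩ := hD D
  have e : T₁ D = ⟨E, hE.mem_jets⟩ := evalJet_injective m ((hT₁ D).trans hE.1.symm)
  rw [e]
  exact (pi_norm_le_iff_of_nonneg ((norm_nonneg _).trans (hEn 0))).2 hEn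

section

variable {m k : ℕ} {hk : 1 ≤ k} {c : ℝ → ℝ} {F : Fin (k + 1) → ℂ → L2} {M : Fin (k + 1) → ℝ}

/-- On the middle line of the strip the functions admissible for `(L₂, W²_2)` have values in
`W^1_2`, on which `I_{k+1}` is regularizing. -/
lemma intENorm_Iop_le (hJ : JetBound m k hk c) (hF : ∀ l, Admissible 2 (F l)) (hM : ∀ l, 0 < M l)
    (h0 : ∀ l, ∀ t : ℝ, ‖F l (t * I)‖ ≤ M l)
    (h1 : ∀ l, ∀ t : ℝ, intENorm 2 (F l (1 + t * I)) ≤ ENNReal.ofReal (M l)) (t : ℝ) :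
    intENorm m (Iop k hk fun l => F l ((1 / 2 : ℝ) + t * I)) ≤
      ENNReal.ofReal ((m + 1) * (c 42 * ∏ l, M l)) := by
  have hl := fun l => lineBound_one.le (hF l) (hM l) (h0 l) (h1 l) t
  choose D hD using fun l => exists_isWeakJet ((hl l).trans_lt ENNReal.ofReal_lt_top)
  have hz : ((1 / 2 : ℝ) + t * I : ℂ) ∈ verticalClosedStrip 0 1 := by
    simp only [verticalClosedStrip, Set.mem_preimage, Set.mem_Icc]
    simp
    norm_num
  obtain ⟨E, hE, hEn⟩ := hJ 42 (fun l => F l ((1 / 2 : ℝ) + t * I)) (fun l => D l 1) M (by norm_num)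
    (fun l => by
      have := (hD l).2 0
      rw [Fin.castSucc_zero, (hD l).1] at this
      exact this)
    (fun l => (hF l).norm_le (hM l).le (h0 l) (h1 l) hz) (fun l => by
      have h2 := (enorm_le_intENorm (hD l) 1).trans (hl l)
      rwa [← ofReal_norm, ENNReal.ofReal_le_ofReal_iff (by linarith [hM l])] at h2)
  refine (intENorm_le_mul hE (M := ENNReal.ofReal (c 42 * ∏ l, M l)) fun j => ?_).trans_eq ?_
  · rw [← ofReal_norm]
    exact ENNReal.ofReal_le_ofReal (hEn j)
  · rw [ENNReal.ofReal_mul (p := (m : ℝ) + 1) (by positivity), ← ENNReal.ofReal_natCast]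
    push_cast
    rfl

/-- The function `z ↦ I_{k+1}(F_1(z/2), …)` interpolates between the bound on `L₂` and the bound on the
middle line of the strip. -/
lemma interpENorm_Iop_le (hJ : JetBound m k hk c) (hc : wt k ≤ c 42)
    (hF : ∀ l, Admissible 2 (F l)) (hM : ∀ l, 0 < M l)
    (h0 : ∀ l, ∀ t : ℝ, ‖F l (t * I)‖ ≤ M l)
    (h1 : ∀ l, ∀ t : ℝ, intENorm 2 (F l (1 + t * I)) ≤ ENNReal.ofReal (M l)) (α : ℝ) :
    interpENorm m α (Iop k hk fun l => F l ((α / 2 : ℝ) : ℂ)) ≤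
      ENNReal.ofReal ((m + 1) * (Real.exp 1 * ((m + 1) * (c 42 * ∏ l, M l)))) := by
  have hP : 0 < ∏ l, M l := Finset.prod_pos fun l _ => hM l
  have hc0 : 0 < c 42 := (wt_pos k).trans_le hc
  have hs := fun l => strip_comp (hF l).diffContOnCl (hF l).bounded (c := 0) (d := 1 / 2) le_rfl
    (by norm_num) (by norm_num) 0
  have e : ∀ z : ℂ, ((0 : ℝ) : ℂ) + ((1 / 2 : ℝ) : ℂ) * z + ((0 : ℝ) : ℂ) * I = z / 2 := fun z => by
    push_cast
    ring
  simp only [e] at hs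
  have hbd : ∀ (f : Fin (k + 1) → L2) (a : Fin (k + 1) → ℝ), (∀ l, ‖f l‖ ≤ a l) →
      ‖Iop k hk f‖ ≤ wt k * ∏ l, a l := fun f a hfa =>
    (norm_Iop_le hk f).trans (mul_le_mul_of_nonneg_left
      (Finset.prod_le_prod (fun _ _ => norm_nonneg _) fun l _ => hfa l) (wt_pos k).le)
  have ehalf : ∀ t : ℝ, (1 + t * I : ℂ) / 2 = (1 / 2 : ℝ) + ((t / 2 : ℝ) : ℂ) * I := fun t => by
    push_cast
    ring
  have key := interpENorm_le (m := m) (θ := α) (M := (m + 1) * (c 42 * ∏ l, M l))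
    (F := fun z => Iop k hk fun l => F l (z / 2)) (by positivity) ?_ ?_ ?_ ?_ ?_
  · convert key using 4
    push_cast
    rfl
  · have hpi : DiffContOnCl ℂ (fun z l => F l (z / 2)) (verticalStrip 0 1) :=
      ⟨differentiableOn_pi.2 fun l => (hs l).1.1, continuousOn_pi.2 fun l => (hs l).1.2⟩
    exact ((IopL k hk).contDiff (n := 1).differentiable (by simp)).comp_diffContOnCl hpi
  · choose C hC using fun l => (hs l).2
    exact ⟨wt k * ∏ l, C l, fun z hz => hbd _ _ fun l => hC l z hz⟩
  · intro t
    refine (hbd _ M fun l => ?_).trans ?_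
    · have := h0 l (t / 2)
      rwa [show ((t / 2 : ℝ) : ℂ) * I = t * I / 2 by push_cast; ring] at this
    · have : wt k * ∏ l, M l ≤ c 42 * ∏ l, M l := by gcongr
      have h2 : 0 ≤ (m : ℝ) * (c 42 * ∏ l, M l) := by positivity
      linarith
  · intro t
    simp only [ehalf]
    exact intENorm_Iop_le hJ hF hM h0 h1 (t / 2)
  · obtain ⟨T, hT⟩ := hJ.exists_lift
    have hJl := fun l => IntervalSobolev.exists_lift
      (u := fun t : ℝ => F l ((1 / 2 : ℝ) + t * I))
      (fun t => (lineBound_one.le (hF l) (hM l) (h0 l) (h1 l) t).trans_lt ENNReal.ofReal_lt_top)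
      (fun t₀ => lineBound_one.tendsto (hF l) t₀)
    choose J hJc hJv using hJl
    have hcont : Continuous fun t : ℝ => T fun l => J l (t / 2) :=
      T.cont.comp (continuous_pi fun l => (hJc l).comp (by fun_prop))
    intro t₀
    have := tendsto_intENorm_sub hcont t₀
    simp only [hT, hJv, ← ehalf] at this
    exact this

end

lemma exists_admissible {m : ℕ} {θ M : ℝ} {f : L2} (h : interpENorm m θ f < ENNReal.ofReal M) :
    ∃ F, Admissible m F ∧ F θ = f ∧ (∀ t : ℝ, ‖F (t * I)‖ ≤ M) ∧
      ∀ t : ℝ, intENorm m (F (1 + t * I)) ≤ ENNReal.ofReal M := by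
  have hM : 0 < M := ENNReal.ofReal_pos.1 (zero_le.trans_lt h)
  simp only [interpENorm, iInf_lt_iff] at h
  obtain ⟨F, ⟨hF, hθ⟩, hlt⟩ := h
  refine ⟨F, hF, hθ, fun t => ?_, fun t => ?_⟩
  · have h2 := (le_iSup (fun t : ℝ => ‖F (t * I)‖ₑ) t).trans ((le_max_left _ _).trans hlt.le)
    rwa [← ofReal_norm, ENNReal.ofReal_le_ofReal_iff hM.le] at h2
  · exact (le_iSup (fun t : ℝ => intENorm m (F (1 + t * I))) t).trans
      ((le_max_right _ _).trans hlt.le)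

/-- Comparison of the two couples: the part `0 ≤ Re z ≤ 2/3` of the strip for `(L₂, W³_2)` is the
strip for `(L₂, W²_2)`. -/
lemma interpENorm_two_le {θ M : ℝ} {g : L2} (h : interpENorm 3 θ g < ENNReal.ofReal M) :
    interpENorm 2 (3 * θ / 2) g ≤ ENNReal.ofReal (3 * (Real.exp 1 * (252000 * M))) := by
  have hM : 0 < M := ENNReal.ofReal_pos.1 (zero_le.trans_lt h)
  obtain ⟨F, hF, hθ, h0, h1⟩ := exists_admissible h
  obtain ⟨hd, hb⟩ := strip_comp hF.diffContOnCl hF.bounded (c := 0) (d := 2 / 3) le_rfl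
    (by norm_num) (by norm_num) 0
  have e : ∀ z : ℂ, ((0 : ℝ) : ℂ) + ((2 / 3 : ℝ) : ℂ) * z + ((0 : ℝ) : ℂ) * I = 2 * z / 3 :=
    fun z => by
      push_cast
      ring
  simp only [e] at hd hb
  have e1 : ∀ t : ℝ, 2 * (1 + t * I : ℂ) / 3 = (2 / 3 : ℝ) + ((2 / 3 * t : ℝ) : ℂ) * I :=
    fun t => by
      push_cast
      ring
  have key := interpENorm_le (m := 2) (θ := 3 * θ / 2) (M := 252000 * M)
    (F := fun z => F (2 * z / 3)) (by positivity) hd hb (fun t => ?_) (fun t => ?_) fun t₀ => ?_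
  · have e2 : 2 * ((3 * θ / 2 : ℝ) : ℂ) / 3 = θ := by push_cast; ring
    rw [e2, hθ] at key
    refine key.trans_eq ?_
    norm_num
  · have := h0 (2 / 3 * t)
    rw [show ((2 / 3 * t : ℝ) : ℂ) * I = 2 * (t * I) / 3 by push_cast; ring] at this
    exact this.trans (by linarith)
  · rw [e1]
    exact lineBound_two.le hF hM h0 h1 _
  · simp only [e1]
    exact (lineBound_two.tendsto hF (2 / 3 * t₀)).comp
      (Continuous.tendsto (f := fun t : ℝ => 2 / 3 * t) (by fun_prop) t₀)

lemma intENorm_two_le_of_interp {M : ℝ} {g : L2}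
    (h : interpENorm 3 (2 / 3) g < ENNReal.ofReal M) :
    intENorm 2 g ≤ ENNReal.ofReal (252000 * M) := by
  have hM : 0 < M := ENNReal.ofReal_pos.1 (zero_le.trans_lt h)
  obtain ⟨F, hF, hθ, h0, h1⟩ := exists_admissible h
  have := lineBound_two.le hF hM h0 h1 0
  simpa [← hθ] using this

open HadamardThreeLines

/-! ### The estimates in the norms of the scale -/

lemma sobolevENorm_zero (f : L2) : sobolevENorm 0 f = ‖f‖ₑ := by simp [sobolevENorm]

lemma sobolevENorm_of_lt_two {s : ℝ} (h0 : 0 < s) (h2 : s < 2) (f : L2) :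
    sobolevENorm s f = interpENorm 2 (s / 2) f := by
  have h : max 2 ⌈s⌉₊ = 2 := max_eq_left (Nat.ceil_le.2 (by exact_mod_cast h2.le))
  rw [sobolevENorm, h, if_neg h0.ne', if_neg (by exact_mod_cast h2.ne)]
  norm_num

lemma sobolevENorm_two (f : L2) : sobolevENorm 2 f = intENorm 2 f := by
  simp [sobolevENorm]

lemma sobolevENorm_of_lt_three {s : ℝ} (h2 : 2 < s) (h3 : s < 3) (f : L2) :
    sobolevENorm s f = interpENorm 3 (s / 3) f := by
  have hc : ⌈s⌉₊ = 3 := (Nat.ceil_eq_iff (by norm_num)).2 ⟨by norm_num; exact h2, by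
    exact_mod_cast h3.le⟩
  have h : max 2 ⌈s⌉₊ = 3 := by rw [hc]; rfl
  rw [sobolevENorm, h, if_neg (by linarith), if_neg (by exact_mod_cast h3.ne)]
  norm_num

lemma sobolevENorm_three (f : L2) : sobolevENorm 3 f = intENorm 3 f := by
  simp [sobolevENorm]

lemma jetBound_two {k : ℕ} (hk : 1 ≤ k) :
    JetBound 2 k hk fun K => 16 * (1 + K) ^ 2 * wt (k - 4) :=
  fun _ _ _ _ hK h hf hf' => exists_isWeakJet_two hk hK h hf hf'

lemma jetBound_three {k : ℕ} (hk3 : 3 ≤ k) (hk : 1 ≤ k) :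
    JetBound 3 k hk fun K => 100 * (1 + K) ^ 4 * wt (k - 6) :=
  fun _ _ _ _ hK h hf hf' => exists_isWeakJet_three hk3 hk hK h hf hf'

section

variable {α : ℝ} {k : ℕ} {f : Fin (k + 1) → L2} {M : Fin (k + 1) → ℝ}

lemma exists_admissible_of_sobolevENorm (h0 : 0 < α) (h1 : α ≤ 1)
    (hf : ∀ l, sobolevENorm α (f l) < ENNReal.ofReal (M l)) :
    ∃ F : Fin (k + 1) → ℂ → L2, (∀ l, Admissible 2 (F l)) ∧
      (f = fun l => F l ((α / 2 : ℝ) : ℂ)) ∧ (∀ l, 0 < M l) ∧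
      (∀ l, ∀ t : ℝ, ‖F l (t * I)‖ ≤ M l) ∧
      ∀ l, ∀ t : ℝ, intENorm 2 (F l (1 + t * I)) ≤ ENNReal.ofReal (M l) := by
  simp only [sobolevENorm_of_lt_two h0 (h1.trans_lt one_lt_two)] at hf
  choose F hF hθ h2 h3 using fun l => exists_admissible (hf l)
  exact ⟨F, hF, funext fun l => (hθ l).symm,
    fun l => ENNReal.ofReal_pos.1 (zero_le.trans_lt (hf l)), h2, h3⟩

lemma interpENorm_Iop_le_of_sobolevENorm {m : ℕ} {hk : 1 ≤ k} {c : ℝ → ℝ}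
    (hJ : JetBound m k hk c) (hc : wt k ≤ c 42) (h0 : 0 < α) (h1 : α ≤ 1)
    (hf : ∀ l, sobolevENorm α (f l) < ENNReal.ofReal (M l)) :
    interpENorm m α (Iop k hk f) ≤
      ENNReal.ofReal ((m + 1) * (Real.exp 1 * ((m + 1) * (c 42 * ∏ l, M l)))) := by
  obtain ⟨F, hF, rfl, hM, h2, h3⟩ := exists_admissible_of_sobolevENorm h0 h1 hf
  exact interpENorm_Iop_le hJ hc hF hM h2 h3 α

lemma intENorm_Iop_le_of_sobolevENorm {m : ℕ} {hk : 1 ≤ k} {c : ℝ → ℝ}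
    (hJ : JetBound m k hk c) (hf : ∀ l, sobolevENorm 1 (f l) < ENNReal.ofReal (M l)) :
    intENorm m (Iop k hk f) ≤ ENNReal.ofReal ((m + 1) * (c 42 * ∏ l, M l)) := by
  obtain ⟨F, hF, rfl, hM, h2, h3⟩ := exists_admissible_of_sobolevENorm one_pos le_rfl hf
  simpa using intENorm_Iop_le hJ hF hM h2 h3 0

lemma prod_pos_of_sobolevENorm_lt (hf : ∀ l, sobolevENorm α (f l) < ENNReal.ofReal (M l)) :
    0 < ∏ l, M l :=
  Finset.prod_pos fun l _ => ENNReal.ofReal_pos.1 (zero_le.trans_lt (hf l))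

lemma sobolevENorm_two_mul_le (hk : 1 ≤ k) (h0 : 0 < α) (h1 : α ≤ 1)
    (hf : ∀ l, sobolevENorm α (f l) < ENNReal.ofReal (M l)) :
    sobolevENorm (2 * α) (Iop k hk f) ≤
      ENNReal.ofReal (3 * (Real.exp 1 * (3 * (16 * (1 + 42) ^ 2))) * wt (k - 4) * ∏ l, M l) := by
  have hP := prod_pos_of_sobolevENorm_lt hf
  have hw := wt_pos (k - 4)
  have he : 1 ≤ Real.exp 1 := Real.one_le_exp zero_le_one
  have hc : wt k ≤ 16 * (1 + 42) ^ 2 * wt (k - 4) := by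
    have := wt_anti (Nat.sub_le k 4)
    linarith
  rcases h1.lt_or_eq with h1' | rfl
  · rw [sobolevENorm_of_lt_two (by linarith) (by linarith), mul_div_cancel_left₀ _ two_ne_zero]
    refine (interpENorm_Iop_le_of_sobolevENorm (jetBound_two hk) hc h0 h1 hf).trans_eq ?_
    congr 1
    push_cast
    ring
  · rw [mul_one, sobolevENorm_two]
    refine (intENorm_Iop_le_of_sobolevENorm (jetBound_two hk) hf).trans
      (ENNReal.ofReal_le_ofReal ?_)
    have := mul_pos hw hP
    push_cast
    nlinarith

/-- The constant in the estimate with three times the regularity. -/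
def constThree : ℝ := 3 * (Real.exp 1 * (252000 * (2 * (4 * (Real.exp 1 * (4 * (100 * 43 ^ 4)))))))

lemma sobolevENorm_three_mul_le (hk3 : 3 ≤ k) (hk : 1 ≤ k) (h0 : 0 < α) (h1 : α ≤ 1)
    (hf : ∀ l, sobolevENorm α (f l) < ENNReal.ofReal (M l)) :
    sobolevENorm (3 * α) (Iop k hk f) ≤
      ENNReal.ofReal (constThree * wt (k - 6) * ∏ l, M l) := by
  have hP := prod_pos_of_sobolevENorm_lt hf
  have hw := wt_pos (k - 6)
  have he : 1 ≤ Real.exp 1 := Real.one_le_exp zero_le_one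
  have hc : wt k ≤ 100 * (1 + 42) ^ 4 * wt (k - 6) := by
    have := wt_anti (Nat.sub_le k 6)
    linarith
  have hwP := mul_pos hw hP
  set B : ℝ := 4 * (Real.exp 1 * (4 * (100 * 43 ^ 4))) * (wt (k - 6) * ∏ l, M l) with hB
  have hB0 : 0 < B := by positivity
  have hCB : constThree * wt (k - 6) * ∏ l, M l = 3 * (Real.exp 1 * (252000 * (2 * B))) := by
    rw [hB, constThree]
    ring
  have heB : B ≤ Real.exp 1 * B := le_mul_of_one_le_left hB0.le he
  have hI : interpENorm 3 α (Iop k hk f) ≤ ENNReal.ofReal B := by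
    refine (interpENorm_Iop_le_of_sobolevENorm (jetBound_three hk3 hk) hc h0 h1 hf).trans_eq ?_
    congr 1
    rw [hB]
    push_cast
    ring
  have hI2 : interpENorm 3 α (Iop k hk f) < ENNReal.ofReal (2 * B) :=
    hI.trans_lt ((ENNReal.ofReal_lt_ofReal_iff (by positivity)).2 (by linarith))
  rw [hCB]
  rcases lt_trichotomy α (2 / 3) with h | rfl | h
  · rw [sobolevENorm_of_lt_two (by linarith) (by linarith)]
    exact interpENorm_two_le hI2
  · rw [show (3 : ℝ) * (2 / 3) = 2 by norm_num, sobolevENorm_two]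
    refine (intENorm_two_le_of_interp hI2).trans (ENNReal.ofReal_le_ofReal ?_)
    linarith
  · rcases h1.lt_or_eq with h1' | rfl
    · rw [sobolevENorm_of_lt_three (by linarith) (by linarith),
        mul_div_cancel_left₀ _ three_ne_zero]
      exact hI.trans (ENNReal.ofReal_le_ofReal (by linarith))
    · rw [mul_one, sobolevENorm_three]
      refine (intENorm_Iop_le_of_sobolevENorm (jetBound_three hk3 hk) hf).trans
        (ENNReal.ofReal_le_ofReal ?_)
      have : 4 * (100 * 43 ^ 4) * (wt (k - 6) * ∏ l, M l) ≤ B := by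
        have := le_mul_of_one_le_left hwP.le he
        rw [hB]
        linarith
      push_cast
      linarith

end

lemma le_ofReal_mul_prod {ι : Type*} [Fintype ι] {G : ℝ≥0∞} {C : ℝ} {w : ι → ℝ}
    (h : ∀ M : ι → ℝ, (∀ l, w l < M l) → G ≤ ENNReal.ofReal (C * ∏ l, M l)) :
    G ≤ ENNReal.ofReal (C * ∏ l, w l) := by
  have hc : Continuous fun ε : ℝ => ENNReal.ofReal (C * ∏ l, (w l + ε)) :=
    ENNReal.continuous_ofReal.comp (by fun_prop)
  have hlim : Tendsto (fun ε : ℝ => ENNReal.ofReal (C * ∏ l, (w l + ε))) (𝓝[>] 0)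
      (𝓝 (ENNReal.ofReal (C * ∏ l, w l))) := by
    simpa using (hc.tendsto 0).mono_left nhdsWithin_le_nhds
  refine ge_of_tendsto hlim ?_
  filter_upwards [self_mem_nhdsWithin] with ε hε
  exact h _ fun l => lt_add_of_pos_right _ hε

/-- The estimates for functions of finite norm, from those with arbitrary larger bounds. -/
lemma sobolevENorm_Iop_le {α s C : ℝ} {k j : ℕ} {hk : 1 ≤ k}
    (hs : α = 0 → s = 0) (hα : 0 ≤ α) (hC : 1 ≤ C) (hj : j ≤ k)
    (H : 0 < α → ∀ (f : Fin (k + 1) → L2) (M : Fin (k + 1) → ℝ),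
      (∀ l, sobolevENorm α (f l) < ENNReal.ofReal (M l)) →
      sobolevENorm s (Iop k hk f) ≤ ENNReal.ofReal (C * wt j * ∏ l, M l))
    {f : Fin (k + 1) → L2} (hf : ∀ l, sobolevENorm α (f l) < ⊤) :
    sobolevENorm s (Iop k hk f) ≤
      ENNReal.ofReal (C * wt j * ∏ l, (sobolevENorm α (f l)).toReal) := by
  rcases hα.eq_or_lt with h0 | h0
  · rw [hs h0.symm, ← h0]
    simp only [sobolevENorm_zero, toReal_enorm]
    rw [← ofReal_norm]
    refine ENNReal.ofReal_le_ofReal ((norm_Iop_le hk f).trans ?_)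
    refine mul_le_mul_of_nonneg_right ?_ (Finset.prod_nonneg fun _ _ => norm_nonneg _)
    exact (wt_anti hj).trans (le_mul_of_one_le_left (wt_pos j).le hC)
  · refine le_ofReal_mul_prod fun M hM => H h0 f M fun l => ?_
    exact (ENNReal.lt_ofReal_iff_toReal_lt (hf l).ne).2 (hM l)

lemma exists_of_memW {s : ℝ} {u : ℝ → ℂ} (h : MemW s u) :
    ∃ hu : MemLp u 2 μ, wENorm s u = sobolevENorm s (hu.toLp u) := by
  by_cases hu : MemLp u 2 μ
  · exact ⟨hu, iInf_pos hu⟩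
  · simp [MemW, wENorm, hu] at h

/-- The passage from estimates for classes to estimates for functions. -/
lemma memW_In {α s C : ℝ} (hC : 0 ≤ C) {k j : ℕ} (hk : 1 ≤ k)
    (H : ∀ f : Fin (k + 1) → L2, (∀ l, sobolevENorm α (f l) < ⊤) →
      sobolevENorm s (Iop k hk f) ≤
        ENNReal.ofReal (C * wt j * ∏ l, (sobolevENorm α (f l)).toReal))
    {f : Fin (k + 1) → ℝ → ℂ} (hf : ∀ l, MemW α (f l)) :
    MemW s (In (k + 1) f) ∧
      wNorm s (In (k + 1) f) ≤ C / √(j.factorial : ℝ) * ∏ l, wNorm α (f l) := by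
  choose hm he using fun l => exists_of_memW (hf l)
  have key := H (fun l => (hm l).toLp (f l)) fun l => (he l).symm.trans_lt (hf l)
  rw [Iop_toLp] at key
  have e : wENorm s (In (k + 1) f) = sobolevENorm s ((memLp_In hk hm).1.toLp (In (k + 1) f)) :=
    iInf_pos (memLp_In hk hm).1
  simp only [← he, ← e] at key
  refine ⟨key.trans_lt ENNReal.ofReal_lt_top, ?_⟩
  refine ENNReal.toReal_le_of_le_ofReal ?_ (key.trans_eq ?_)
  · exact mul_nonneg (by positivity) (Finset.prod_nonneg fun _ _ => ENNReal.toReal_nonneg)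
  · rw [wt, mul_one_div]
    rfl

end IntervalSobolev

end

theorem theorem4p2 (α : ℝ) (hα : α ∈ Set.Icc (0 : ℝ) 1) :
    (∃ C : ℝ, 0 < C ∧ ∀ n : ℕ, 2 ≤ n → ∀ f : Fin n → ℝ → ℂ,
      (∀ l, IntervalSobolev.MemW α (f l)) →
        (∀ᵐ s ∂IntervalSobolev.μ, IntegrableOn (IntervalSobolev.integrand n f s)
          (IntervalSobolev.PiStar (n - 1) s)) ∧
        IntervalSobolev.MemW (2 * α) (IntervalSobolev.In n f) ∧
        IntervalSobolev.wNorm (2 * α) (IntervalSobolev.In n f) ≤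
          C / √((n - 5).factorial : ℝ) * ∏ l, IntervalSobolev.wNorm α (f l)) ∧
    (∃ C : ℝ, 0 < C ∧ ∀ n : ℕ, 4 ≤ n → ∀ f : Fin n → ℝ → ℂ,
      (∀ l, IntervalSobolev.MemW α (f l)) →
        IntervalSobolev.MemW (3 * α) (IntervalSobolev.In n f) ∧
        IntervalSobolev.wNorm (3 * α) (IntervalSobolev.In n f) ≤
          C / √((n - 7).factorial : ℝ) * ∏ l, IntervalSobolev.wNorm α (f l)) := by
  open IntervalSobolev in
  have he : 1 ≤ Real.exp 1 := Real.one_le_exp zero_le_one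
  have h2 : 1 ≤ 3 * (Real.exp 1 * (3 * (16 * (1 + 42) ^ 2))) := by linarith
  have h3 : 1 ≤ constThree := by
    unfold constThree
    have : 1 ≤ Real.exp 1 * Real.exp 1 := one_le_mul_of_one_le_of_one_le he he
    linarith
  refine ⟨⟨_, one_pos.trans_le h2, fun n hn f hf => ?_⟩,
    ⟨_, one_pos.trans_le h3, fun n hn f hf => ?_⟩⟩
  · obtain ⟨k, rfl⟩ := Nat.exists_eq_add_of_le' (one_le_two.trans hn)
    have hk : 1 ≤ k := by omega
    refine ⟨?_, memW_In (zero_le_one.trans h2) hk (fun g hg => ?_) hf⟩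
    · choose hm _ using fun l => exists_of_memW (hf l)
      filter_upwards [ae_restrict_of_ae (ae_integrableOn hk hm)] with s hs
      rwa [region_zero hk] at hs
    · exact sobolevENorm_Iop_le (fun h => by rw [h, mul_zero]) hα.1 h2 (by omega)
        (fun h0 g M hg => sobolevENorm_two_mul_le hk h0 hα.2 hg) hg
  · obtain ⟨k, rfl⟩ := Nat.exists_eq_add_of_le' ((by norm_num : 1 ≤ 4).trans hn)
    have hk : 1 ≤ k := by omega
    refine memW_In (zero_le_one.trans h3) hk (fun g hg => ?_) hf
    exact sobolevENorm_Iop_le (fun h => by rw [h, mul_zero]) hα.1 h3 (by omega)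
      (fun h0 g M hg => sobolevENorm_three_mul_le (by omega) hk h0 hα.2 hg) hg
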